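/- Let $M$ be a complete (connected, second countable) smooth Riemannian manifold of dimension $n$, with Riemannian measure $dx$ and Levi-Civita connection $\nabla$. Let $\square = dd^*+d^*d$ be the de Rham-Hodge Laplacian, acting on vector fields through the metric identification with 1-forms. Assume that there is a constant $\kappa\in\mathbb R$ with $\mathrm{Ric}\ge-\kappa$, i.e. $\mathrm{Ric}(v,v)\ge-\kappa|v|^2$ for all tangent vectors $v$. Let $\nu>0$ and let $(u,p)$ be a solution, smooth on $[0,T]\times M$, of the Navier-Stokes equation $$\partial_t u_t+\nabla_{u_t}u_t+\nu\,\square u_t=-\nabla p_t,\qquad \mathrm{div}(u_t)=0,\qquad u|_{t=0}=u_0 ,$$ such that $$\int_0^T\!\int_M|u_t|^2\,dx\,dt<\infty\quad\text{and}\quad \int_0^T\!\int_M\Bigl|\bigl(\tfrac12|u_t|^2+p_t\bigr)u_t\Bigr|\,dx\,dt<\infty$$ (both hold automatically when $M$ is compact). Then, for every $t\in[0,T]$, $$\frac12\|u_t\|_2^2+\nu\int_0^t\|\nabla u_s\|_2^2\,ds\le\frac12\|u_0\|_2^2\,\exp(2\nu t\kappa^+),\qquad \kappa^+=\sup\{\kappa,0\},$$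 where $\|\cdot\|_2$ is the $L^2$ norm and $|\nabla u|$ is the pointwise Hilbert-Schmidt norm; both sides are read in $[0,\infty]$ (so if $u_0\in L^2$ then the left-hand side is finite). -/

import Mathlib

open Bundle Manifold MeasureTheory Set
open scoped ContDiff

noncomputable section

namespace RiemNS

variable {n : ℕ} {M : Type*} [TopologicalSpace M]
  [ChartedSpace (EuclideanSpace ℝ (Fin n)) M] [IsManifold (𝓡 n) ∞ M]
  [RiemannianBundle (fun x : M ↦ TangentSpace (𝓡 n) x)]

/-- Vector fields (no regularity imposed) on the `n`-dimensional manifold `M`. -/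
abbrev VField (n : ℕ) (M : Type*) [TopologicalSpace M]
    [ChartedSpace (EuclideanSpace ℝ (Fin n)) M] : Type _ :=
  (x : M) → TangentSpace (𝓡 n) x

instance finiteDimensional_tangentSpace (x : M) :
    FiniteDimensional ℝ (TangentSpace (𝓡 n) x) :=
  inferInstanceAs (FiniteDimensional ℝ (EuclideanSpace ℝ (Fin n)))

/-- An orthonormal basis of the tangent space at `x`. -/
def frame (x : M) :
    OrthonormalBasis (Fin (Module.finrank ℝ (TangentSpace (𝓡 n) x))) ℝ (TangentSpace (𝓡 n) x) :=
  stdOrthonormalBasis ℝ (TangentSpace (𝓡 n) x)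

/-- A vector field, smooth near `x`, with the value `v` at `x`. -/
def ext {x : M} (v : TangentSpace (𝓡 n) x) : VField n M :=
  FiberBundle.extend (EuclideanSpace ℝ (Fin n)) v

/-- The Koszul expression for `⟨∇_X Y, Z⟩` at `x`. -/
def koszul (X Y Z : VField n M) (x : M) : ℝ :=
  (1 / 2) *
    (mvfderiv (𝓡 n) (fun y ↦ inner ℝ (Y y) (Z y)) x (X x)
      + mvfderiv (𝓡 n) (fun y ↦ inner ℝ (Z y) (X y)) x (Y x)
      - mvfderiv (𝓡 n) (fun y ↦ inner ℝ (X y) (Y y)) x (Z x)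
      + inner ℝ (VectorField.mlieBracket (𝓡 n) X Y x) (Z x)
      - inner ℝ (VectorField.mlieBracket (𝓡 n) Y Z x) (X x)
      + inner ℝ (VectorField.mlieBracket (𝓡 n) Z X x) (Y x))

/-- The Levi-Civita derivative: `nabla Y x v` is `∇_v Y`. -/
def nabla (Y : VField n M) (x : M) : TangentSpace (𝓡 n) x →L[ℝ] TangentSpace (𝓡 n) x :=
  ∑ i, ∑ j, koszul (ext (frame x i)) Y (ext (frame x j)) x •
    (innerSL ℝ (frame x i)).smulRight (frame x j)

/-- The curvature `R(X, Y) Z = ∇_X ∇_Y Z - ∇_Y ∇_X Z - ∇_{[X, Y]} Z`. -/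
def curvature (X Y Z : VField n M) : VField n M := fun x ↦
  nabla (fun y ↦ nabla Z y (Y y)) x (X x) - nabla (fun y ↦ nabla Z y (X y)) x (Y x)
    - nabla Z x (VectorField.mlieBracket (𝓡 n) X Y x)

/-- The Ricci tensor `Ric(v, w) = ∑ᵢ ⟨R(eᵢ, v) w, eᵢ⟩`. -/
def ricci (x : M) (v w : TangentSpace (𝓡 n) x) : ℝ :=
  ∑ i, inner ℝ (curvature (ext (frame x i)) (ext v) (ext w) x) (frame x i)

/-- The lower bound `Ric ≥ -κ`. -/
def RicciBoundedBelow (n : ℕ) (M : Type*) [TopologicalSpace M]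
    [ChartedSpace (EuclideanSpace ℝ (Fin n)) M] [IsManifold (𝓡 n) ∞ M]
    [RiemannianBundle (fun x : M ↦ TangentSpace (𝓡 n) x)] (κ : ℝ) : Prop :=
  ∀ (x : M) (v : TangentSpace (𝓡 n) x), -κ * ‖v‖ ^ 2 ≤ ricci x v v

/-- The divergence `div u = tr ∇u`. -/
def divergence (u : VField n M) (x : M) : ℝ :=
  ∑ i, inner ℝ (nabla u x (frame x i)) (frame x i)

/-- The gradient of a function. -/
def gradient (f : M → ℝ) (x : M) : TangentSpace (𝓡 n) x :=
  ∑ i, mvfderiv (𝓡 n) f x (frame x i) • frame x i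

/-- Differential `1`-forms (no regularity imposed). -/
abbrev OneForm (n : ℕ) (M : Type*) [TopologicalSpace M]
    [ChartedSpace (EuclideanSpace ℝ (Fin n)) M] : Type _ :=
  (x : M) → TangentSpace (𝓡 n) x → ℝ

/-- Fields of bilinear forms; `2`-forms are among them. -/
abbrev TwoForm (n : ℕ) (M : Type*) [TopologicalSpace M]
    [ChartedSpace (EuclideanSpace ℝ (Fin n)) M] : Type _ :=
  (x : M) → TangentSpace (𝓡 n) x → TangentSpace (𝓡 n) x → ℝ

/-- The `1`-form `⟨u, ·⟩` of a vector field `u`. -/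
def flat (u : VField n M) : OneForm n M := fun x v ↦ inner ℝ (u x) v

/-- The vector field `α♯` of a `1`-form `α`. -/
def sharp (α : OneForm n M) : VField n M := fun x ↦ ∑ i, α x (frame x i) • frame x i

/-- The differential of a function, as a `1`-form. -/
def dFun (f : M → ℝ) : OneForm n M := fun x v ↦ mvfderiv (𝓡 n) f x v

/-- The exterior derivative of a `1`-form,
`dα(v, w) = V(α(W)) - W(α(V)) - α([V, W])`. -/
def dOne (α : OneForm n M) : TwoForm n M := fun x v w ↦
  mvfderiv (𝓡 n) (fun y ↦ α y (ext w y)) x v - mvfderiv (𝓡 n) (fun y ↦ α y (ext v y)) x w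
    - α x (VectorField.mlieBracket (𝓡 n) (ext v) (ext w) x)

/-- `(∇_v α)(a)` for a `1`-form `α`. -/
def nablaOne (α : OneForm n M) (x : M) (v a : TangentSpace (𝓡 n) x) : ℝ :=
  mvfderiv (𝓡 n) (fun y ↦ α y (ext a y)) x v - α x (nabla (ext a) x v)

/-- `(∇_v β)(a, b)` for a `2`-form `β`. -/
def nablaTwo (β : TwoForm n M) (x : M) (v a b : TangentSpace (𝓡 n) x) : ℝ :=
  mvfderiv (𝓡 n) (fun y ↦ β y (ext a y) (ext b y)) x v
    - β x (nabla (ext a) x v) b - β x a (nabla (ext b) x v)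

/-- The codifferential `d*` on `1`-forms (the formal adjoint of `d`). -/
def codiffOne (α : OneForm n M) (x : M) : ℝ :=
  -∑ i, nablaOne α x (frame x i) (frame x i)

/-- The codifferential `d*` on `2`-forms (the formal adjoint of `d`). -/
def codiffTwo (β : TwoForm n M) : OneForm n M := fun x v ↦
  -∑ i, nablaTwo β x (frame x i) (frame x i) v

/-- The de Rham-Hodge Laplacian `□ = d d* + d* d` on vector fields,
through the identification of vector fields with `1`-forms. -/
def hodgeLaplacian (u : VField n M) : VField n M :=
  sharp fun x v ↦ dFun (codiffOne (flat u)) x v + codiffTwo (dOne (flat u)) x v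

/-- The matrix `(g_ij)` of the metric, at the point `y` of the chart centred at `c`. -/
def chartMetric (c : M) (y : EuclideanSpace ℝ (Fin n)) : Matrix (Fin n) (Fin n) ℝ :=
  Matrix.of fun i j ↦ inner ℝ
    (mfderiv 𝓘(ℝ, EuclideanSpace ℝ (Fin n)) (𝓡 n) (extChartAt (𝓡 n) c).symm y
      (EuclideanSpace.single i (1 : ℝ)))
    (mfderiv 𝓘(ℝ, EuclideanSpace ℝ (Fin n)) (𝓡 n) (extChartAt (𝓡 n) c).symm y
      (EuclideanSpace.single j (1 : ℝ)))

/-- The measure `√(det g) dy` on the domain of the chart centred at `c`, extended by zero. -/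
def chartVolume [MeasurableSpace M] (c : M) : Measure M :=
  Measure.map (extChartAt (𝓡 n) c).symm
    ((volume.restrict (extChartAt (𝓡 n) c).target).withDensity
      fun y ↦ ENNReal.ofReal (Real.sqrt (chartMetric c y).det))

/-- The Riemannian measure. The measures `chartVolume c` are its restrictions to the chart
domains, and on a second countable manifold it is their supremum. -/
def vol (n : ℕ) (M : Type*) [TopologicalSpace M]
    [ChartedSpace (EuclideanSpace ℝ (Fin n)) M] [IsManifold (𝓡 n) ∞ M]
    [RiemannianBundle (fun x : M ↦ TangentSpace (𝓡 n) x)] [MeasurableSpace M] : Measure M :=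
  ⨆ c : M, chartVolume (n := n) c

/-- `‖u‖₂²`, with the value `∞` when `u` is not in `L²`. -/
def normSq [MeasurableSpace M] (u : VField n M) : ENNReal :=
  ∫⁻ x, ENNReal.ofReal (‖u x‖ ^ 2) ∂(vol n M)

/-- `‖∇u‖₂²`, with the pointwise Hilbert-Schmidt norm `|∇u|² = ∑ᵢ |∇_{eᵢ} u|²`. -/
def gradNormSq [MeasurableSpace M] (u : VField n M) : ENNReal :=
  ∫⁻ x, ENNReal.ofReal (∑ i, ‖nabla u x (frame x i)‖ ^ 2) ∂(vol n M)

/-- `(u, p)` is smooth on `[0, T] × M` and solves the Navier-Stokes equation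
`∂ₜ u + ∇_u u + ν □ u = -∇p`, `div u = 0`, with `u = u₀` at time `0`. -/
structure IsSmoothSolution (ν T : ℝ) (u₀ : VField n M) (u : ℝ → VField n M) (p : ℝ → M → ℝ) :
    Prop where
  smooth_velocity : ContMDiffOn (𝓘(ℝ, ℝ).prod (𝓡 n)) (𝓡 n).tangent ∞
    (fun q : ℝ × M ↦ (⟨q.2, u q.1 q.2⟩ : TangentBundle (𝓡 n) M)) (Icc 0 T ×ˢ univ)
  smooth_pressure : ContMDiffOn (𝓘(ℝ, ℝ).prod (𝓡 n)) 𝓘(ℝ, ℝ) ∞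
    (fun q : ℝ × M ↦ p q.1 q.2) (Icc 0 T ×ˢ univ)
  momentum : ∀ t ∈ Icc 0 T, ∀ x : M,
    derivWithin (fun s ↦ u s x) (Icc 0 T) t + nabla (u t) x (u t x) + ν • hodgeLaplacian (u t) x
      = -gradient (p t) x
  incompressible : ∀ t ∈ Icc 0 T, ∀ x : M, divergence (u t) x = 0
  initial : u 0 = u₀

/-- The kinetic energy is integrable in time on `[0, T]`, and the energy flux
`(|u|² / 2 + p) u` is integrable on `[0, T] × M`. -/
structure HasIntegrableEnergy [MeasurableSpace M] (T : ℝ) (u : ℝ → VField n M)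
    (p : ℝ → M → ℝ) : Prop where
  energy : ∫⁻ t in Icc 0 T, normSq (u t) < ⊤
  flux : ∫⁻ t in Icc 0 T, ∫⁻ x,
    ENNReal.ofReal ‖(‖u t x‖ ^ 2 / 2 + p t x) • u t x‖ ∂(vol n M) < ⊤

end RiemNS

end

/-! Pairing the equation with `u` and using the Bochner-Weitzenböck formula ⟨□u, u⟩ = |∇u|² -
Δ|u|²/2 + Ric(u, u), valid for divergence free `u`, gives the pointwise identity ∂ₜ(|u|²/2) = -div J
- ν|∇u|² - ν Ric(u, u) with the current J = (|u|²/2 + p)u - ν∇(|u|²/2) (`inner_hodgeLaplacian`,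
`inner_eq_of_momentum`). If div J integrated to zero, the bound on Ric and Gronwall's inequality
would conclude.

In general the identity is tested against χ², where χ is a cutoff built from the distance: 1 on a
ball of radius R, 0 outside the ball of radius 2R, Lipschitz with constant L = 1/R. By Hopf-Rinow
(`isCompact_closedBall_of_complete`) these balls are compact, so all localized integrals are finite.
Integration by parts gives |∫χ² div J| ≤ 2L∫χ|J| (`abs_integral_sq_mul_divergence_le`). The square
is essential: |∇(|u|²/2)| ≤ |∇u||u| and 2χ|∇u||u| ≤ χ²|∇u|² + |u|², so the gradient part of the
error, with its factor νL, is absorbed by the dissipation and no integrability of ∇u is needed. What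
remains is L times the energy flux and L times the kinetic energy, both integrable by assumption.
Gronwall's inequality (`add_integral_le_mul_exp`) and R → ∞ (`energy_le`) finish the proof.

The geometric definitions use a Koszul expression, frames chosen point by point and extensions of
vectors, so their regularity is not visible. They are therefore computed in charts from the
Christoffel symbols of an `IsLocalMetric`, with `toE_nabla` as the bridge. Likewise `vol_apply`
identifies the Riemannian measure with √(det g) dy in each chart. Since the distance is only
Lipschitz, the integration by parts rests on Rademacher's theorem inside a chart and on a partition
of unity. -/

noncomputable section

namespace RiemNS

open scoped Topology

set_option maxSynthPendingDepth 3
set_option linter.unusedSectionVars false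
open ContinuousLinearMap (flipₗᵢ compL)

/-! ### Levi-Civita calculus of a metric on an open subset of a vector space. -/

section LocalMetric

variable {E : Type*} [NormedAddCommGroup E] [NormedSpace ℝ E]

/-- `g` is a smooth Riemannian metric on the open subset `Ω` of the vector space `E`. -/
structure IsLocalMetric (Ω : Set E) (g : E → E →L[ℝ] E →L[ℝ] ℝ) : Prop where
  isOpen : IsOpen Ω
  smooth : ContDiffOn ℝ ∞ g Ω
  symm : ∀ y ∈ Ω, ∀ v w, g y v w = g y w v
  pos : ∀ y ∈ Ω, ∀ v, v ≠ 0 → 0 < g y v v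

/-- The Christoffel symbols of the first kind. -/
def christoffelLower (g : E → E →L[ℝ] E →L[ℝ] ℝ) (y : E) : E →L[ℝ] E →L[ℝ] E →L[ℝ] ℝ :=
  (1 / 2 : ℝ) • (fderiv ℝ g y + (fderiv ℝ g y).flip
    - ((flipₗᵢ ℝ E E ℝ).toContinuousLinearEquiv : (E →L[ℝ] E →L[ℝ] ℝ) →L[ℝ] E →L[ℝ] E →L[ℝ] ℝ).comp
        (fderiv ℝ g y).flip)

/-- The Christoffel symbols (of the second kind). -/
def christoffel (g : E → E →L[ℝ] E →L[ℝ] ℝ) (y : E) : E →L[ℝ] E →L[ℝ] E :=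
  (compL ℝ E (E →L[ℝ] ℝ) E (g y).inverse).comp (christoffelLower g y)

/-- The covariant derivative of the vector field `u`, as a field of endomorphisms. -/
def cov (g : E → E →L[ℝ] E →L[ℝ] ℝ) (u : E → E) (y : E) : E →L[ℝ] E :=
  fderiv ℝ u y + (christoffel g y).flip (u y)

lemma christoffelLower_apply (g : E → E →L[ℝ] E →L[ℝ] ℝ) (y v w z : E) :
    christoffelLower g y v w z =
      (1 / 2) * (fderiv ℝ g y v w z + fderiv ℝ g y w v z - fderiv ℝ g y z v w) := by
  simp [christoffelLower]

lemma cov_apply (g : E → E →L[ℝ] E →L[ℝ] ℝ) (u : E → E) (y v : E) :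
    cov g u y v = fderiv ℝ u y v + christoffel g y v (u y) := by
  simp [cov]

lemma hasFDerivAt_bilin {g : E → E →L[ℝ] E →L[ℝ] ℝ} {X Y : E → E} {y : E}
    (hg : DifferentiableAt ℝ g y) (hX : DifferentiableAt ℝ X y) (hY : DifferentiableAt ℝ Y y) :
    DifferentiableAt ℝ (fun z ↦ g z (X z) (Y z)) y ∧
    ∀ v, fderiv ℝ (fun z ↦ g z (X z) (Y z)) y v
      = fderiv ℝ g y v (X y) (Y y) + g y (fderiv ℝ X y v) (Y y) + g y (X y) (fderiv ℝ Y y v) := by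
  have h := (hg.hasFDerivAt.clm_apply hX.hasFDerivAt).clm_apply hY.hasFDerivAt
  refine ⟨h.differentiableAt, fun v ↦ ?_⟩
  rw [h.fderiv]
  simp
  ring

namespace IsLocalMetric

variable {Ω : Set E} {g : E → E →L[ℝ] E →L[ℝ] ℝ} (hg : IsLocalMetric Ω g) {y : E}

lemma contDiffAt (hg : IsLocalMetric Ω g) (hy : y ∈ Ω) : ContDiffAt ℝ ∞ g y :=
  hg.smooth.contDiffAt (hg.isOpen.mem_nhds hy)

lemma differentiableAt (hg : IsLocalMetric Ω g) (hy : y ∈ Ω) : DifferentiableAt ℝ g y :=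
  (hg.contDiffAt hy).differentiableAt (by simp)

lemma contDiffAt_fderiv (hg : IsLocalMetric Ω g) (hy : y ∈ Ω) : ContDiffAt ℝ ∞ (fderiv ℝ g) y :=
  (hg.contDiffAt hy).fderiv_right (m := ∞) (by simp)

lemma mem_nhds (hg : IsLocalMetric Ω g) (hy : y ∈ Ω) : Ω ∈ 𝓝 y := hg.isOpen.mem_nhds hy

lemma fderiv_symm (hg : IsLocalMetric Ω g) (hy : y ∈ Ω) (a v w : E) :
    fderiv ℝ g y a v w = fderiv ℝ g y a w v := by
  have h1 := (hasFDerivAt_bilin (hg.differentiableAt hy) (differentiableAt_const v)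
    (differentiableAt_const w)).2 a
  have h2 := (hasFDerivAt_bilin (hg.differentiableAt hy) (differentiableAt_const w)
    (differentiableAt_const v)).2 a
  have : (fun z ↦ g z v w) =ᶠ[𝓝 y] fun z ↦ g z w v := by
    filter_upwards [hg.mem_nhds hy] with z hz using hg.symm z hz v w
  rw [this.fderiv_eq, h2] at h1
  simpa using h1.symm

/-- Positive definiteness makes the metric nondegenerate: pair with `v - w`. Identities between
vectors are checked below by lowering an index in this way. -/
lemma eq_of_forall (hg : IsLocalMetric Ω g) (hy : y ∈ Ω) {v w : E}
    (h : ∀ z, g y v z = g y w z) : v = w := by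
  by_contra hne
  have := hg.pos y hy (v - w) (sub_ne_zero.2 hne)
  have h1 := h (v - w)
  rw [map_sub (g y), _root_.sub_apply, h1] at this
  simp at this

lemma contDiffAt_christoffelLower (hg : IsLocalMetric Ω g) (hy : y ∈ Ω) :
    ContDiffAt ℝ ∞ (christoffelLower g) y := by
  have h := hg.contDiffAt_fderiv hy
  have hf : ContDiffAt ℝ ∞ (fun z ↦ (fderiv ℝ g z).flip) y :=
    (flipₗᵢ ℝ E E (E →L[ℝ] ℝ)).toContinuousLinearEquiv.contDiff.contDiffAt.comp y h
  exact ((h.add hf).sub (contDiffAt_const.clm_comp hf)).const_smul (1 / 2 : ℝ)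

variable [FiniteDimensional ℝ E]

/-- Injectivity and equality of dimensions. It guarantees that `inverse`, used to raise indices, is
never the default value 0. -/
lemma isInvertible (hg : IsLocalMetric Ω g) (hy : y ∈ Ω) : (g y).IsInvertible := by
  have hinj : Function.Injective (g y : E →ₗ[ℝ] (E →L[ℝ] ℝ)) := fun v w h ↦
    hg.eq_of_forall hy fun z ↦ congrArg (fun l : E →L[ℝ] ℝ ↦ l z) h
  have hdim : Module.finrank ℝ E = Module.finrank ℝ (E →L[ℝ] ℝ) := by
    rw [← (LinearMap.toContinuousLinearMap : (E →ₗ[ℝ] ℝ) ≃ₗ[ℝ] E →L[ℝ] ℝ).finrank_eq,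
      Module.finrank_linearMap, Module.finrank_self, mul_one]
  exact ⟨(LinearEquiv.ofInjectiveOfFinrankEq _ hinj hdim).toContinuousLinearEquiv, by ext; rfl⟩

lemma apply_inverse (hg : IsLocalMetric Ω g) (hy : y ∈ Ω) (l : E →L[ℝ] ℝ) :
    g y ((g y).inverse l) = l :=
  (hg.isInvertible hy).self_apply_inverse l

lemma contDiffAt_inverse (hg : IsLocalMetric Ω g) (hy : y ∈ Ω) :
    ContDiffAt ℝ ∞ (fun z ↦ (g z).inverse) y :=
  ((hg.isInvertible hy).contDiffAt_map_inverse).comp y (hg.contDiffAt hy)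

lemma contDiffAt_christoffel (hg : IsLocalMetric Ω g) (hy : y ∈ Ω) :
    ContDiffAt ℝ ∞ (christoffel g) y :=
  ((compL ℝ E (E →L[ℝ] ℝ) E).contDiff.contDiffAt.comp y (hg.contDiffAt_inverse hy)).clm_comp
    (hg.contDiffAt_christoffelLower hy)

lemma differentiableAt_christoffel (hg : IsLocalMetric Ω g) (hy : y ∈ Ω) :
    DifferentiableAt ℝ (christoffel g) y :=
  (hg.contDiffAt_christoffel hy).differentiableAt (by simp)

lemma christoffel_apply (hg : IsLocalMetric Ω g) (hy : y ∈ Ω) (v w z : E) :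
    g y (christoffel g y v w) z =
      (1 / 2) * (fderiv ℝ g y v w z + fderiv ℝ g y w v z - fderiv ℝ g y z v w) := by
  rw [← christoffelLower_apply]
  simp [christoffel, hg.apply_inverse hy]

lemma christoffel_symm (hg : IsLocalMetric Ω g) (hy : y ∈ Ω) (v w : E) :
    christoffel g y v w = christoffel g y w v :=
  hg.eq_of_forall hy fun z ↦ by
    rw [hg.christoffel_apply hy, hg.christoffel_apply hy, hg.fderiv_symm hy z v w]
    ring

/-- The Levi-Civita connection is compatible with the metric. -/
lemma fderiv_metric (hg : IsLocalMetric Ω g) (hy : y ∈ Ω) (a v w : E) :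
    fderiv ℝ g y a v w = g y (christoffel g y a v) w + g y v (christoffel g y a w) := by
  rw [hg.symm y hy v, hg.christoffel_apply hy, hg.christoffel_apply hy, hg.fderiv_symm hy a w v,
    hg.fderiv_symm hy v a w, hg.fderiv_symm hy w a v]
  ring

lemma fderiv_inner (hg : IsLocalMetric Ω g) (hy : y ∈ Ω) {X Y : E → E}
    (hX : DifferentiableAt ℝ X y) (hY : DifferentiableAt ℝ Y y) (v : E) :
    fderiv ℝ (fun z ↦ g z (X z) (Y z)) y v = g y (cov g X y v) (Y y) + g y (X y) (cov g Y y v) := by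
  rw [(hasFDerivAt_bilin (hg.differentiableAt hy) hX hY).2, hg.fderiv_metric hy, cov_apply, cov_apply]
  simp only [map_add, _root_.add_apply]
  ring

/-- The Christoffel terms cancel by symmetry: the connection has no torsion. -/
lemma lieBracket_eq_cov (hg : IsLocalMetric Ω g) (hy : y ∈ Ω) (X Y : E → E) :
    VectorField.lieBracket ℝ X Y y = cov g Y y (X y) - cov g X y (Y y) := by
  rw [VectorField.lieBracket_eq, cov_apply, cov_apply, hg.christoffel_symm hy (X y)]
  module

/-- Metric compatibility expands the derivatives and vanishing torsion the brackets; everything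
cancels but one term, counted twice. This ties the Koszul expression behind `nabla` to the
Christoffel symbols. -/
lemma koszul_eq (hg : IsLocalMetric Ω g) (hy : y ∈ Ω) {X Y Z : E → E}
    (hX : DifferentiableAt ℝ X y) (hY : DifferentiableAt ℝ Y y) (hZ : DifferentiableAt ℝ Z y) :
    (1 / 2) * (fderiv ℝ (fun z ↦ g z (Y z) (Z z)) y (X y)
      + fderiv ℝ (fun z ↦ g z (Z z) (X z)) y (Y y)
      - fderiv ℝ (fun z ↦ g z (X z) (Y z)) y (Z y)
      + g y (VectorField.lieBracket ℝ X Y y) (Z y)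
      - g y (VectorField.lieBracket ℝ Y Z y) (X y)
      + g y (VectorField.lieBracket ℝ Z X y) (Y y)) = g y (cov g Y y (X y)) (Z y) := by
  simp only [hg.fderiv_inner hy hX hY, hg.fderiv_inner hy hY hZ, hg.fderiv_inner hy hZ hX,
    hg.lieBracket_eq_cov hy, map_sub, _root_.sub_apply]
  rw [hg.symm y hy (Y y), hg.symm y hy (Z y) (cov g X y (Y y)),
    hg.symm y hy (X y) (cov g Y y (Z y))]
  ring

omit [FiniteDimensional ℝ E] in
lemma _root_.Filter.EventuallyEq.cov_eq {X Y : E → E} (h : X =ᶠ[𝓝 y] Y) :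
    cov g X y = cov g Y y := by
  rw [cov, cov, h.fderiv_eq, h.eq_of_nhds]

lemma contDiffAt_cov (hg : IsLocalMetric Ω g) (hy : y ∈ Ω) {u : E → E}
    (hu : ContDiffAt ℝ ∞ u y) : ContDiffAt ℝ ∞ (cov g u) y := by
  have hf : ContDiffAt ℝ ∞ (fun z ↦ (christoffel g z).flip) y :=
    (flipₗᵢ ℝ E E E).toContinuousLinearEquiv.contDiff.contDiffAt.comp y
      (hg.contDiffAt_christoffel hy)
  exact (hu.fderiv_right (m := ∞) (by simp)).add (hf.clm_apply hu)

end IsLocalMetric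

/-! ### Second covariant derivatives and curvature. -/

/-- The covariant derivative of a field `N` of endomorphisms. -/
def covEnd (g : E → E →L[ℝ] E →L[ℝ] ℝ) (N : E → E →L[ℝ] E) (y v : E) : E →L[ℝ] E :=
  fderiv ℝ N y v + (christoffel g y v).comp (N y) - (N y).comp (christoffel g y v)

lemma covEnd_apply (g : E → E →L[ℝ] E →L[ℝ] ℝ) (N : E → E →L[ℝ] E) (y v a : E) :
    covEnd g N y v a
      = fderiv ℝ N y v a + christoffel g y v (N y a) - N y (christoffel g y v a) := rfl

/-- The curvature tensor `R(v, a) w`. -/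
def curv (g : E → E →L[ℝ] E →L[ℝ] ℝ) (y v a w : E) : E :=
  fderiv ℝ (christoffel g) y v a w - fderiv ℝ (christoffel g) y a v w
    + christoffel g y v (christoffel g y a w) - christoffel g y a (christoffel g y v w)

lemma fderiv_clm_apply_apply {N : E → E →L[ℝ] E} {a : E → E} {y : E} (hN : DifferentiableAt ℝ N y)
    (ha : DifferentiableAt ℝ a y) (v : E) :
    fderiv ℝ (fun z ↦ N z (a z)) y v = fderiv ℝ N y v (a y) + N y (fderiv ℝ a y v) := by
  rw [(hN.hasFDerivAt.clm_apply ha.hasFDerivAt).fderiv]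
  simp [add_comm]

namespace IsLocalMetric

variable [FiniteDimensional ℝ E] {Ω : Set E} {g : E → E →L[ℝ] E →L[ℝ] ℝ} {y : E}

lemma fderiv_cov_apply (hg : IsLocalMetric Ω g) (hy : y ∈ Ω) {u : E → E}
    (hu : ContDiffAt ℝ ∞ u y) (v a : E) :
    fderiv ℝ (cov g u) y v a = fderiv ℝ (fderiv ℝ u) y v a
      + fderiv ℝ (christoffel g) y v a (u y) + christoffel g y a (fderiv ℝ u y v) := by
  have h1 : DifferentiableAt ℝ (fderiv ℝ u) y :=
    (hu.fderiv_right (m := ∞) (by simp)).differentiableAt (by simp)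
  have h0 := hu.differentiableAt (by simp)
  have hN : DifferentiableAt ℝ (cov g u) y := (hg.contDiffAt_cov hy hu).differentiableAt (by simp)
  have hc := hg.differentiableAt_christoffel hy
  have e1 := fderiv_clm_apply_apply hN (differentiableAt_const a) v
  have h2 := (hc.hasFDerivAt.clm_apply (hasFDerivAt_const a y)).clm_apply h0.hasFDerivAt
  have h3 := h1.hasFDerivAt.clm_apply (hasFDerivAt_const a y)
  have : (fun z ↦ cov g u z a) = fun z ↦ fderiv ℝ u z a + christoffel g z a (u z) := by
    ext z; rw [cov_apply]
  rw [this, fderiv_fun_add h3.differentiableAt h2.differentiableAt, h3.fderiv, h2.fderiv] at e1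
  simp at e1
  rw [← e1]
  module

/-- The Ricci identity: the antisymmetrized second covariant derivative is the curvature. -/
lemma covEnd_sub (hg : IsLocalMetric Ω g) (hy : y ∈ Ω) {u : E → E}
    (hu : ContDiffAt ℝ ∞ u y) (v a : E) :
    covEnd g (cov g u) y v a - covEnd g (cov g u) y a v = curv g y v a (u y) := by
  have hs : fderiv ℝ (fderiv ℝ u) y v a = fderiv ℝ (fderiv ℝ u) y a v :=
    (hu.isSymmSndFDerivAt (by simp [minSmoothness_of_isRCLikeNormedField]; exact WithTop.coe_le_coe.2 le_top)).eq v a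
  simp only [covEnd_apply, hg.fderiv_cov_apply hy hu, curv, hs, hg.christoffel_symm hy v a]
  simp only [cov_apply, map_add]
  abel

lemma fderiv_cov_field (hg : IsLocalMetric Ω g) (hy : y ∈ Ω) {u X : E → E}
    (hu : ContDiffAt ℝ ∞ u y) (hX : DifferentiableAt ℝ X y) (v : E) :
    cov g (fun z ↦ cov g u z (X z)) y v = covEnd g (cov g u) y v (X y) + cov g u y (cov g X y v) := by
  have hN : DifferentiableAt ℝ (cov g u) y := (hg.contDiffAt_cov hy hu).differentiableAt (by simp)
  rw [cov_apply, fderiv_clm_apply_apply hN hX, covEnd_apply, cov_apply g X, map_add]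
  abel

/-- The Leibniz rule produces an extra ∇_{∇_X Y - ∇_Y X} Z, which the bracket term removes; the rest
is the Ricci identity. Hence the curvature depends only on the values at `y`, whatever extensions
are chosen. -/
lemma curvature_eq (hg : IsLocalMetric Ω g) (hy : y ∈ Ω) {X Y Z : E → E}
    (hX : DifferentiableAt ℝ X y) (hY : DifferentiableAt ℝ Y y) (hZ : ContDiffAt ℝ ∞ Z y) :
    cov g (fun z ↦ cov g Z z (Y z)) y (X y) - cov g (fun z ↦ cov g Z z (X z)) y (Y y)
      - cov g Z y (VectorField.lieBracket ℝ X Y y) = curv g y (X y) (Y y) (Z y) := by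
  rw [hg.fderiv_cov_field hy hZ hX, hg.fderiv_cov_field hy hZ hY, ← hg.covEnd_sub hy hZ,
    hg.lieBracket_eq_cov hy, map_sub]
  abel

/-- The covariant derivative of the exterior derivative of the dual form of `u`. -/
lemma fderiv_extDeriv (hg : IsLocalMetric Ω g) (hy : y ∈ Ω) {N : E → E →L[ℝ] E} {a b : E → E}
    (hN : DifferentiableAt ℝ N y) (ha : DifferentiableAt ℝ a y) (hb : DifferentiableAt ℝ b y)
    (v : E) :
    fderiv ℝ (fun z ↦ g z (N z (a z)) (b z) - g z (N z (b z)) (a z)) y v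
      - (g y (N y (cov g a y v)) (b y) - g y (N y (b y)) (cov g a y v))
      - (g y (N y (a y)) (cov g b y v) - g y (N y (cov g b y v)) (a y))
      = g y (covEnd g N y v (a y)) (b y) - g y (covEnd g N y v (b y)) (a y) := by
  have hNa : DifferentiableAt ℝ (fun z ↦ N z (a z)) y := hN.clm_apply ha
  have hNb : DifferentiableAt ℝ (fun z ↦ N z (b z)) y := hN.clm_apply hb
  have d1 := (hasFDerivAt_bilin (hg.differentiableAt hy) hNa hb).1
  have d2 := (hasFDerivAt_bilin (hg.differentiableAt hy) hNb ha).1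
  have key : ∀ {a : E → E}, DifferentiableAt ℝ a y →
      cov g (fun z ↦ N z (a z)) y v = covEnd g N y v (a y) + N y (cov g a y v) := by
    intro a ha
    rw [cov_apply, fderiv_clm_apply_apply hN ha, covEnd_apply, cov_apply g a, map_add]
    abel
  rw [fderiv_fun_sub d1 d2, _root_.sub_apply, hg.fderiv_inner hy hNa hb,
    hg.fderiv_inner hy hNb ha, key ha, key hb]
  simp only [map_add, _root_.add_apply]
  ring

/-- The Christoffel part is a commutator, and commutators have trace zero. -/
lemma trace_covEnd {N : E → E →L[ℝ] E} (hN : DifferentiableAt ℝ N y) (v : E) :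
    LinearMap.trace ℝ E (covEnd g N y v : E →ₗ[ℝ] E)
      = fderiv ℝ (fun z ↦ LinearMap.trace ℝ E (N z : E →ₗ[ℝ] E)) y v := by
  let T : (E →L[ℝ] E) →L[ℝ] ℝ := LinearMap.toContinuousLinearMap
    ((LinearMap.trace ℝ E).comp (ContinuousLinearMap.coeLM ℝ))
  have hT : ∀ A : E →L[ℝ] E, T A = LinearMap.trace ℝ E (A : E →ₗ[ℝ] E) := fun A ↦ rfl
  have : fderiv ℝ (fun z ↦ T (N z)) y v = T (fderiv ℝ N y v) := by
    exact congrArg (fun l : E →L[ℝ] ℝ ↦ l v) (T.hasFDerivAt.comp y hN.hasFDerivAt).fderiv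
  simp only [← hT] at this ⊢
  rw [this, covEnd, map_sub, map_add]
  have : T ((christoffel g y v).comp (N y)) = T ((N y).comp (christoffel g y v)) := by
    simp only [hT]
    exact LinearMap.trace_mul_comm ℝ _ _
  rw [this]
  ring

end IsLocalMetric

end LocalMetric

/-! ### The Bochner-Weitzenböck formula in coordinates. -/

section LocalMetric

variable {E : Type*} [NormedAddCommGroup E] [NormedSpace ℝ E]

namespace IsLocalMetric

variable [FiniteDimensional ℝ E] {Ω : Set E} {g : E → E →L[ℝ] E →L[ℝ] ℝ} {y : E}

/-- `W` is the gradient of |u|²/2, and this computes its Hessian. The defining identity of `W` is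
differentiated with a constant field `a`; the terms in ∇_v a cancel by that same identity. -/
lemma inner_cov_adjoint (hg : IsLocalMetric Ω g) (hy : y ∈ Ω) {u W : E → E}
    (hu : ContDiffAt ℝ ∞ u y) (hW : DifferentiableAt ℝ W y)
    (h : ∀ z ∈ Ω, ∀ a, g z (W z) a = g z (cov g u z a) (u z)) (v a : E) :
    g y (cov g W y v) a = g y (covEnd g (cov g u) y v a) (u y)
      + g y (cov g u y a) (cov g u y v) := by
  have hN : DifferentiableAt ℝ (cov g u) y := (hg.contDiffAt_cov hy hu).differentiableAt (by simp)
  have hu0 : DifferentiableAt ℝ u y := hu.differentiableAt (by simp)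
  have hNa : DifferentiableAt ℝ (fun z ↦ cov g u z a) y := hN.clm_apply (differentiableAt_const a)
  have e : (fun z ↦ g z (W z) a) =ᶠ[𝓝 y] fun z ↦ g z (cov g u z a) (u z) := by
    filter_upwards [hg.mem_nhds hy] with z hz using h z hz a
  have e1 := hg.fderiv_inner hy hW (differentiableAt_const a) v
  rw [e.fderiv_eq, hg.fderiv_inner hy hNa hu0, hg.fderiv_cov_field hy hu (differentiableAt_const a),
    h y hy] at e1
  simp only [map_add, _root_.add_apply] at e1
  linarith

/-- The Bochner-Weitzenböck formula for a divergence free vector field. -/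
lemma bochner (hg : IsLocalMetric Ω g) (hy : y ∈ Ω) {ι : Type*} [Fintype ι] {e : ι → E}
    (he : ∀ A : E →L[ℝ] E, ∑ i, g y (A (e i)) (e i) = LinearMap.trace ℝ E (A : E →ₗ[ℝ] E))
    {u W : E → E} (hu : ContDiffAt ℝ ∞ u y) (hW : DifferentiableAt ℝ W y)
    (h : ∀ z ∈ Ω, ∀ a, g z (W z) a = g z (cov g u z a) (u z))
    (hdiv : ∀ z ∈ Ω, LinearMap.trace ℝ E (cov g u z : E →ₗ[ℝ] E) = 0) :
    -∑ i, (g y (covEnd g (cov g u) y (e i) (e i)) (u y)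
        - g y (covEnd g (cov g u) y (e i) (u y)) (e i))
      = ∑ i, g y (cov g u y (e i)) (cov g u y (e i))
        - LinearMap.trace ℝ E (cov g W y : E →ₗ[ℝ] E)
        + ∑ i, g y (curv g y (e i) (u y) (u y)) (e i) := by
  have hN : DifferentiableAt ℝ (cov g u) y := (hg.contDiffAt_cov hy hu).differentiableAt (by simp)
  -- The sum is the derivative of div u in the direction `u`, and div u vanishes near `y`.
  have h0 : ∑ i, g y (covEnd g (cov g u) y (u y) (e i)) (e i) = 0 := by
    have := he (covEnd g (cov g u) y (u y))
    rw [trace_covEnd hN] at this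
    have e0 : (fun z ↦ LinearMap.trace ℝ E (cov g u z : E →ₗ[ℝ] E)) =ᶠ[𝓝 y] fun _ ↦ 0 := by
      filter_upwards [hg.mem_nhds hy] with z hz using hdiv z hz
    rw [e0.fderiv_eq] at this
    simpa using this
  -- Exchanging the two derivatives costs a curvature term, whose trace is Ric(u, u).
  have h1 : ∑ i, g y (covEnd g (cov g u) y (e i) (u y)) (e i)
      = ∑ i, g y (curv g y (e i) (u y) (u y)) (e i) := by
    rw [← sub_eq_zero, ← h0, ← Finset.sum_sub_distrib]
    refine Finset.sum_congr rfl fun i _ ↦ ?_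
    rw [← hg.covEnd_sub hy hu]
    simp
  rw [← he (cov g W y), Finset.sum_sub_distrib, h1]
  simp only [hg.inner_cov_adjoint hy hu hW h, Finset.sum_add_distrib]
  ring

end IsLocalMetric

end LocalMetric

/-! ### The Riemannian density and the divergence in coordinates. -/

section Density

variable {n : ℕ}

/-- The Gram matrix of a bilinear form in the standard basis. -/
def gram (B : (EuclideanSpace ℝ (Fin n)) →L[ℝ] (EuclideanSpace ℝ (Fin n)) →L[ℝ] ℝ) : Matrix (Fin n) (Fin n) ℝ :=
  Matrix.of fun i j ↦ B (EuclideanSpace.single i 1) (EuclideanSpace.single j 1)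

/-- The Riemannian density `√(det g)`. -/
def density (g : (EuclideanSpace ℝ (Fin n)) → (EuclideanSpace ℝ (Fin n)) →L[ℝ] (EuclideanSpace ℝ (Fin n)) →L[ℝ] ℝ) (y : (EuclideanSpace ℝ (Fin n))) : ℝ := √(gram (g y)).det

lemma contDiff_det : ContDiff ℝ ∞ (fun A : Fin n → Fin n → ℝ ↦ (Matrix.of A).det) := by
  simp only [Matrix.det_apply, Matrix.of_apply]
  fun_prop

/-- Jacobi's formula in a multiplicative direction: det(A + tAM) = det A · det(1 + tM), and the
linear coefficient of the last factor is tr M. `A` need not be invertible. -/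
lemma fderiv_det (A M : Matrix (Fin n) (Fin n) ℝ) :
    fderiv ℝ (fun B : Fin n → Fin n → ℝ ↦ (Matrix.of B).det) (fun i j ↦ A i j)
      (fun i j ↦ (A * M) i j) = A.det * M.trace := by
  have hd : DifferentiableAt ℝ (fun B : Fin n → Fin n → ℝ ↦ (Matrix.of B).det)
      (fun i j ↦ A i j) := contDiff_det.differentiable (by simp) _
  have h1 : HasDerivAt (fun t : ℝ ↦ (fun i ↦ fun j ↦ A i j + t * (A * M) i j : Fin n → Fin n → ℝ))
      (fun i j ↦ (A * M) i j) 0 := by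
    refine hasDerivAt_pi.2 fun i ↦ hasDerivAt_pi.2 fun j ↦ ?_
    simpa using ((hasDerivAt_id (0 : ℝ)).mul_const ((A * M) i j)).const_add (A i j)
  have h2 := hd.hasFDerivAt.comp_hasDerivAt_of_eq 0 h1 (by ext; simp)
  have e : ((fun B : Fin n → Fin n → ℝ ↦ (Matrix.of B).det) ∘
      fun t : ℝ ↦ (fun i ↦ fun j ↦ A i j + t * (A * M) i j : Fin n → Fin n → ℝ))
      = fun t ↦ A.det * (1 + t • M).det := by
    ext t
    rw [← Matrix.det_mul]
    simp only [Function.comp]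
    congr 1
    ext i j
    simp [mul_add]
  rw [e] at h2
  have h3 : HasDerivAt (fun t : ℝ ↦ A.det * (1 + t • M).det) (A.det * M.trace) 0 := by
    refine HasDerivAt.const_mul _ ?_
    have := (Matrix.det (1 + (Polynomial.X : Polynomial ℝ) • M.map Polynomial.C)).hasDerivAt 0
    rw [Matrix.derivative_det_one_add_X_smul] at this
    refine this.congr_of_eventuallyEq (Filter.Eventually.of_forall fun t ↦ ?_)
    change (1 + t • M).det = Polynomial.evalRingHom t _
    rw [RingHom.map_det]
    congr 1
    ext i j
    by_cases h : i = j <;> simp [h, mul_comm t]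
  exact h2.unique h3

variable {Ω : Set (EuclideanSpace ℝ (Fin n))} {g : (EuclideanSpace ℝ (Fin n)) → (EuclideanSpace ℝ (Fin n)) →L[ℝ] (EuclideanSpace ℝ (Fin n)) →L[ℝ] ℝ} {y : (EuclideanSpace ℝ (Fin n))}

lemma gram_posDef (hg : IsLocalMetric Ω g) (hy : y ∈ Ω) : (gram (g y)).PosDef := by
  rw [Matrix.posDef_iff_dotProduct_mulVec]
  refine ⟨by ext i j; simpa [gram] using hg.symm y hy _ _, fun x hx ↦ ?_⟩
  have hv := hg.pos y hy (WithLp.toLp 2 x) (by simpa using hx)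
  have e : (WithLp.toLp 2 x : (EuclideanSpace ℝ (Fin n))) = ∑ i, x i • EuclideanSpace.single i (1 : ℝ) := by
    ext j; simp [Finset.sum_apply, Pi.single_apply]
  rw [e] at hv
  refine hv.trans_eq ?_
  simp only [dotProduct, Matrix.mulVec, gram, Matrix.of_apply, map_sum, map_smul, Pi.star_apply,
    star_trivial, _root_.sum_apply, _root_.smul_apply, smul_eq_mul, Finset.mul_sum]
  rw [Finset.sum_comm]
  refine Finset.sum_congr rfl fun i _ ↦ Finset.sum_congr rfl fun j _ ↦ ?_
  ring

lemma gram_det_pos (hg : IsLocalMetric Ω g) (hy : y ∈ Ω) : 0 < (gram (g y)).det :=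
  (gram_posDef hg hy).det_pos

lemma density_pos (hg : IsLocalMetric Ω g) (hy : y ∈ Ω) : 0 < density g y :=
  Real.sqrt_pos.2 (gram_det_pos hg hy)

lemma contDiffAt_gram_entries (hg : IsLocalMetric Ω g) (hy : y ∈ Ω) :
    ContDiffAt ℝ ∞ (fun z ↦ (fun i j ↦ gram (g z) i j : Fin n → Fin n → ℝ)) y :=
  contDiffAt_pi.2 fun _ ↦ contDiffAt_pi.2 fun _ ↦
    ((hg.contDiffAt hy).clm_apply contDiffAt_const).clm_apply contDiffAt_const

lemma contDiffAt_gram_det (hg : IsLocalMetric Ω g) (hy : y ∈ Ω) :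
    ContDiffAt ℝ ∞ (fun z ↦ (gram (g z)).det) y :=
  contDiff_det.contDiffAt.comp y (contDiffAt_gram_entries hg hy)

lemma contDiffAt_density (hg : IsLocalMetric Ω g) (hy : y ∈ Ω) :
    ContDiffAt ℝ ∞ (density g) y :=
  (contDiffAt_gram_det hg hy).sqrt (gram_det_pos hg hy).ne'

lemma trace_eq_sum_single (A : (EuclideanSpace ℝ (Fin n)) →L[ℝ] (EuclideanSpace ℝ (Fin n))) :
    LinearMap.trace ℝ (EuclideanSpace ℝ (Fin n)) (A : (EuclideanSpace ℝ (Fin n)) →ₗ[ℝ] (EuclideanSpace ℝ (Fin n))) = ∑ i, A (EuclideanSpace.single i 1) i := by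
  rw [LinearMap.trace_eq_sum_inner _ (EuclideanSpace.basisFun (Fin n) ℝ)]
  simp [EuclideanSpace.inner_single_left]

/-- With A the matrix of Γ(v) and G the Gram matrix, metric compatibility reads ∂_v G = GA + AᵀG.
Factored as G(A + G⁻¹AᵀG), it fits Jacobi's formula, and the trace is 2 tr A. -/
lemma fderiv_gram_det (hg : IsLocalMetric Ω g) (hy : y ∈ Ω) (v : (EuclideanSpace ℝ (Fin n))) :
    fderiv ℝ (fun z ↦ (gram (g z)).det) y v
      = 2 * (gram (g y)).det * LinearMap.trace ℝ (EuclideanSpace ℝ (Fin n)) (christoffel g y v : (EuclideanSpace ℝ (Fin n)) →ₗ[ℝ] (EuclideanSpace ℝ (Fin n))) := by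
  let A : Matrix (Fin n) (Fin n) ℝ :=
    Matrix.of fun i j ↦ christoffel g y v (EuclideanSpace.single j 1) i
  have hA : ∀ j, christoffel g y v (EuclideanSpace.single j 1)
      = ∑ i, A i j • EuclideanSpace.single i (1 : ℝ) := by
    intro j; ext k; simp [Finset.sum_apply, Pi.single_apply, A]
  have htr : A.trace = LinearMap.trace ℝ (EuclideanSpace ℝ (Fin n)) (christoffel g y v : (EuclideanSpace ℝ (Fin n)) →ₗ[ℝ] (EuclideanSpace ℝ (Fin n))) := by
    rw [trace_eq_sum_single]; rfl
  have hdet := gram_det_pos hg hy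
  set G := gram (g y) with hG
  have hu : IsUnit G.det := hdet.ne'.isUnit
  have hent := contDiffAt_gram_entries hg hy
  have h1 := ((contDiff_det (n := n)).differentiable (by simp) (fun i j ↦ G i j)).hasFDerivAt.comp y
    (hent.differentiableAt (by simp)).hasFDerivAt
  have h2 : fderiv ℝ (fun z ↦ (fun i j ↦ gram (g z) i j : Fin n → Fin n → ℝ)) y v
      = fun i j ↦ (G * (A + G⁻¹ * A.transpose * G)) i j := by
    have e : G * (A + G⁻¹ * A.transpose * G) = G * A + A.transpose * G := by
      rw [mul_add, Matrix.mul_assoc, Matrix.mul_nonsing_inv_cancel_left _ _ hu]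
    ext i j
    have : fderiv ℝ (fun z ↦ gram (g z) i j) y v = fderiv ℝ g y v
        (EuclideanSpace.single i 1) (EuclideanSpace.single j 1) := by
      simpa [gram] using (hasFDerivAt_bilin (hg.differentiableAt hy)
        (differentiableAt_const (EuclideanSpace.single i (1 : ℝ)))
        (differentiableAt_const (EuclideanSpace.single j (1 : ℝ)))).2 v
    rw [e]
    have e1 := hasFDerivAt_pi'.1 (hent.differentiableAt (by simp)).hasFDerivAt i
    have e2 := hasFDerivAt_pi'.1 e1 j
    have e3 := congrArg (fun l : (EuclideanSpace ℝ (Fin n)) →L[ℝ] ℝ ↦ l v) e2.fderiv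
    simp only [ContinuousLinearMap.comp_apply, ContinuousLinearMap.proj_apply] at e3
    rw [← e3, this, hg.fderiv_metric hy, hA, hA]
    simp only [map_sum, map_smul, sum_apply, smul_apply, smul_eq_mul, Matrix.add_apply,
      Matrix.mul_apply, Matrix.transpose_apply]
    rw [add_comm]
    congr 1
    exact Finset.sum_congr rfl fun k _ ↦ mul_comm _ _
  have h3 : fderiv ℝ (fun z ↦ (gram (g z)).det) y v = fderiv ℝ
      (fun B : Fin n → Fin n → ℝ ↦ (Matrix.of B).det) (fun i j ↦ G i j)
      (fderiv ℝ (fun z ↦ (fun i j ↦ gram (g z) i j : Fin n → Fin n → ℝ)) y v) :=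
    congrArg (fun l : (EuclideanSpace ℝ (Fin n)) →L[ℝ] ℝ ↦ l v) h1.fderiv
  rw [h3, h2, fderiv_det, Matrix.trace_add, Matrix.mul_assoc, Matrix.trace_mul_comm,
    Matrix.mul_nonsing_inv_cancel_right _ _ hu, Matrix.trace_transpose, htr]
  ring

lemma fderiv_density (hg : IsLocalMetric Ω g) (hy : y ∈ Ω) (v : (EuclideanSpace ℝ (Fin n))) :
    fderiv ℝ (density g) y v
      = density g y * LinearMap.trace ℝ (EuclideanSpace ℝ (Fin n)) (christoffel g y v : (EuclideanSpace ℝ (Fin n)) →ₗ[ℝ] (EuclideanSpace ℝ (Fin n))) := by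
  have hdet := gram_det_pos hg hy
  have h := ((contDiffAt_gram_det hg hy).differentiableAt (by simp)).hasFDerivAt.sqrt hdet.ne'
  have : fderiv ℝ (density g) y v = (1 / (2 * √(gram (g y)).det)) *
      fderiv ℝ (fun z ↦ (gram (g z)).det) y v := congrArg (fun l : (EuclideanSpace ℝ (Fin n)) →L[ℝ] ℝ ↦ l v) h.fderiv
  rw [this, fderiv_gram_det hg hy, density]
  have h0 : √(gram (g y)).det ≠ 0 := (Real.sqrt_pos.2 hdet).ne'
  field_simp
  rw [Real.sq_sqrt hdet.le]

/-- `√(det g) div V = ∑ᵢ ∂ᵢ (√(det g) Vⁱ)`. -/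
lemma density_mul_trace_cov (hg : IsLocalMetric Ω g) (hy : y ∈ Ω) {V : (EuclideanSpace ℝ (Fin n)) → (EuclideanSpace ℝ (Fin n))}
    (hV : DifferentiableAt ℝ V y) :
    density g y * LinearMap.trace ℝ (EuclideanSpace ℝ (Fin n)) (cov g V y : (EuclideanSpace ℝ (Fin n)) →ₗ[ℝ] (EuclideanSpace ℝ (Fin n)))
      = ∑ i, fderiv ℝ (fun z ↦ density g z * V z i) y (EuclideanSpace.single i 1) := by
  have hρ := (contDiffAt_density hg hy).differentiableAt (by simp)
  have hVi : ∀ i, HasFDerivAt (fun z ↦ V z i)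
      ((EuclideanSpace.proj i : (EuclideanSpace ℝ (Fin n)) →L[ℝ] ℝ).comp (fderiv ℝ V y)) y := fun i ↦
    (EuclideanSpace.proj i : (EuclideanSpace ℝ (Fin n)) →L[ℝ] ℝ).hasFDerivAt.comp y hV.hasFDerivAt
  have h1 : ∀ i, fderiv ℝ (fun z ↦ density g z * V z i) y (EuclideanSpace.single i 1)
      = density g y * fderiv ℝ V y (EuclideanSpace.single i 1) i
        + V y i * fderiv ℝ (density g) y (EuclideanSpace.single i 1) := fun i ↦ by
    rw [fderiv_fun_mul hρ (hVi i).differentiableAt, (hVi i).fderiv]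
    simp
  have hVs : V y = ∑ i, V y i • EuclideanSpace.single i (1 : ℝ) := by
    ext k; simp [Finset.sum_apply, Pi.single_apply]
  have h2 : ∑ i, V y i * fderiv ℝ (density g) y (EuclideanSpace.single i 1)
      = fderiv ℝ (density g) y (V y) := by
    conv_rhs => rw [hVs]
    simp
  simp only [h1, Finset.sum_add_distrib, h2, trace_eq_sum_single, cov_apply, PiLp.add_apply]
  -- Symmetry of Γ turns ∑ᵢ Γ(eᵢ, V)ⁱ into tr Γ(V), the logarithmic derivative of the density along
  -- `V`.
  simp only [fderiv_density hg hy, trace_eq_sum_single, hg.christoffel_symm hy _ (V y), mul_add,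
    Finset.mul_sum]

end Density

/-! ### Charts: coordinates of vector fields, derivatives and Lie brackets. -/

section Chart

variable {n : ℕ} {M : Type*} [TopologicalSpace M]
  [ChartedSpace (EuclideanSpace ℝ (Fin n)) M]

/-- The domain of the chart centred at `c`. -/
abbrev dom (c : M) : Set M := (chartAt (EuclideanSpace ℝ (Fin n)) c).source

/-- The image of the chart centred at `c`. -/
abbrev tgt (c : M) : Set (EuclideanSpace ℝ (Fin n)) := (extChartAt (𝓡 n) c).target

lemma isOpen_dom (c : M) : IsOpen (dom (n := n) c) := (chartAt _ c).open_source

lemma isOpen_tgt (c : M) : IsOpen (tgt (n := n) c) := isOpen_extChartAt_target c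

lemma extChartAt_mem_tgt {c x : M} (hx : x ∈ dom (n := n) c) : extChartAt (𝓡 n) c x ∈ tgt c :=
  (extChartAt (𝓡 n) c).map_source (by rwa [extChartAt_source])

lemma symm_mem_dom {c : M} {y : EuclideanSpace ℝ (Fin n)} (hy : y ∈ tgt c) :
    (extChartAt (𝓡 n) c).symm y ∈ dom (n := n) c := by
  have := (extChartAt (𝓡 n) c).map_target hy
  rwa [extChartAt_source] at this

lemma symm_extChartAt {c x : M} (hx : x ∈ dom (n := n) c) :
    (extChartAt (𝓡 n) c).symm (extChartAt (𝓡 n) c x) = x :=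
  (extChartAt (𝓡 n) c).left_inv (by rwa [extChartAt_source])

lemma extChartAt_symm {c : M} {y : EuclideanSpace ℝ (Fin n)} (hy : y ∈ tgt c) :
    extChartAt (𝓡 n) c ((extChartAt (𝓡 n) c).symm y) = y :=
  (extChartAt (𝓡 n) c).right_inv hy

lemma eventually_mem_dom {c x : M} (hx : x ∈ dom (n := n) c) : ∀ᶠ z in 𝓝 x, z ∈ dom (n := n) c :=
  (isOpen_dom c).mem_nhds hx

lemma eventually_mem_tgt {c x : M} (hx : x ∈ dom (n := n) c) :
    ∀ᶠ y in 𝓝 (extChartAt (𝓡 n) c x), y ∈ tgt (n := n) c :=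
  (isOpen_tgt c).mem_nhds (extChartAt_mem_tgt hx)

variable [IsManifold (𝓡 n) ∞ M]

lemma mdifferentiableAt_chart {c x : M} (hx : x ∈ dom (n := n) c) :
    MDifferentiableAt (𝓡 n) 𝓘(ℝ, EuclideanSpace ℝ (Fin n)) (extChartAt (𝓡 n) c) x :=
  mdifferentiableAt_extChartAt hx

lemma contMDiffAt_symm {c : M} {y : EuclideanSpace ℝ (Fin n)} (hy : y ∈ tgt c) :
    ContMDiffAt 𝓘(ℝ, EuclideanSpace ℝ (Fin n)) (𝓡 n) ∞ (extChartAt (𝓡 n) c).symm y :=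
  (contMDiffOn_extChartAt_symm c).contMDiffAt ((isOpen_tgt c).mem_nhds hy)

lemma contMDiffAt_chart {c x : M} (hx : x ∈ dom (n := n) c) :
    ContMDiffAt (𝓡 n) 𝓘(ℝ, EuclideanSpace ℝ (Fin n)) ∞ (extChartAt (𝓡 n) c) x :=
  contMDiffOn_extChartAt.contMDiffAt ((isOpen_dom c).mem_nhds hx)

lemma tendsto_chart {c x : M} (hx : x ∈ dom (n := n) c) :
    Filter.Tendsto (extChartAt (𝓡 n) c) (𝓝 x) (𝓝 (extChartAt (𝓡 n) c x)) :=
  (contMDiffAt_chart hx).continuousAt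

lemma tendsto_symm {c x : M} (hx : x ∈ dom (n := n) c) :
    Filter.Tendsto (extChartAt (𝓡 n) c).symm (𝓝 (extChartAt (𝓡 n) c x)) (𝓝 x) := by
  have := (contMDiffAt_symm (extChartAt_mem_tgt hx)).continuousAt.tendsto
  rwa [symm_extChartAt hx] at this

/-- The coordinates of tangent vectors at `x` in the chart centred at `c`. -/
def toE (c x : M) : TangentSpace (𝓡 n) x →L[ℝ] EuclideanSpace ℝ (Fin n) :=
  (trivializationAt (EuclideanSpace ℝ (Fin n)) (TangentSpace (𝓡 n)) c).continuousLinearMapAt ℝ x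

/-- The tangent vector at `x` with given coordinates in the chart centred at `c`. -/
def ofE (c x : M) : EuclideanSpace ℝ (Fin n) →L[ℝ] TangentSpace (𝓡 n) x :=
  (trivializationAt (EuclideanSpace ℝ (Fin n)) (TangentSpace (𝓡 n)) c).symmL ℝ x

lemma mem_baseSet {c x : M} (hx : x ∈ dom (n := n) c) :
    x ∈ (trivializationAt (EuclideanSpace ℝ (Fin n)) (TangentSpace (𝓡 n)) c).baseSet := by
  simpa using hx

lemma ofE_toE {c x : M} (hx : x ∈ dom (n := n) c) (v : TangentSpace (𝓡 n) x) :
    ofE c x (toE c x v) = v :=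
  Trivialization.symmL_continuousLinearMapAt _ (mem_baseSet hx) v

lemma toE_ofE {c x : M} (hx : x ∈ dom (n := n) c) (v : EuclideanSpace ℝ (Fin n)) :
    toE c x (ofE c x v) = v :=
  Trivialization.continuousLinearMapAt_symmL _ (mem_baseSet hx) v

lemma toE_eq_snd {c x : M} (hx : x ∈ dom (n := n) c) (v : TangentSpace (𝓡 n) x) :
    toE c x v = (trivializationAt (EuclideanSpace ℝ (Fin n)) (TangentSpace (𝓡 n)) c ⟨x, v⟩).2 := by
  rw [toE, Trivialization.continuousLinearMapAt_apply,
    Trivialization.coe_linearMapAt_of_mem _ (mem_baseSet hx)]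

/-- The vector field `V` in the chart centred at `c`. -/
def hat (c : M) (V : VField n M) (y : EuclideanSpace ℝ (Fin n)) : EuclideanSpace ℝ (Fin n) :=
  toE c _ (V ((extChartAt (𝓡 n) c).symm y))

lemma hat_chart {c x : M} (hx : x ∈ dom (n := n) c) (V : VField n M) :
    hat c V (extChartAt (𝓡 n) c x) = toE c x (V x) :=
  congrArg (fun z ↦ toE c z (V z)) (symm_extChartAt hx)

/-- Smoothness of a vector field at a point. -/
def SmoothAt (V : VField n M) (x : M) : Prop :=
  ContMDiffAt (𝓡 n) (𝓡 n).tangent ∞ (fun y ↦ (⟨y, V y⟩ : TangentBundle (𝓡 n) M)) x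

lemma smoothAt_iff {c x : M} (hx : x ∈ dom (n := n) c) (V : VField n M) :
    SmoothAt V x ↔ ContDiffAt ℝ ∞ (hat c V) (extChartAt (𝓡 n) c x) := by
  have e := (trivializationAt (EuclideanSpace ℝ (Fin n)) (TangentSpace (𝓡 n)) c).contMDiffAt_section_iff
    (IB := 𝓡 n) (n := ∞) (s := V) (mem_baseSet hx)
  refine Iff.trans e ?_
  have e1 : (fun z ↦ (trivializationAt (EuclideanSpace ℝ (Fin n)) (TangentSpace (𝓡 n)) c
      ⟨z, V z⟩).2) =ᶠ[𝓝 x] fun z ↦ toE c z (V z) := by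
    filter_upwards [eventually_mem_dom hx] with z hz using (toE_eq_snd hz _).symm
  rw [e1.contMDiffAt_iff, ← contMDiffAt_iff_contDiffAt]
  constructor
  · intro h
    have := ContMDiffAt.comp_of_eq (f := (extChartAt (𝓡 n) c).symm) (x := extChartAt (𝓡 n) c x) h
      (contMDiffAt_symm (extChartAt_mem_tgt hx)) (symm_extChartAt hx)
    exact this
  · intro h
    refine (ContMDiffAt.comp x h (contMDiffAt_chart hx)).congr_of_eventuallyEq ?_
    filter_upwards [eventually_mem_dom hx] with z hz using (hat_chart hz V).symm

/-- In the chart centred at `x` the field `ext v` has constant coordinates, so it is smooth on the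
whole chart domain and not only at `x`; the curvature differentiates it twice. -/
lemma smoothAt_ext_of_mem {x z : M} (v : TangentSpace (𝓡 n) x) (hz : z ∈ dom (n := n) x) :
    SmoothAt (ext v) z := by
  have hx : x ∈ dom (n := n) x := mem_chart_source _ x
  rw [smoothAt_iff hz]
  refine (contDiffAt_const (c := toE x x v)).congr_of_eventuallyEq ?_
  filter_upwards [eventually_mem_tgt hz] with y hy
  have h := symm_mem_dom hy
  rw [hat, toE_eq_snd h, ext, FiberBundle.extend, Trivialization.apply_mk_symm _ (mem_baseSet h),
    toE_eq_snd hx]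

lemma smoothAt_ext {x : M} (v : TangentSpace (𝓡 n) x) : SmoothAt (ext v) x :=
  smoothAt_ext_of_mem v (mem_chart_source _ x)

lemma eventually_smoothAt_ext {x : M} (v : TangentSpace (𝓡 n) x) :
    ∀ᶠ z in 𝓝 x, SmoothAt (ext v) z := by
  filter_upwards [eventually_mem_dom (n := n) (mem_chart_source _ x)] with z hz
    using smoothAt_ext_of_mem v hz

@[simp] lemma ext_self {x : M} (v : TangentSpace (𝓡 n) x) : ext v x = v :=
  FiberBundle.extend_apply_self (EuclideanSpace ℝ (Fin n)) v

/-- The derivative of a function in the chart centred at `c`. -/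
lemma mvfderiv_chart {c x : M} (hx : x ∈ dom (n := n) c) {f : M → ℝ}
    {F : EuclideanSpace ℝ (Fin n) → ℝ} (hF : DifferentiableAt ℝ F (extChartAt (𝓡 n) c x))
    (h : ∀ y ∈ tgt c, f ((extChartAt (𝓡 n) c).symm y) = F y) (v : TangentSpace (𝓡 n) x) :
    mvfderiv (𝓡 n) f x v = fderiv ℝ F (extChartAt (𝓡 n) c x) (toE c x v) := by
  have e : f =ᶠ[𝓝 x] F ∘ extChartAt (𝓡 n) c := by
    filter_upwards [eventually_mem_dom hx] with z hz
    rw [Function.comp, ← h _ (extChartAt_mem_tgt hz), symm_extChartAt hz]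
  have h1 := hF.hasFDerivAt.hasMFDerivAt.comp x (mdifferentiableAt_chart hx).hasMFDerivAt
  have h2 := (h1.congr_of_eventuallyEq e).mfderiv
  rw [mvfderiv, h2, toE, TangentBundle.continuousLinearMapAt_trivializationAt hx]
  rfl

/-- Differentiate the composite of the inverse chart with the chart; `toE` is the derivative of the
chart and `ofE` inverts it. -/
lemma mfderiv_symm {c : M} {y : EuclideanSpace ℝ (Fin n)} (hy : y ∈ tgt c) :
    mfderiv 𝓘(ℝ, EuclideanSpace ℝ (Fin n)) (𝓡 n) (extChartAt (𝓡 n) c).symm y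
      = ofE c ((extChartAt (𝓡 n) c).symm y) := by
  have h := symm_mem_dom hy
  have h1 := (mdifferentiableAt_chart h).hasMFDerivAt.comp y
    ((contMDiffAt_symm hy).mdifferentiableAt (by simp)).hasMFDerivAt
  have e : (extChartAt (𝓡 n) c ∘ (extChartAt (𝓡 n) c).symm) =ᶠ[𝓝 y] id := by
    filter_upwards [(isOpen_tgt c).mem_nhds hy] with z hz using extChartAt_symm hz
  have h2 := (h1.congr_of_eventuallyEq e.symm).mfderiv
  rw [mfderiv_id, ← TangentBundle.continuousLinearMapAt_trivializationAt h] at h2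
  ext v
  have h3 := congrArg (fun l ↦ l v) h2
  rw [← ofE_toE h (mfderiv _ _ _ y v)]
  exact congrArg _ h3.symm

/-- Seen as a pullback by the inverse chart, the coordinate expression inherits the naturality of
the Lie bracket. -/
lemma hat_eq_mpullback {c : M} {y : EuclideanSpace ℝ (Fin n)} (hy : y ∈ tgt c) (V : VField n M) :
    VectorField.mpullback 𝓘(ℝ, EuclideanSpace ℝ (Fin n)) (𝓡 n) (extChartAt (𝓡 n) c).symm V y
      = hat c V y := by
  have h := symm_mem_dom hy
  rw [VectorField.mpullback_apply, mfderiv_symm hy]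
  have : (ofE c ((extChartAt (𝓡 n) c).symm y)).inverse = toE c ((extChartAt (𝓡 n) c).symm y) :=
    ContinuousLinearMap.inverse_eq (by ext v : 1; exact ofE_toE h v) (by ext v : 1; exact toE_ofE h v)
  exact congrArg (fun l ↦ l (V ((extChartAt (𝓡 n) c).symm y))) this

lemma mlieBracket_eq_of_eventuallyEq {E : Type*} [NormedAddCommGroup E] [NormedSpace ℝ E]
    {V W V' W' : E → E} {y : E} (hV : V =ᶠ[𝓝 y] V') (hW : W =ᶠ[𝓝 y] W') :
    VectorField.mlieBracket 𝓘(ℝ, E) V W y = VectorField.lieBracket ℝ V' W' y := by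
  refine Eq.trans ?_ (hV.lieBracket_vectorField_eq hW)
  rw [← VectorField.lieBracketWithin_univ]
  exact congrFun (VectorField.mlieBracketWithin_eq_lieBracketWithin (𝕜 := ℝ) (V := V) (W := W)
    (s := univ)) y

/-- The Lie bracket of vector fields in the chart centred at `c`. -/
lemma toE_mlieBracket {c x : M} (hx : x ∈ dom (n := n) c) {V W : VField n M} (hV : SmoothAt V x)
    (hW : SmoothAt W x) :
    toE c x (VectorField.mlieBracket (𝓡 n) V W x)
      = VectorField.lieBracket ℝ (hat c V) (hat c W) (extChartAt (𝓡 n) c x) := by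
  have hy := extChartAt_mem_tgt hx
  have hV' : MDifferentiableAt (𝓡 n) (𝓡 n).tangent
      (fun y ↦ (⟨y, V y⟩ : TangentBundle (𝓡 n) M)) x := hV.mdifferentiableAt (by simp)
  have hW' : MDifferentiableAt (𝓡 n) (𝓡 n).tangent
      (fun y ↦ (⟨y, W y⟩ : TangentBundle (𝓡 n) M)) x := hW.mdifferentiableAt (by simp)
  rw [← symm_extChartAt hx] at hV' hW'
  have : IsManifold (𝓡 n) (minSmoothness ℝ 2) M :=
    IsManifold.of_le (n := ∞) (by simp [minSmoothness_of_isRCLikeNormedField]; exact WithTop.coe_le_coe.2 le_top)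
  have h := VectorField.mpullback_mlieBracket (I := 𝓘(ℝ, EuclideanSpace ℝ (Fin n))) hV' hW'
    (contMDiffAt_symm hy) (by simp [minSmoothness_of_isRCLikeNormedField]; exact WithTop.coe_le_coe.2 le_top)
  rw [hat_eq_mpullback hy, hat_chart hx] at h
  have e : ∀ U : VField n M, (fun y ↦ VectorField.mpullback 𝓘(ℝ, EuclideanSpace ℝ (Fin n)) (𝓡 n)
      (extChartAt (𝓡 n) c).symm U y : EuclideanSpace ℝ (Fin n) → EuclideanSpace ℝ (Fin n))
      =ᶠ[𝓝 (extChartAt (𝓡 n) c x)] hat c U := fun U ↦ by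
    filter_upwards [eventually_mem_tgt hx] with y hy using hat_eq_mpullback hy U
  exact h.trans (mlieBracket_eq_of_eventuallyEq (e V) (e W))

variable [RiemannianBundle (fun x : M ↦ TangentSpace (𝓡 n) x)]

/-- The metric in the chart centred at `c`. -/
def ghat (c : M) (y : EuclideanSpace ℝ (Fin n)) :
    EuclideanSpace ℝ (Fin n) →L[ℝ] EuclideanSpace ℝ (Fin n) →L[ℝ] ℝ :=
  (innerSL ℝ : TangentSpace (𝓡 n) ((extChartAt (𝓡 n) c).symm y) →L[ℝ]
    TangentSpace (𝓡 n) ((extChartAt (𝓡 n) c).symm y) →L[ℝ] ℝ).bilinearComp (ofE c _) (ofE c _)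

lemma ghat_apply (c : M) (y v w : EuclideanSpace ℝ (Fin n)) :
    ghat c y v w = inner ℝ (ofE c ((extChartAt (𝓡 n) c).symm y) v)
      (ofE c ((extChartAt (𝓡 n) c).symm y) w) := rfl

lemma ghat_chart {c x : M} (hx : x ∈ dom (n := n) c) (v w : TangentSpace (𝓡 n) x) :
    ghat c (extChartAt (𝓡 n) c x) (toE c x v) (toE c x w) = inner ℝ v w := by
  -- The base point of `ghat` is only propositionally equal to `x`; it is generalized so that
  -- substitution identifies the tangent spaces.
  have h : ∀ z, z = x → inner ℝ (ofE c z (toE c x v)) (ofE c z (toE c x w)) = inner ℝ v w := by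
    rintro z rfl
    rw [ofE_toE hx, ofE_toE hx]
  exact h _ (symm_extChartAt hx)

lemma ghat_hat {c : M} {y : EuclideanSpace ℝ (Fin n)} (hy : y ∈ tgt c) (V W : VField n M) :
    ghat c y (hat c V y) (hat c W y)
      = inner ℝ (V ((extChartAt (𝓡 n) c).symm y)) (W ((extChartAt (𝓡 n) c).symm y)) := by
  rw [ghat_apply, hat, hat, ofE_toE (symm_mem_dom hy), ofE_toE (symm_mem_dom hy)]

end Chart

/-! ### The metric, the Levi-Civita derivative and the divergence of `M` in charts. -/

section Transfer

variable {n : ℕ} {M : Type*} [TopologicalSpace M]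
  [ChartedSpace (EuclideanSpace ℝ (Fin n)) M] [IsManifold (𝓡 n) ∞ M]
  [RiemannianBundle (fun x : M ↦ TangentSpace (𝓡 n) x)]
  [IsContMDiffRiemannianBundle (𝓡 n) ∞ (EuclideanSpace ℝ (Fin n))
      (fun x : M ↦ TangentSpace (𝓡 n) x)]

lemma contMDiffOn_ofE (c : M) (v : EuclideanSpace ℝ (Fin n)) :
    ContMDiffOn 𝓘(ℝ, EuclideanSpace ℝ (Fin n)) (𝓡 n).tangent ∞
      (fun y ↦ (⟨(extChartAt (𝓡 n) c).symm y, ofE c _ v⟩ : TangentBundle (𝓡 n) M)) (tgt c) := by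
  rw [(trivializationAt (EuclideanSpace ℝ (Fin n)) (TangentSpace (𝓡 n)) c).contMDiffOn_iff
    (fun y hy ↦ (Trivialization.mem_source _).2 (mem_baseSet (symm_mem_dom hy)))]
  refine ⟨contMDiffOn_extChartAt_symm c, (contMDiffOn_const (c := v)).congr fun y hy ↦ ?_⟩
  rw [← toE_eq_snd (symm_mem_dom hy), toE_ofE (symm_mem_dom hy)]

lemma isLocalMetric_ghat (c : M) : IsLocalMetric (tgt (n := n) c) (ghat c) where
  isOpen := isOpen_tgt c
  smooth := by
    refine contDiffOn_clm_apply.2 fun v ↦ contDiffOn_clm_apply.2 fun w ↦ ?_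
    rw [← contMDiffOn_iff_contDiffOn]
    exact ContMDiffOn.inner_bundle (contMDiffOn_ofE c v) (contMDiffOn_ofE c w)
  symm y _ v w := by rw [ghat_apply, ghat_apply, real_inner_comm]
  pos y hy v hv := by
    rw [ghat_apply, real_inner_self_eq_norm_sq]
    have : ofE c ((extChartAt (𝓡 n) c).symm y) v ≠ 0 := fun h ↦ hv <| by
      rw [← toE_ofE (symm_mem_dom hy) v, h, map_zero]
    positivity

lemma differentiableAt_hat {c x : M} (hx : x ∈ dom (n := n) c) {V : VField n M}
    (hV : SmoothAt V x) : DifferentiableAt ℝ (hat c V) (extChartAt (𝓡 n) c x) :=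
  ((smoothAt_iff hx V).1 hV).differentiableAt (by simp)

lemma mvfderiv_inner_chart {c x : M} (hx : x ∈ dom (n := n) c) {V W : VField n M}
    (hV : SmoothAt V x) (hW : SmoothAt W x) (v : TangentSpace (𝓡 n) x) :
    mvfderiv (𝓡 n) (fun y ↦ inner ℝ (V y) (W y)) x v
      = fderiv ℝ (fun y ↦ ghat c y (hat c V y) (hat c W y)) (extChartAt (𝓡 n) c x) (toE c x v) :=
  mvfderiv_chart hx (hasFDerivAt_bilin ((isLocalMetric_ghat c).differentiableAt
    (extChartAt_mem_tgt hx)) (differentiableAt_hat hx hV) (differentiableAt_hat hx hW)).1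
    (fun _ hy ↦ (ghat_hat hy V W).symm) v

lemma koszul_chart {c x : M} (hx : x ∈ dom (n := n) c) {X Y Z : VField n M}
    (hX : SmoothAt X x) (hY : SmoothAt Y x) (hZ : SmoothAt Z x) :
    koszul X Y Z x = ghat c (extChartAt (𝓡 n) c x)
      (cov (ghat c) (hat c Y) (extChartAt (𝓡 n) c x) (toE c x (X x))) (toE c x (Z x)) := by
  have h := (isLocalMetric_ghat c).koszul_eq (extChartAt_mem_tgt hx) (differentiableAt_hat hx hX)
    (differentiableAt_hat hx hY) (differentiableAt_hat hx hZ)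
  simp only [hat_chart hx] at h
  rw [← h, koszul, mvfderiv_inner_chart hx hY hZ, mvfderiv_inner_chart hx hZ hX,
    mvfderiv_inner_chart hx hX hY, ← ghat_chart hx, ← ghat_chart hx, ← ghat_chart hx,
    toE_mlieBracket hx hX hY, toE_mlieBracket hx hY hZ, toE_mlieBracket hx hZ hX]

/-- The Levi-Civita derivative in the chart centred at `c`. -/
lemma toE_nabla {c x : M} (hx : x ∈ dom (n := n) c) {Y : VField n M} (hY : SmoothAt Y x)
    (v : TangentSpace (𝓡 n) x) :
    toE c x (nabla Y x v) = cov (ghat c) (hat c Y) (extChartAt (𝓡 n) c x) (toE c x v) := by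
  set L := cov (ghat c) (hat c Y) (extChartAt (𝓡 n) c x) with hL
  rw [← toE_ofE hx (L (toE c x v))]
  congr 1
  -- The coefficients defining `nabla` are the components ⟨∇_{eᵢ}Y, eⱼ⟩, so the double sum
  -- reassembles ∇_v Y by two orthonormal expansions.
  have hk : ∀ i j, koszul (ext (frame x i)) Y (ext (frame x j)) x
      = inner ℝ (ofE c x (L (toE c x (frame x i)))) (frame x j) := fun i j ↦ by
    rw [koszul_chart hx (smoothAt_ext _) hY (smoothAt_ext _), ext_self, ext_self, ← hL,
      ← toE_ofE hx (L (toE c x (frame x i))), ghat_chart hx, toE_ofE hx]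
  simp only [nabla, hk, sum_apply, smul_apply, ContinuousLinearMap.smulRight_apply,
    innerSL_apply_apply]
  have h1 : ∀ i, ∑ j, inner ℝ (ofE c x (L (toE c x (frame x i)))) (frame x j) •
      inner ℝ (frame x i) v • frame x j = inner ℝ (frame x i) v • ofE c x (L (toE c x (frame x i))) :=
    fun i ↦ by
      conv_rhs => rw [← (frame x).sum_repr' (ofE c x (L (toE c x (frame x i)))), Finset.smul_sum]
      refine Finset.sum_congr rfl fun j _ ↦ ?_
      rw [real_inner_comm, smul_comm]
  simp only [h1]
  conv_rhs => rw [← (frame x).sum_repr' v]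
  simp only [map_sum, map_smul]

lemma inner_eq_ghat {c x : M} (hx : x ∈ dom (n := n) c) (v w : TangentSpace (𝓡 n) x) :
    inner ℝ v w = ghat c (extChartAt (𝓡 n) c x) (toE c x v) (toE c x w) := (ghat_chart hx v w).symm

lemma contDiffAt_cov_hat {c x : M} (hx : x ∈ dom (n := n) c) {Y : VField n M} (hY : SmoothAt Y x) :
    ContDiffAt ℝ ∞ (cov (ghat c) (hat c Y)) (extChartAt (𝓡 n) c x) :=
  (isLocalMetric_ghat c).contDiffAt_cov (extChartAt_mem_tgt hx) ((smoothAt_iff hx Y).1 hY)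

/-- The trace of an endomorphism of a tangent space in the chart centred at `c`. -/
lemma sum_frame {c x : M} (hx : x ∈ dom (n := n) c)
    (A : EuclideanSpace ℝ (Fin n) →L[ℝ] EuclideanSpace ℝ (Fin n)) :
    ∑ i, ghat c (extChartAt (𝓡 n) c x) (A (toE c x (frame x i))) (toE c x (frame x i))
      = LinearMap.trace ℝ (EuclideanSpace ℝ (Fin n)) A := by
  let e : TangentSpace (𝓡 n) x ≃ₗ[ℝ] EuclideanSpace ℝ (Fin n) :=
    LinearEquiv.ofLinearMap (toE (n := n) c x).toLinearMap (ofE (n := n) c x).toLinearMap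
      (by ext v : 1; exact toE_ofE hx v) (by ext v : 1; exact ofE_toE hx v)
  rw [← LinearMap.trace_conj' (A : EuclideanSpace ℝ (Fin n) →ₗ[ℝ] EuclideanSpace ℝ (Fin n)) e.symm,
    LinearMap.trace_eq_sum_inner _ (frame x)]
  refine Finset.sum_congr rfl fun i _ ↦ ?_
  rw [inner_eq_ghat hx, (isLocalMetric_ghat c).symm _ (extChartAt_mem_tgt hx)]
  congr 1
  exact (toE_ofE hx _).symm

/-- The divergence in the chart centred at `c`. -/
lemma divergence_chart {c x : M} (hx : x ∈ dom (n := n) c) {u : VField n M} (hu : SmoothAt u x) :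
    divergence u x = LinearMap.trace ℝ (EuclideanSpace ℝ (Fin n))
      (cov (ghat c) (hat c u) (extChartAt (𝓡 n) c x) :
        EuclideanSpace ℝ (Fin n) →ₗ[ℝ] EuclideanSpace ℝ (Fin n)) := by
  rw [divergence, ← sum_frame hx]
  refine Finset.sum_congr rfl fun i _ ↦ ?_
  rw [inner_eq_ghat hx, toE_nabla hx hu]

end Transfer

/-! ### Curvature, Hodge Laplacian and the Bochner formula on the manifold. -/

section Bochner

variable {n : ℕ} {M : Type*} [TopologicalSpace M]
  [ChartedSpace (EuclideanSpace ℝ (Fin n)) M] [IsManifold (𝓡 n) ∞ M]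
  [RiemannianBundle (fun x : M ↦ TangentSpace (𝓡 n) x)]
  [IsContMDiffRiemannianBundle (𝓡 n) ∞ (EuclideanSpace ℝ (Fin n))
      (fun x : M ↦ TangentSpace (𝓡 n) x)]

/-- The curvature differentiates ∇Z once more, so the coordinate formula is needed on a
neighbourhood; hence `Z` is assumed smooth near `x`. -/
lemma hat_nabla_eventuallyEq {c x : M} (hx : x ∈ dom (n := n) c) {Y Z : VField n M}
    (hZ : ∀ᶠ z in 𝓝 x, SmoothAt Z z) :
    hat c (fun y ↦ nabla Z y (Y y)) =ᶠ[𝓝 (extChartAt (𝓡 n) c x)]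
      fun y ↦ cov (ghat c) (hat c Z) y (hat c Y y) := by
  filter_upwards [eventually_mem_tgt hx, (tendsto_symm hx).eventually hZ] with y hy hy'
  rw [hat, toE_nabla (symm_mem_dom hy) hy', extChartAt_symm hy]
  rfl

lemma smoothAt_nabla {x : M} {Y Z : VField n M} (hY : SmoothAt Y x)
    (hZ : ∀ᶠ z in 𝓝 x, SmoothAt Z z) : SmoothAt (fun y ↦ nabla Z y (Y y)) x := by
  have hx : x ∈ dom (n := n) x := mem_chart_source _ x
  rw [smoothAt_iff hx]
  exact ((contDiffAt_cov_hat hx hZ.self_of_nhds).clm_apply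
    ((smoothAt_iff hx Y).1 hY)).congr_of_eventuallyEq (hat_nabla_eventuallyEq hx hZ)

/-- The curvature tensor in the chart centred at `c`. -/
lemma toE_curvature {c x : M} (hx : x ∈ dom (n := n) c) {X Y Z : VField n M}
    (hX : SmoothAt X x) (hY : SmoothAt Y x) (hZ : ∀ᶠ z in 𝓝 x, SmoothAt Z z) :
    toE c x (curvature X Y Z x)
      = curv (ghat c) (extChartAt (𝓡 n) c x) (toE c x (X x)) (toE c x (Y x)) (toE c x (Z x)) := by
  have hZx := hZ.self_of_nhds
  have h := (isLocalMetric_ghat c).curvature_eq (extChartAt_mem_tgt hx) (differentiableAt_hat hx hX)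
    (differentiableAt_hat hx hY) ((smoothAt_iff hx Z).1 hZx)
  simp only [hat_chart hx] at h
  rw [curvature, map_sub, map_sub, toE_nabla hx (smoothAt_nabla hY hZ),
    toE_nabla hx (smoothAt_nabla hX hZ), toE_nabla hx hZx, toE_mlieBracket hx hX hY,
    (hat_nabla_eventuallyEq hx hZ).cov_eq, (hat_nabla_eventuallyEq hx hZ).cov_eq, h]

lemma ricci_chart {c x : M} (hx : x ∈ dom (n := n) c) (v w : TangentSpace (𝓡 n) x) :
    ricci x v w = ∑ i, ghat c (extChartAt (𝓡 n) c x)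
      (curv (ghat c) (extChartAt (𝓡 n) c x) (toE c x (frame x i)) (toE c x v) (toE c x w))
      (toE c x (frame x i)) := by
  refine Finset.sum_congr rfl fun i _ ↦ ?_
  rw [inner_eq_ghat hx, toE_curvature hx (smoothAt_ext _) (smoothAt_ext _)
    (eventually_smoothAt_ext _)]
  simp only [ext_self]

lemma mvfderiv_inner {x : M} {V W : VField n M} (hV : SmoothAt V x) (hW : SmoothAt W x)
    (v : TangentSpace (𝓡 n) x) :
    mvfderiv (𝓡 n) (fun y ↦ inner ℝ (V y) (W y)) x v
      = inner ℝ (nabla V x v) (W x) + inner ℝ (V x) (nabla W x v) := by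
  have hx : x ∈ dom (n := n) x := mem_chart_source _ x
  rw [mvfderiv_inner_chart hx hV hW, (isLocalMetric_ghat x).fderiv_inner (extChartAt_mem_tgt hx)
    (differentiableAt_hat hx hV) (differentiableAt_hat hx hW), inner_eq_ghat hx, inner_eq_ghat hx,
    toE_nabla hx hV, toE_nabla hx hW, hat_chart hx, hat_chart hx]

lemma mlieBracket_eq_nabla {x : M} {V W : VField n M} (hV : SmoothAt V x) (hW : SmoothAt W x) :
    VectorField.mlieBracket (𝓡 n) V W x = nabla W x (V x) - nabla V x (W x) := by
  have hx : x ∈ dom (n := n) x := mem_chart_source _ x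
  rw [← ofE_toE hx (VectorField.mlieBracket (𝓡 n) V W x), toE_mlieBracket hx hV hW,
    (isLocalMetric_ghat x).lieBracket_eq_cov (extChartAt_mem_tgt hx), hat_chart hx, hat_chart hx,
    ← toE_nabla hx hV, ← toE_nabla hx hW, ← map_sub, ofE_toE hx]

/-- The derivatives of the extensions of `a` and `b` cancel against the bracket, because the
connection has no torsion. -/
lemma dOne_flat {x : M} {u : VField n M} (hu : SmoothAt u x) (a b : TangentSpace (𝓡 n) x) :
    dOne (flat u) x a b = inner ℝ (nabla u x a) b - inner ℝ (nabla u x b) a := by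
  simp only [dOne, flat]
  rw [mvfderiv_inner hu (smoothAt_ext _), mvfderiv_inner hu (smoothAt_ext _),
    mlieBracket_eq_nabla (smoothAt_ext _) (smoothAt_ext _)]
  simp only [ext_self, inner_sub_right]
  ring

lemma codiffOne_flat {x : M} {u : VField n M} (hu : SmoothAt u x) :
    codiffOne (flat u) x = -divergence u x := by
  rw [codiffOne, divergence]
  congr 1
  refine Finset.sum_congr rfl fun i _ ↦ ?_
  simp only [nablaOne, flat]
  rw [mvfderiv_inner hu (smoothAt_ext _)]
  simp

lemma nablaTwo_chart {c x : M} (hx : x ∈ dom (n := n) c) {u : VField n M}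
    (hu : ∀ z, SmoothAt u z) (v a b : TangentSpace (𝓡 n) x) :
    nablaTwo (dOne (flat u)) x v a b
      = ghat c (extChartAt (𝓡 n) c x) (covEnd (ghat c) (cov (ghat c) (hat c u))
          (extChartAt (𝓡 n) c x) (toE c x v) (toE c x a)) (toE c x b)
        - ghat c (extChartAt (𝓡 n) c x) (covEnd (ghat c) (cov (ghat c) (hat c u))
          (extChartAt (𝓡 n) c x) (toE c x v) (toE c x b)) (toE c x a) := by
  have hy := extChartAt_mem_tgt hx
  have hN : DifferentiableAt ℝ (cov (ghat c) (hat c u)) (extChartAt (𝓡 n) c x) :=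
    (contDiffAt_cov_hat hx (hu x)).differentiableAt (by simp)
  have hA := differentiableAt_hat hx (smoothAt_ext a)
  have hB := differentiableAt_hat hx (smoothAt_ext b)
  have hg := (isLocalMetric_ghat c).differentiableAt hy
  have h := (isLocalMetric_ghat c).fderiv_extDeriv hy hN hA hB (toE c x v)
  simp only [hat_chart hx, ext_self] at h
  rw [← h, nablaTwo, mvfderiv_chart hx (F := fun z ↦ ghat c z
      (cov (ghat c) (hat c u) z (hat c (ext a) z)) (hat c (ext b) z)
      - ghat c z (cov (ghat c) (hat c u) z (hat c (ext b) z)) (hat c (ext a) z))]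
  · rw [dOne_flat (hu x), dOne_flat (hu x)]
    simp only [inner_eq_ghat hx, toE_nabla hx (hu x), toE_nabla hx (smoothAt_ext _)]
  · exact ((hasFDerivAt_bilin hg (hN.clm_apply hA) hB).1).sub
      (hasFDerivAt_bilin hg (hN.clm_apply hB) hA).1
  · intro y hy
    have hy' := symm_mem_dom hy
    rw [dOne_flat (hu _), inner_eq_ghat hy', inner_eq_ghat hy', toE_nabla hy' (hu _),
      toE_nabla hy' (hu _), extChartAt_symm hy]
    rfl

/-- The vector field dual to `v ↦ ⟨∇_v u, u⟩`, the gradient of `|u|² / 2`. -/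
def gradEnergy (u : VField n M) : VField n M := fun x ↦
  ∑ i, (inner ℝ (nabla u x (frame x i)) (u x) : ℝ) • frame x i

lemma inner_gradEnergy (u : VField n M) (x : M) (a : TangentSpace (𝓡 n) x) :
    inner ℝ (gradEnergy u x) a = inner ℝ (nabla u x a) (u x) := by
  conv_rhs => rw [← (frame x).sum_repr' a]
  simp only [gradEnergy, sum_inner, inner_smul_left, map_sum, map_smul, conj_trivial]
  exact Finset.sum_congr rfl fun i _ ↦ mul_comm _ _

lemma ghat_hat_gradEnergy {c : M} {u : VField n M} (hu : ∀ z, SmoothAt u z)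
    {y : EuclideanSpace ℝ (Fin n)} (hy : y ∈ tgt c) (a : EuclideanSpace ℝ (Fin n)) :
    ghat c y (hat c (gradEnergy u) y) a
      = ghat c y (cov (ghat c) (hat c u) y a) (hat c u y) := by
  have hy' := symm_mem_dom hy
  have h := inner_gradEnergy u _ (ofE c ((extChartAt (𝓡 n) c).symm y) a)
  rw [inner_eq_ghat hy', inner_eq_ghat hy', toE_nabla hy' (hu _), toE_ofE hy',
    extChartAt_symm hy] at h
  exact h

/-- The frame in the definition is chosen separately at each point, without continuity. Smoothness
comes from duality instead: in coordinates the field is the inverse metric applied to a smooth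
covector. -/
lemma smoothAt_gradEnergy {u : VField n M} (hu : ∀ z, SmoothAt u z) (x : M) :
    SmoothAt (gradEnergy u) x := by
  have hx : x ∈ dom (n := n) x := mem_chart_source _ x
  have hg := isLocalMetric_ghat (n := n) x
  have hy := extChartAt_mem_tgt hx
  rw [smoothAt_iff hx]
  have e : hat x (gradEnergy u) =ᶠ[𝓝 (extChartAt (𝓡 n) x x)] fun y ↦
      (ghat x y).inverse ((ghat x y (hat x u y)).comp (cov (ghat x) (hat x u) y)) := by
    filter_upwards [eventually_mem_tgt hx] with y hy
    refine hg.eq_of_forall hy fun z ↦ ?_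
    rw [ghat_hat_gradEnergy hu hy, hg.apply_inverse hy, hg.symm y hy]
    rfl
  refine ContDiffAt.congr_of_eventuallyEq ?_ e
  exact (hg.contDiffAt_inverse hy).clm_apply (((hg.contDiffAt hy).clm_apply
    ((smoothAt_iff hx u).1 (hu x))).clm_comp (contDiffAt_cov_hat hx (hu x)))

/-- The Bochner-Weitzenböck formula `⟨□u, u⟩ = |∇u|² - Δ|u|²/2 + Ric(u, u)` for a divergence free
vector field. -/
lemma inner_hodgeLaplacian {u : VField n M} (hu : ∀ z, SmoothAt u z)
    (hdiv : ∀ z, divergence u z = 0) (x : M) :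
    inner ℝ (hodgeLaplacian u x) (u x) = ∑ i, ‖nabla u x (frame x i)‖ ^ 2
      - divergence (gradEnergy u) x + ricci x (u x) (u x) := by
  have hx : x ∈ dom (n := n) x := mem_chart_source _ x
  have hg := isLocalMetric_ghat (n := n) x
  have hy := extChartAt_mem_tgt hx
  have h := hg.bochner hy (e := fun i ↦ toE x x (frame x i)) (sum_frame hx)
    ((smoothAt_iff hx u).1 (hu x)) (differentiableAt_hat hx (smoothAt_gradEnergy hu x))
    (fun z hz a ↦ ghat_hat_gradEnergy hu hz a) (fun z hz ↦ by
      have := divergence_chart (symm_mem_dom hz) (hu _)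
      rwa [hdiv, extChartAt_symm hz, eq_comm] at this)
  rw [← divergence_chart hx (smoothAt_gradEnergy hu x), hat_chart hx, ← ricci_chart hx] at h
  have h1 : ∀ i, ghat x (extChartAt (𝓡 n) x x)
      (cov (ghat x) (hat x u) (extChartAt (𝓡 n) x x) (toE x x (frame x i)))
      (cov (ghat x) (hat x u) (extChartAt (𝓡 n) x x) (toE x x (frame x i)))
      = ‖nabla u x (frame x i)‖ ^ 2 := fun i ↦ by
    rw [← toE_nabla hx (hu x), ghat_chart hx, real_inner_self_eq_norm_sq]
  simp only [h1] at h
  rw [← h]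
  -- As div u = 0, the part d d* of □ vanishes and only d* d remains.
  have h2 : codiffOne (flat u) = fun _ ↦ 0 := by
    ext z; rw [codiffOne_flat (hu z), hdiv, neg_zero]
  have h3 : ∀ w, codiffTwo (dOne (flat u)) x w = -∑ i, (ghat x (extChartAt (𝓡 n) x x)
      (covEnd (ghat x) (cov (ghat x) (hat x u)) (extChartAt (𝓡 n) x x) (toE x x (frame x i))
        (toE x x (frame x i))) (toE x x w)
      - ghat x (extChartAt (𝓡 n) x x) (covEnd (ghat x) (cov (ghat x) (hat x u))
        (extChartAt (𝓡 n) x x) (toE x x (frame x i)) (toE x x w)) (toE x x (frame x i))) := by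
    intro w
    rw [codiffTwo]
    simp only [nablaTwo_chart hx hu]
  simp only [hodgeLaplacian, sharp, h2, dFun, mvfderiv_const, zero_apply, zero_add, h3, sum_inner,
    inner_smul_left, conj_trivial]
  conv_rhs => rw [← (frame x).sum_repr' (u x)]
  simp only [map_sum, map_smul, sum_apply, smul_apply, smul_eq_mul]
  simp only [← Finset.sum_sub_distrib, ← mul_sub, Finset.sum_mul, neg_mul,
    ← Finset.sum_neg_distrib]
  rw [Finset.sum_comm]
  refine Finset.sum_congr rfl fun i _ ↦ Finset.sum_congr rfl fun j _ ↦ ?_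
  ring

end Bochner

/-! ### The Riemannian measure in charts. -/

section Measure

variable {n : ℕ} {M : Type*} [TopologicalSpace M]
  [ChartedSpace (EuclideanSpace ℝ (Fin n)) M] [IsManifold (𝓡 n) ∞ M]
  [RiemannianBundle (fun x : M ↦ TangentSpace (𝓡 n) x)]
  [IsContMDiffRiemannianBundle (𝓡 n) ∞ (EuclideanSpace ℝ (Fin n))
      (fun x : M ↦ TangentSpace (𝓡 n) x)]

/-- In matrices, the Gram matrix becomes TᵀGT. This is why √(det g) changes by the absolute Jacobian
between charts. -/
lemma gram_bilinearComp_det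
    (B : EuclideanSpace ℝ (Fin n) →L[ℝ] EuclideanSpace ℝ (Fin n) →L[ℝ] ℝ)
    (L : EuclideanSpace ℝ (Fin n) →L[ℝ] EuclideanSpace ℝ (Fin n)) :
    (gram (B.bilinearComp L L)).det = L.det ^ 2 * (gram B).det := by
  let b := (EuclideanSpace.basisFun (Fin n) ℝ).toBasis
  let T := LinearMap.toMatrix b b (L : EuclideanSpace ℝ (Fin n) →ₗ[ℝ] EuclideanSpace ℝ (Fin n))
  have hT : T.det = L.det := LinearMap.det_toMatrix b _
  have hL : ∀ j, L (EuclideanSpace.single j 1) = ∑ i, T i j • EuclideanSpace.single i (1 : ℝ) := by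
    intro j; ext k; simp [Finset.sum_apply, Pi.single_apply, T, b, LinearMap.toMatrix_apply]
  have e : gram (B.bilinearComp L L) = T.transpose * gram B * T := by
    ext i j
    simp only [gram, Matrix.of_apply, ContinuousLinearMap.bilinearComp_apply, hL, map_sum, map_smul,
      Matrix.mul_apply, Matrix.transpose_apply, _root_.sum_apply, _root_.smul_apply, smul_eq_mul,
      Finset.sum_mul]
    refine Finset.sum_congr rfl fun k _ ↦ ?_
    rw [Finset.mul_sum]
    refine Finset.sum_congr rfl fun l _ ↦ ?_
    ring
  rw [e, Matrix.det_mul, Matrix.det_mul, Matrix.det_transpose, hT]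
  ring

lemma chartMetric_eq_gram {c : M} {y : EuclideanSpace ℝ (Fin n)} (hy : y ∈ tgt c) :
    chartMetric c y = gram (ghat c y) := by
  ext i j
  simp only [chartMetric, Matrix.of_apply, gram, ghat_apply]
  rw [mfderiv_symm hy]
  rfl

/-- The Riemannian measure in the chart centred at `c`. -/
def hatVolume (c : M) : Measure (EuclideanSpace ℝ (Fin n)) :=
  (volume.restrict (tgt c)).withDensity fun y ↦ ENNReal.ofReal (density (ghat c) y)

lemma measurableSet_tgt (c : M) : MeasurableSet (tgt (n := n) c) := (isOpen_tgt c).measurableSet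

lemma continuousOn_density (c : M) : ContinuousOn (density (ghat (n := n) c)) (tgt c) :=
  fun _ hy ↦ (contDiffAt_density (isLocalMetric_ghat c) hy).continuousAt.continuousWithinAt

lemma aemeasurable_density (c : M) :
    AEMeasurable (fun y ↦ ENNReal.ofReal (density (ghat (n := n) c) y)) (volume.restrict (tgt c)) :=
  ((continuousOn_density c).aemeasurable (measurableSet_tgt c)).ennreal_ofReal

variable [MeasurableSpace M]

lemma chartVolume_eq (c : M) :
    chartVolume (n := n) c = Measure.map (extChartAt (𝓡 n) c).symm (hatVolume c) := by
  rw [chartVolume, hatVolume]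
  congr 1
  refine withDensity_congr_ae ?_
  filter_upwards [ae_restrict_mem (measurableSet_tgt c)] with y hy
  rw [density, chartMetric_eq_gram hy]

variable [BorelSpace M]

lemma measurableSet_dom (c : M) : MeasurableSet (dom (n := n) c) := (isOpen_dom c).measurableSet

lemma aemeasurable_symm (c : M) :
    AEMeasurable (extChartAt (𝓡 n) c).symm (hatVolume (n := n) c) :=
  ((continuousOn_extChartAt_symm c).aemeasurable (measurableSet_tgt c)).mono_ac
    (withDensity_absolutelyContinuous _ _)

/-- The inverse chart is continuous only on its target, so measurability passes through the subtype.
-/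
lemma measurableSet_tgt_inter (c : M) {s : Set M} (hs : MeasurableSet s) :
    MeasurableSet (tgt (n := n) c ∩ (extChartAt (𝓡 n) c).symm ⁻¹' s) := by
  have : Measurable ((tgt (n := n) c).domRestrict (extChartAt (𝓡 n) c).symm) :=
    (continuousOn_extChartAt_symm (I := 𝓡 n) c).domRestrict.measurable
  have h := (measurableSet_tgt c).subtype_image (this hs)
  convert h using 1
  ext y
  constructor
  · rintro ⟨hy, hys⟩
    exact ⟨⟨y, hy⟩, hys, rfl⟩
  · rintro ⟨⟨z, hz⟩, hzs, rfl⟩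
    exact ⟨hz, hzs⟩

lemma chartVolume_apply (c : M) {s : Set M} (hs : MeasurableSet s) :
    chartVolume (n := n) c s = ∫⁻ y in tgt (n := n) c ∩ (extChartAt (𝓡 n) c).symm ⁻¹' s,
      ENNReal.ofReal (density (ghat c) y) := by
  have hm := measurableSet_tgt_inter (n := n) c hs
  rw [chartVolume_eq, Measure.map_apply_of_aemeasurable (aemeasurable_symm c) hs]
  have h1 : hatVolume c ((extChartAt (𝓡 n) c).symm ⁻¹' s)
      = hatVolume c (tgt c ∩ (extChartAt (𝓡 n) c).symm ⁻¹' s) := by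
    have h0 : hatVolume (n := n) c (tgt c)ᶜ = 0 := by
      refine withDensity_absolutelyContinuous _ _ ?_
      rw [Measure.restrict_apply (measurableSet_tgt c).compl]
      simp
    refine le_antisymm ?_ (measure_mono inter_subset_right)
    refine (measure_mono fun y hy ↦ ?_).trans ((measure_union_le (tgt c ∩ (extChartAt (𝓡 n) c).symm ⁻¹' s) (tgt (n := n) c)ᶜ).trans_eq ?_)
    · by_cases hyt : y ∈ tgt (n := n) c
      · exact Or.inl ⟨hyt, hy⟩
      · exact Or.inr hyt
    · rw [h0, add_zero]
  rw [h1, hatVolume, withDensity_apply _ hm, Measure.restrict_restrict hm,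
    inter_eq_left.2 inter_subset_left]

lemma chartVolume_inter_dom (c : M) {s : Set M} (hs : MeasurableSet s) :
    chartVolume (n := n) c (s ∩ dom (n := n) c) = chartVolume (n := n) c s := by
  rw [chartVolume_apply c hs, chartVolume_apply c (hs.inter (measurableSet_dom (n := n) c))]
  congr 2
  ext y
  simp only [mem_inter_iff, mem_preimage]
  exact ⟨fun h ↦ ⟨h.1, h.2.1⟩, fun h ↦ ⟨h.1, h.2, symm_mem_dom h.1⟩⟩

/-- The transition map between two charts and its derivative. -/
lemma hasFDerivAt_transition {c c' : M} {y : EuclideanSpace ℝ (Fin n)} (hy : y ∈ tgt c)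
    (hy' : (extChartAt (𝓡 n) c).symm y ∈ dom (n := n) c') :
    HasFDerivAt (extChartAt (𝓡 n) c' ∘ (extChartAt (𝓡 n) c).symm)
      ((toE c' ((extChartAt (𝓡 n) c).symm y)).comp (ofE c ((extChartAt (𝓡 n) c).symm y))) y := by
  have h1 := (mdifferentiableAt_chart hy').hasMFDerivAt.comp y
    ((contMDiffAt_symm hy).mdifferentiableAt (by simp)).hasMFDerivAt
  rw [mfderiv_symm hy, ← TangentBundle.continuousLinearMapAt_trivializationAt hy'] at h1
  exact h1.hasFDerivAt

/-- Change of variables along the transition map: both coordinate metrics represent the same inner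
product, so the Jacobian is exactly the ratio of the densities. -/
lemma chartVolume_congr (c c' : M) {s : Set M} (hs : MeasurableSet s) (h : s ⊆ dom (n := n) c)
    (h' : s ⊆ dom (n := n) c') : chartVolume (n := n) c s = chartVolume (n := n) c' s := by
  rw [chartVolume_apply c hs, chartVolume_apply c' hs]
  set τ := extChartAt (𝓡 n) c' ∘ (extChartAt (𝓡 n) c).symm with hτ
  set S := tgt (n := n) c ∩ (extChartAt (𝓡 n) c).symm ⁻¹' s with hS
  have himg : tgt (n := n) c' ∩ (extChartAt (𝓡 n) c').symm ⁻¹' s = τ '' S := by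
    ext z
    constructor
    · rintro ⟨hz, hzs⟩
      refine ⟨extChartAt (𝓡 n) c ((extChartAt (𝓡 n) c').symm z), ⟨extChartAt_mem_tgt (h hzs), ?_⟩, ?_⟩
      · rw [mem_preimage, symm_extChartAt (h hzs)]; exact hzs
      · rw [hτ, Function.comp, symm_extChartAt (h hzs), extChartAt_symm hz]
    · rintro ⟨y, ⟨hy, hys⟩, rfl⟩
      refine ⟨extChartAt_mem_tgt (h' hys), ?_⟩
      rw [mem_preimage, hτ, Function.comp, symm_extChartAt (h' hys)]
      exact hys
  have hinj : InjOn τ S := by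
    rintro y ⟨hy, hys⟩ z ⟨hz, hzs⟩ hyz
    have := congrArg (extChartAt (𝓡 n) c').symm hyz
    rw [hτ, Function.comp, Function.comp, symm_extChartAt (h' hys), symm_extChartAt (h' hzs)] at this
    rw [← extChartAt_symm hy, this, extChartAt_symm hz]
  rw [himg, lintegral_image_eq_lintegral_abs_det_fderiv_mul volume
    (measurableSet_tgt_inter c hs)
    (fun y hy ↦ (hasFDerivAt_transition hy.1 (h' hy.2)).hasFDerivWithinAt) hinj]
  refine setLIntegral_congr_fun (measurableSet_tgt_inter c hs) fun y hy ↦ ?_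
  have e : ghat c y = (ghat c' (τ y)).bilinearComp
      ((toE c' ((extChartAt (𝓡 n) c).symm y)).comp (ofE c ((extChartAt (𝓡 n) c).symm y)))
      ((toE c' ((extChartAt (𝓡 n) c).symm y)).comp (ofE c ((extChartAt (𝓡 n) c).symm y))) := by
    ext v w
    exact (ghat_chart (h' hy.2) (ofE c ((extChartAt (𝓡 n) c).symm y) v) (ofE c _ w)).symm
  change ENNReal.ofReal (density (ghat c) y) = _
  rw [← ENNReal.ofReal_mul (abs_nonneg _), density, e, gram_bilinearComp_det,
    Real.sqrt_mul (sq_nonneg _), Real.sqrt_sq_eq_abs]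
  rfl

variable [SecondCountableTopology M]

/-- On the domain of a chart, the Riemannian measure is the measure of the chart. -/
lemma vol_apply (c : M) {s : Set M} (hs : MeasurableSet s) (hc : s ⊆ dom (n := n) c) :
    vol n M s = chartVolume (n := n) c s := by
  refine le_antisymm ?_ (le_iSup (fun c : M ↦ chartVolume (n := n) c) c s)
  obtain ⟨t, ht, htu⟩ := TopologicalSpace.countable_cover_nhds (f := fun x : M ↦ dom (n := n) x)
    fun x ↦ (isOpen_dom x).mem_nhds (mem_chart_source _ x)
  have hne : t.Nonempty := by
    rw [nonempty_iff_ne_empty]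
    rintro rfl
    have : c ∈ (∅ : Set M) := by simpa using htu.symm.subset (mem_univ c)
    exact this
  obtain ⟨f, rfl⟩ := ht.exists_eq_range hne
  -- Disjoint measurable pieces that cover `M`, each inside one chart domain.
  let A : ℕ → Set M := disjointed fun k ↦ dom (n := n) (f k)
  have hA : ∀ k, MeasurableSet (A k) := MeasurableSet.disjointed fun k ↦ measurableSet_dom (f k)
  have hAd : Pairwise (Function.onFun Disjoint A) := disjoint_disjointed _
  have hAu : ⋃ k, A k = univ := by
    rw [iUnion_disjointed, ← htu, biUnion_range]
  have hAs : ∀ k, A k ⊆ dom (n := n) (f k) := disjointed_subset _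
  have hsplit : ∀ (μ : Measure M) (s : Set M), MeasurableSet s → μ s = ∑' k, μ (s ∩ A k) := by
    intro μ s hs
    rw [← measure_iUnion (fun i j hij ↦ (hAd hij).mono inter_subset_right inter_subset_right)
      (fun k ↦ hs.inter (hA k)), ← inter_iUnion, hAu, inter_univ]
  -- A supremum of measures is not computed set by set. The glued measure `μ` is an explicit upper
  -- bound for every chart measure, hence for `vol`.
  let μ : Measure M := Measure.sum fun k ↦ (chartVolume (n := n) (f k)).restrict (A k)
  have hμ : ∀ s, MeasurableSet s → μ s = ∑' k, chartVolume (n := n) (f k) (s ∩ A k) := by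
    intro s hs
    rw [Measure.sum_apply _ hs]
    simp only [Measure.restrict_apply hs]
  have hle : vol n M ≤ μ := by
    refine iSup_le fun c' ↦ Measure.le_iff.2 fun s hs ↦ ?_
    rw [hsplit _ s hs, hμ s hs]
    refine ENNReal.tsum_le_tsum fun k ↦ ?_
    rw [← chartVolume_inter_dom c' (hs.inter (hA k)), chartVolume_congr c' (f k)
      ((hs.inter (hA k)).inter (measurableSet_dom c')) inter_subset_right
      (inter_subset_left.trans (inter_subset_right.trans (hAs k)))]
    exact measure_mono inter_subset_left
  refine (hle s).trans ?_
  rw [hμ s hs, hsplit _ s hs]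
  refine ENNReal.tsum_le_tsum fun k ↦ le_of_eq ?_
  exact chartVolume_congr _ _ (hs.inter (hA k)) (inter_subset_right.trans (hAs k))
    (inter_subset_left.trans hc)

lemma vol_restrict_dom (c : M) : (vol n M).restrict (dom (n := n) c) = chartVolume (n := n) c := by
  ext s hs
  rw [Measure.restrict_apply hs, vol_apply c (hs.inter (measurableSet_dom c)) inter_subset_right,
    chartVolume_inter_dom c hs]

/-- The density is continuous, hence integrable on a closed ball inside the chart image. Continuous
functions thereby become integrable on compact sets. -/
instance isLocallyFiniteMeasure_vol : IsLocallyFiniteMeasure (vol n M) := by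
  refine ⟨fun x ↦ ?_⟩
  have hx : x ∈ dom (n := n) x := mem_chart_source _ x
  obtain ⟨r, hr, hrt⟩ := Metric.nhds_basis_closedBall.mem_iff.1
    ((isOpen_tgt x).mem_nhds (extChartAt_mem_tgt hx))
  have hopen : IsOpen (dom (n := n) x ∩ extChartAt (𝓡 n) x ⁻¹' Metric.ball (extChartAt (𝓡 n) x x) r) := by
    have := (continuousOn_extChartAt (I := 𝓡 n) x).isOpen_inter_preimage
      (isOpen_extChartAt_source x) (Metric.isOpen_ball (x := extChartAt (𝓡 n) x x) (ε := r))
    rwa [extChartAt_source] at this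
  refine ⟨_, hopen.mem_nhds ⟨hx, Metric.mem_ball_self hr⟩, ?_⟩
  rw [vol_apply x hopen.measurableSet inter_subset_left, chartVolume_apply x hopen.measurableSet]
  have hK := isCompact_closedBall (extChartAt (𝓡 n) x x) r
  have hint : IntegrableOn (density (ghat (n := n) x))
      (Metric.closedBall (extChartAt (𝓡 n) x x) r) :=
    ((continuousOn_density x).mono hrt).integrableOn_compact hK
  refine lt_of_le_of_lt (lintegral_mono_set ?_) (hint.lintegral_lt_top)
  rintro y ⟨hy, hy', hy''⟩
  rw [mem_preimage, extChartAt_symm hy] at hy''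
  exact Metric.ball_subset_closedBall hy''

/-- Integration in a chart. -/
lemma integral_vol_chart (c : M) {F : M → ℝ} (hF : AEStronglyMeasurable F (vol n M))
    (h0 : ∀ x ∉ dom (n := n) c, F x = 0) :
    ∫ x, F x ∂(vol n M) = ∫ y in tgt (n := n) c,
      density (ghat c) y * F ((extChartAt (𝓡 n) c).symm y) := by
  have hF' : AEStronglyMeasurable F (Measure.map (extChartAt (𝓡 n) c).symm (hatVolume (n := n) c)) := by
    rw [← chartVolume_eq, ← vol_restrict_dom]
    exact hF.restrict
  rw [← setIntegral_eq_integral_of_forall_compl_eq_zero h0, vol_restrict_dom, chartVolume_eq,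
    integral_map (aemeasurable_symm c) hF', hatVolume,
    integral_withDensity_eq_integral_toReal_smul₀ (aemeasurable_density c)
      (Filter.Eventually.of_forall fun _ ↦ ENNReal.ofReal_lt_top)]
  refine setIntegral_congr_fun (measurableSet_tgt c) fun y hy ↦ ?_
  rw [ENNReal.toReal_ofReal (density_pos (isLocalMetric_ghat c) hy).le, smul_eq_mul]

end Measure

/-! ### Compactness of closed balls. -/

section HopfRinow

/-- The Hopf-Rinow-Cohn-Vossen theorem: a complete, locally compact length space is proper. -/
lemma isCompact_closedBall_of_length {X : Type*} [MetricSpace X] [CompleteSpace X]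
    [LocallyCompactSpace X]
    (h : ∀ (x y : X) (r s : ℝ), 0 < r → dist x y < r + s → 0 < s →
      ∃ z, dist x z ≤ r ∧ dist z y < s)
    (x : X) (r : ℝ) : IsCompact (Metric.closedBall x r) := by
  by_contra hr
  -- If some ball is not compact, the radii of compact balls are bounded; their supremum is shown to
  -- be attained and then exceeded.
  let S : Set ℝ := {ρ | IsCompact (Metric.closedBall x ρ)}
  have hdown : ∀ ρ ∈ S, ∀ ρ' ≤ ρ, ρ' ∈ S := fun ρ hρ ρ' h' ↦
    IsCompact.of_isClosed_subset hρ Metric.isClosed_closedBall (Metric.closedBall_subset_closedBall h')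
  have hub : ∀ ρ ∈ S, ρ ≤ r := fun ρ hρ ↦ le_of_not_ge fun hle ↦ hr (hdown ρ hρ r hle)
  have hbdd : BddAbove S := ⟨r, hub⟩
  obtain ⟨K, hK, hxK⟩ := exists_compact_mem_nhds x
  obtain ⟨ρ₀, hρ₀, hρ₀K⟩ := Metric.nhds_basis_closedBall.mem_iff.1 hxK
  have hρ₀S : ρ₀ ∈ S := IsCompact.of_isClosed_subset hK Metric.isClosed_closedBall hρ₀K
  set ρ := sSup S
  have hρ : 0 < ρ := hρ₀.trans_le (le_csSup hbdd hρ₀S)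
  have hlt : ∀ ρ' < ρ, ρ' ∈ S := fun ρ' h' ↦ by
    obtain ⟨σ, hσ, hlt⟩ := exists_lt_of_lt_csSup ⟨ρ₀, hρ₀S⟩ h'
    exact hdown σ hσ ρ' hlt.le
  have hρS : ρ ∈ S := by
    refine TotallyBounded.isCompact_of_isClosed ?_ Metric.isClosed_closedBall
    rw [Metric.totallyBounded_iff]
    intro ε hε
    -- By the length property every point of the ball lies within ε/2 of the compact ball of radius
    -- ρ - δ/2. The minimum with ρ keeps that radius positive.
    set δ := min (ε / 2) ρ
    have hδ : 0 < δ := lt_min (by positivity) hρ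
    have hδε : δ ≤ ε / 2 := min_le_left _ _
    have hδρ : δ ≤ ρ := min_le_right _ _
    obtain ⟨t, ht, htc⟩ := Metric.totallyBounded_iff.1 (hlt (ρ - δ / 2) (by linarith)).totallyBounded
      (ε / 2) (by positivity)
    refine ⟨t, ht, fun y hy ↦ ?_⟩
    obtain ⟨z, hz, hzy⟩ := h x y (ρ - δ / 2) δ (by linarith)
      (by rw [Metric.mem_closedBall, dist_comm] at hy; linarith) hδ
    obtain ⟨w, hw, hzw⟩ := mem_iUnion₂.1 (htc (Metric.mem_closedBall'.2 hz))
    refine mem_iUnion₂.2 ⟨w, hw, ?_⟩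
    rw [Metric.mem_ball] at hzw ⊢
    linarith [dist_triangle y z w, dist_comm z y]
  -- A compact neighbourhood of the ball contains a thickening of it, and the length property places
  -- a larger closed ball in that thickening.
  obtain ⟨K', hK', hKK'⟩ := exists_compact_superset hρS
  obtain ⟨δ, hδ, hδK⟩ := hρS.exists_cthickening_subset_open isOpen_interior hKK'
  have : ρ + δ / 2 ∈ S := by
    refine IsCompact.of_isClosed_subset hK' Metric.isClosed_closedBall fun y hy ↦ ?_
    refine interior_subset (hδK ?_)
    obtain ⟨z, hz, hzy⟩ := h x y ρ δ hρ
      (by rw [Metric.mem_closedBall, dist_comm] at hy; linarith) hδ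
    exact Metric.mem_cthickening_of_dist_le y z δ _ (Metric.mem_closedBall'.2 hz)
      (by rw [dist_comm]; exact hzy.le)
  linarith [le_csSup hbdd this]

/-- Take a curve from `x` to `y` of length less than `r + s` and, by the intermediate value theorem,
a point on it at distance `r` from `x`. The arc before it has length at least `r`, so the arc after
it is shorter than `s`. -/
lemma exists_intermediate_point (n : ℕ) {M : Type*} [MetricSpace M]
    [ChartedSpace (EuclideanSpace ℝ (Fin n)) M] [IsManifold (𝓡 n) ∞ M]
    [RiemannianBundle (fun x : M ↦ TangentSpace (𝓡 n) x)]
    [IsRiemannianManifold (𝓡 n) M]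
    (x y : M) (r s : ℝ) (hr : 0 < r) (h : dist x y < r + s)
    (hs : 0 < s) : ∃ z, dist x z ≤ r ∧ dist z y < s := by
  rcases le_or_gt (dist x y) r with hxy | hxy
  · exact ⟨y, hxy, by simpa using hs⟩
  have h' : riemannianEDist (𝓡 n) x y < ENNReal.ofReal (r + s) := by
    rw [← IsRiemannianManifold.out (I := 𝓡 n) x y, edist_dist]
    exact (ENNReal.ofReal_lt_ofReal_iff (by positivity)).2 h
  obtain ⟨γ, h0, h1, hγ, hlen⟩ := exists_lt_of_riemannianEDist_lt h'
  have hcont : ContinuousOn (fun t ↦ dist x (γ t)) (Icc 0 1) :=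
    Continuous.comp_continuousOn (g := fun z ↦ dist x z) (by fun_prop) hγ.continuousOn
  obtain ⟨t, ht, htr⟩ := intermediate_value_Icc zero_le_one hcont
    (show r ∈ Icc (dist x (γ 0)) (dist x (γ 1)) by rw [h0, h1, dist_self]; exact ⟨hr.le, hxy.le⟩)
  refine ⟨γ t, htr.le, ?_⟩
  have e1 := riemannianEDist_le_pathELength (hγ.mono (Icc_subset_Icc_right ht.2)) h0 rfl ht.1
  have e2 := riemannianEDist_le_pathELength (hγ.mono (Icc_subset_Icc_left ht.1)) rfl h1 ht.2
  rw [← IsRiemannianManifold.out (I := 𝓡 n), edist_dist] at e1 e2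
  have := (add_le_add e1 e2).trans_lt (by rwa [pathELength_add ht.1 ht.2])
  rw [← ENNReal.ofReal_add dist_nonneg dist_nonneg, ENNReal.ofReal_lt_ofReal_iff (by positivity)]
    at this
  simp only at htr
  linarith

/-- The Hopf-Rinow theorem. -/
lemma isCompact_closedBall_of_complete (n : ℕ) {M : Type*} [MetricSpace M]
    [ChartedSpace (EuclideanSpace ℝ (Fin n)) M] [IsManifold (𝓡 n) ∞ M]
    [RiemannianBundle (fun x : M ↦ TangentSpace (𝓡 n) x)]
    [IsRiemannianManifold (𝓡 n) M]
    [CompleteSpace M] (x : M) (r : ℝ) :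
    IsCompact (Metric.closedBall x r) := by
  have : LocallyCompactSpace M := Manifold.locallyCompact_of_finiteDimensional (𝓡 n)
  exact isCompact_closedBall_of_length (exists_intermediate_point n) x r

end HopfRinow

/-! ### Distances along coordinate segments, and derivatives of Lipschitz functions. -/

section Segment

variable {n : ℕ} {M : Type*} [MetricSpace M]
  [ChartedSpace (EuclideanSpace ℝ (Fin n)) M] [IsManifold (𝓡 n) ∞ M]
  [RiemannianBundle (fun x : M ↦ TangentSpace (𝓡 n) x)]
  [IsContMDiffRiemannianBundle (𝓡 n) ∞ (EuclideanSpace ℝ (Fin n))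
      (fun x : M ↦ TangentSpace (𝓡 n) x)]
  [IsRiemannianManifold (𝓡 n) M]

/-- The distance is at most the length of a segment in a chart. -/
lemma dist_symm_segment_le (c : M) {y w : EuclideanSpace ℝ (Fin n)} {s C : ℝ} (hs : 0 ≤ s)
    (hC : 0 ≤ C) (h : ∀ τ ∈ Icc 0 s, y + τ • w ∈ tgt (n := n) c)
    (hg : ∀ τ ∈ Icc 0 s, ghat c (y + τ • w) w w ≤ C ^ 2) :
    dist ((extChartAt (𝓡 n) c).symm (y + s • w)) ((extChartAt (𝓡 n) c).symm y) ≤ s * C := by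
  have hl : ∀ τ : ℝ, HasFDerivAt (fun τ : ℝ ↦ y + τ • w)
      ((ContinuousLinearMap.id ℝ ℝ).smulRight w) τ := fun τ ↦
    ((ContinuousLinearMap.id ℝ ℝ).smulRight w).hasFDerivAt.const_add y
  let γ : ℝ → M := fun τ ↦ (extChartAt (𝓡 n) c).symm (y + τ • w)
  have hγ : ContMDiffOn 𝓘(ℝ, ℝ) (𝓡 n) 1 γ (Icc 0 s) := by
    intro τ hτ
    have h0 : ContDiff ℝ 1 fun τ : ℝ ↦ y + τ • w := by fun_prop
    have h1 : ContMDiffAt 𝓘(ℝ, EuclideanSpace ℝ (Fin n)) (𝓡 n) 1 (extChartAt (𝓡 n) c).symm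
      (y + τ • w) := (contMDiffAt_symm (h τ hτ)).of_le (by simp)
    exact (h1.comp τ h0.contMDiff.contMDiffAt).contMDiffWithinAt
  have hd : ∀ τ ∈ Icc 0 s, ‖mfderiv 𝓘(ℝ, ℝ) (𝓡 n) γ τ (1 : ℝ)‖ₑ ≤ ENNReal.ofReal C := by
    intro τ hτ
    have h1 := ((contMDiffAt_symm (h τ hτ)).mdifferentiableAt (by simp)).hasMFDerivAt.comp τ
      (hl τ).hasMFDerivAt
    rw [mfderiv_symm (h τ hτ)] at h1
    have h2 : mfderiv 𝓘(ℝ, ℝ) (𝓡 n) γ τ (1 : ℝ) = ofE c (γ τ) w := by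
      refine (congrArg (fun l : ℝ →L[ℝ] TangentSpace (𝓡 n) (γ τ) ↦ l 1) h1.mfderiv).trans ?_
      change ofE c (γ τ) ((1 : ℝ) • w) = _
      rw [one_smul]
    rw [h2, ← ofReal_norm]
    refine ENNReal.ofReal_le_ofReal (abs_le_of_sq_le_sq' ?_ hC).2
    rw [← real_inner_self_eq_norm_sq]
    exact hg τ hτ
  have h1 := riemannianEDist_le_pathELength hγ rfl rfl hs
  rw [← IsRiemannianManifold.out (I := 𝓡 n), pathELength_eq_lintegral_mfderiv_Icc] at h1
  have h2 := h1.trans (setLIntegral_mono' measurableSet_Icc hd)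
  rw [setLIntegral_const, Real.volume_Icc, sub_zero, ← ENNReal.ofReal_mul hC, edist_dist,
    ENNReal.ofReal_le_ofReal_iff (by positivity)] at h2
  have e : γ 0 = (extChartAt (𝓡 n) c).symm y := by simp only [γ, zero_smul, add_zero]
  rw [← e, dist_comm]
  exact h2.trans_eq (mul_comm _ _)

/-- Charts are locally bi-Lipschitz; this is the bound for the inverse. -/
lemma exists_dist_symm_le (c : M) {y : EuclideanSpace ℝ (Fin n)} (hy : y ∈ tgt c) :
    ∃ C > 0, ∃ r > 0, Metric.ball y r ⊆ tgt c ∧ ∀ a ∈ Metric.ball y r, ∀ b ∈ Metric.ball y r,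
      dist ((extChartAt (𝓡 n) c).symm a) ((extChartAt (𝓡 n) c).symm b) ≤ C * dist a b := by
  have hcont : ContinuousAt (fun z ↦ ‖ghat c z‖) y :=
    ((isLocalMetric_ghat c).contDiffAt hy).continuousAt.norm
  have hev : ∀ᶠ z in 𝓝 y, ‖ghat c z‖ < ‖ghat c y‖ + 1 ∧ z ∈ tgt c :=
    (hcont.eventually (gt_mem_nhds (lt_add_one _))).and ((isOpen_tgt c).mem_nhds hy)
  obtain ⟨r, hr, hrb⟩ := Metric.eventually_nhds_iff_ball.1 hev
  -- `D` bounds the norm of the metric near `y`, so Riemannian lengths are at most √D times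
  -- Euclidean ones.
  set D := ‖ghat c y‖ + 1 with hD
  have hD0 : 0 < D := by positivity
  refine ⟨√D, Real.sqrt_pos.2 hD0, r, hr, fun z hz ↦ (hrb z hz).2, fun a ha b hb ↦ ?_⟩
  have hseg : ∀ τ ∈ Icc (0 : ℝ) 1, b + τ • (a - b) ∈ Metric.ball y r := fun τ hτ ↦
    (convex_ball y r).add_smul_sub_mem hb ha hτ
  have := dist_symm_segment_le c (y := b) (w := a - b) (s := 1) (C := √D * dist a b) zero_le_one
    (by positivity) (fun τ hτ ↦ (hrb _ (hseg τ hτ)).2) fun τ hτ ↦ by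
      rw [mul_pow, Real.sq_sqrt hD0.le, dist_eq_norm]
      refine (le_abs_self _).trans (((ghat c _).le_opNorm₂ _ _).trans ?_)
      rw [mul_assoc, ← sq]
      exact mul_le_mul_of_nonneg_right (hrb _ (hseg τ hτ)).1.le (sq_nonneg _)
  rwa [one_smul, add_sub_cancel, one_mul] at this

/-- The infinitesimal form of `dist_symm_segment_le`. -/
lemma eventually_dist_symm_le (c : M) {y : EuclideanSpace ℝ (Fin n)} (hy : y ∈ tgt c)
    (w : EuclideanSpace ℝ (Fin n)) {ε : ℝ} (hε : 0 < ε) :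
    ∀ᶠ s in 𝓝[>] (0 : ℝ), dist ((extChartAt (𝓡 n) c).symm (y + s • w))
      ((extChartAt (𝓡 n) c).symm y) ≤ s * (√(ghat c y w w) + ε) := by
  have hl : Filter.Tendsto (fun τ : ℝ ↦ y + τ • w) (𝓝 0) (𝓝 y) := by
    have : Continuous fun τ : ℝ ↦ y + τ • w := by fun_prop
    simpa using this.tendsto 0
  have hcont : ContinuousAt (fun z ↦ √(ghat c z w w)) y :=
    ((((isLocalMetric_ghat c).contDiffAt hy).continuousAt.clm_apply
      continuousAt_const).clm_apply continuousAt_const).sqrt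
  have hev : ∀ᶠ z in 𝓝 y, √(ghat c z w w) < √(ghat c y w w) + ε ∧ z ∈ tgt c :=
    (hcont.eventually (gt_mem_nhds (lt_add_of_pos_right _ hε))).and ((isOpen_tgt c).mem_nhds hy)
  obtain ⟨r, hr, hrb⟩ := Metric.eventually_nhds_iff_ball.1 (hl.eventually hev)
  filter_upwards [Ioo_mem_nhdsGT hr] with s hs
  have hb : ∀ τ ∈ Icc 0 s, τ ∈ Metric.ball (0 : ℝ) r := fun τ hτ ↦ by
    rw [Metric.mem_ball, dist_zero_right, Real.norm_eq_abs, abs_of_nonneg hτ.1]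
    exact hτ.2.trans_lt hs.2
  refine dist_symm_segment_le c hs.1.le (by positivity) (fun τ hτ ↦ (hrb τ (hb τ hτ)).2)
    fun τ hτ ↦ ?_
  exact (Real.sqrt_le_left (by positivity)).1 (hrb τ (hb τ hτ)).1.le

/-- The derivative of the square of a Lipschitz function. -/
lemma abs_fderiv_sq_le (c : M) {y : EuclideanSpace ℝ (Fin n)} (hy : y ∈ tgt c) {χ : M → ℝ} {L : ℝ}
    (hL0 : 0 ≤ L)
    (hχ0 : ∀ x, 0 ≤ χ x) (hL : ∀ x z, |χ x - χ z| ≤ L * dist x z) {Q : EuclideanSpace ℝ (Fin n) → ℝ}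
    (hQ : Q =ᶠ[𝓝 y] fun z ↦ χ ((extChartAt (𝓡 n) c).symm z) ^ 2) (hd : DifferentiableAt ℝ Q y)
    (w : EuclideanSpace ℝ (Fin n)) :
    |fderiv ℝ Q y w| ≤ 2 * L * χ ((extChartAt (𝓡 n) c).symm y) * √(ghat c y w w) := by
  set φ := (extChartAt (𝓡 n) c).symm
  have hχc : Continuous χ := by
    have : LipschitzWith L.toNNReal χ := LipschitzWith.of_dist_le_mul fun x z ↦ by
      rw [Real.coe_toNNReal _ hL0, Real.dist_eq]; exact hL x z
    exact this.continuous
  have hl : Filter.Tendsto (fun τ : ℝ ↦ y + τ • w) (𝓝 0) (𝓝 y) := by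
    have : Continuous fun τ : ℝ ↦ y + τ • w := by fun_prop
    simpa using this.tendsto 0
  have hφ : ContinuousAt φ y := (contMDiffAt_symm hy).continuousAt
  have hlim : Filter.Tendsto (fun s : ℝ ↦ χ (φ (y + s • w)) + χ (φ y)) (𝓝[>] 0)
      (𝓝 (χ (φ y) + χ (φ y))) :=
    (((hχc.continuousAt.tendsto.comp (hφ.tendsto.comp hl)).mono_left nhdsWithin_le_nhds).add_const _)
  have hder : HasDerivAt (fun s : ℝ ↦ Q (y + s • w)) (fderiv ℝ Q y w) 0 :=
    hd.hasFDerivAt.hasLineDerivAt w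
  have hslope : Filter.Tendsto _ (𝓝[>] (0 : ℝ)) _ := (hasDerivAt_iff_tendsto_slope.1 hder).mono_left
    (nhdsWithin_mono (0 : ℝ) (fun s (hs : 0 < s) ↦ hs.ne'))
  refine le_of_forall_pos_le_add fun ε hε ↦ ?_
  -- One-sided difference quotients suffice. In a² - b² = (a + b)(a - b) the second factor is at
  -- most L times the length of a short segment, while the first tends to 2χ.
  have key : ∀ δ > 0, |fderiv ℝ Q y w| ≤ L * (√(ghat c y w w) + δ) * (χ (φ y) + χ (φ y)) := by
    intro δ hδ
    refine le_of_tendsto_of_tendsto hslope.abs (hlim.const_mul _) ?_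
    filter_upwards [eventually_dist_symm_le c hy w hδ, self_mem_nhdsWithin,
      nhdsWithin_le_nhds (hl.eventually hQ)] with s hs hs0 hQs
    have hs0 : 0 < s := hs0
    rw [slope_def_field, sub_zero, zero_smul, add_zero, abs_div, abs_of_pos hs0, div_le_iff₀ hs0, hQs,
      hQ.self_of_nhds, sq_sub_sq, abs_mul, abs_of_nonneg (add_nonneg (hχ0 _) (hχ0 _))]
    calc _ ≤ (χ (φ (y + s • w)) + χ (φ y)) * (L * (s * (√(ghat c y w w) + δ))) :=
          mul_le_mul_of_nonneg_left ((hL _ _).trans (mul_le_mul_of_nonneg_left hs hL0))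
            (add_nonneg (hχ0 _) (hχ0 _))
      _ = _ := by ring
  have h0 : Filter.Tendsto (fun δ : ℝ ↦ L * (√(ghat c y w w) + δ) * (χ (φ y) + χ (φ y))) (𝓝[>] 0)
      (𝓝 (L * (√(ghat c y w w) + 0) * (χ (φ y) + χ (φ y)))) := by
    refine Filter.Tendsto.mono_left (Continuous.tendsto ?_ 0) nhdsWithin_le_nhds
    fun_prop
  have := ge_of_tendsto h0 (by filter_upwards [self_mem_nhdsWithin] with δ hδ using key δ hδ)
  linarith

end Segment

/-! ### Locality of the divergence and continuity of the basic quantities. -/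

section Continuity

variable {n : ℕ} {M : Type*} [TopologicalSpace M]
  [ChartedSpace (EuclideanSpace ℝ (Fin n)) M] [IsManifold (𝓡 n) ∞ M]
  [RiemannianBundle (fun x : M ↦ TangentSpace (𝓡 n) x)]
  [IsContMDiffRiemannianBundle (𝓡 n) ∞ (EuclideanSpace ℝ (Fin n))
      (fun x : M ↦ TangentSpace (𝓡 n) x)]

lemma hat_eventuallyEq {c x : M} (hx : x ∈ dom (n := n) c) {V W : VField n M}
    (h : ∀ᶠ z in 𝓝 x, V z = W z) :
    hat c V =ᶠ[𝓝 (extChartAt (𝓡 n) c x)] hat c W := by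
  filter_upwards [(tendsto_symm hx).eventually h] with y hy
  rw [hat, hat, hy]

lemma smoothAt_congr {V W : VField n M} {x : M} (hV : SmoothAt V x)
    (h : ∀ᶠ z in 𝓝 x, W z = V z) : SmoothAt W x := by
  have hx : x ∈ dom (n := n) x := mem_chart_source _ x
  rw [smoothAt_iff hx] at hV ⊢
  exact hV.congr_of_eventuallyEq (hat_eventuallyEq hx h)

lemma divergence_congr {V W : VField n M} {x : M} (hV : SmoothAt V x)
    (h : ∀ᶠ z in 𝓝 x, W z = V z) : divergence W x = divergence V x := by
  have hx : x ∈ dom (n := n) x := mem_chart_source _ x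
  rw [divergence_chart hx hV, divergence_chart hx (smoothAt_congr hV h),
    (hat_eventuallyEq hx h).cov_eq]

lemma smoothAt_zero (x : M) : SmoothAt (0 : VField n M) x := by
  have hx : x ∈ dom (n := n) x := mem_chart_source _ x
  rw [smoothAt_iff hx]
  have : hat x (0 : VField n M) = fun _ ↦ 0 := by
    ext y : 1
    exact map_zero _
  rw [this]
  exact contDiffAt_const

lemma divergence_of_eventually_zero {V : VField n M} {x : M} (h : ∀ᶠ z in 𝓝 x, V z = 0) :
    divergence V x = 0 := by
  have hx : x ∈ dom (n := n) x := mem_chart_source _ x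
  rw [divergence_congr (smoothAt_zero x) h, divergence_chart hx (smoothAt_zero x)]
  have : hat x (0 : VField n M) = fun _ ↦ 0 := by
    ext y : 1
    exact map_zero _
  have e : cov (ghat x) (hat x (0 : VField n M)) (extChartAt (𝓡 n) x x) = 0 := by
    ext v : 1
    rw [this, cov_apply]
    simp
  rw [e]
  simp

lemma continuousAt_of_chart {X : Type*} [TopologicalSpace X] {c x : M} (hx : x ∈ dom (n := n) c)
    {f : M → X} {F : EuclideanSpace ℝ (Fin n) → X} (hF : ContinuousAt F (extChartAt (𝓡 n) c x))
    (h : ∀ z ∈ dom (n := n) c, f z = F (extChartAt (𝓡 n) c z)) : ContinuousAt f x := by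
  refine (ContinuousAt.comp (f := extChartAt (𝓡 n) c) hF (tendsto_chart hx)).congr ?_
  filter_upwards [eventually_mem_dom hx] with z hz using (h z hz).symm

lemma continuous_divergence {V : VField n M} (hV : ∀ x, SmoothAt V x) :
    Continuous (divergence V) := by
  refine continuous_iff_continuousAt.2 fun x ↦ ?_
  have hx : x ∈ dom (n := n) x := mem_chart_source _ x
  let T : (EuclideanSpace ℝ (Fin n) →L[ℝ] EuclideanSpace ℝ (Fin n)) →ₗ[ℝ] ℝ :=
    (LinearMap.trace ℝ (EuclideanSpace ℝ (Fin n))) ∘ₗ ContinuousLinearMap.coeLM ℝ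
  exact continuousAt_of_chart hx (T.continuous_of_finiteDimensional.continuousAt.comp
    (contDiffAt_cov_hat hx (hV x)).continuousAt) fun z hz ↦ divergence_chart hz (hV z)

lemma continuous_inner {V W : VField n M} (hV : ∀ x, SmoothAt V x) (hW : ∀ x, SmoothAt W x) :
    Continuous fun x ↦ inner ℝ (V x) (W x) := by
  refine continuous_iff_continuousAt.2 fun x ↦ ?_
  have hx : x ∈ dom (n := n) x := mem_chart_source _ x
  refine continuousAt_of_chart hx (F := fun y ↦ ghat x y (hat x V y) (hat x W y)) ?_ fun z hz ↦ ?_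
  · exact (((isLocalMetric_ghat x).contDiffAt (extChartAt_mem_tgt hx)).continuousAt.clm_apply
      (differentiableAt_hat hx (hV x)).continuousAt).clm_apply
      (differentiableAt_hat hx (hW x)).continuousAt
  · rw [hat_chart hz, hat_chart hz, ghat_chart hz]

lemma continuous_norm {V : VField n M} (hV : ∀ x, SmoothAt V x) : Continuous fun x ↦ ‖V x‖ := by
  have : (fun x ↦ ‖V x‖) = fun x ↦ √(inner ℝ (V x) (V x)) := by
    ext x
    rw [real_inner_self_eq_norm_sq, Real.sqrt_sq (norm_nonneg _)]
  rw [this]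
  exact (continuous_inner hV hV).sqrt

end Continuity

/-! ### Integration by parts inside one chart. -/

section LocalDivergence

variable {n : ℕ} {M : Type*} [MetricSpace M] [SecondCountableTopology M]
  [MeasurableSpace M] [BorelSpace M]
  [ChartedSpace (EuclideanSpace ℝ (Fin n)) M] [IsManifold (𝓡 n) ∞ M]
  [RiemannianBundle (fun x : M ↦ TangentSpace (𝓡 n) x)]
  [IsContMDiffRiemannianBundle (𝓡 n) ∞ (EuclideanSpace ℝ (Fin n))
      (fun x : M ↦ TangentSpace (𝓡 n) x)]
  [IsRiemannianManifold (𝓡 n) M]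

lemma locallyLipschitzOn_sq (c : M) {χ : M → ℝ} {L : ℝ} (hL0 : 0 ≤ L) (hχ0 : ∀ x, 0 ≤ χ x)
    (hχ : Continuous χ) (hL : ∀ x z, |χ x - χ z| ≤ L * dist x z) :
    LocallyLipschitzOn (tgt (n := n) c) fun y ↦ χ ((extChartAt (𝓡 n) c).symm y) ^ 2 := by
  intro y hy
  obtain ⟨C, hC, r, hr, hrt, hd⟩ := exists_dist_symm_le c hy
  set φ := (extChartAt (𝓡 n) c).symm
  have hcont : ContinuousAt (fun z ↦ χ (φ z)) y :=
    hχ.continuousAt.comp (contMDiffAt_symm hy).continuousAt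
  have hev := (hcont.eventually (gt_mem_nhds (lt_add_one _))).and (Metric.ball_mem_nhds y hr)
  set B := χ (φ y) + 1
  have hB : 0 ≤ B := add_nonneg (hχ0 _) zero_le_one
  refine ⟨(2 * B * (L * C)).toNNReal, _, nhdsWithin_le_nhds hev, ?_⟩
  refine LipschitzOnWith.of_dist_le_mul fun a ha b hb ↦ ?_
  rw [Real.coe_toNNReal _ (by positivity), Real.dist_eq, sq_sub_sq, abs_mul,
    abs_of_nonneg (add_nonneg (hχ0 _) (hχ0 _)), mul_assoc (2 * B)]
  refine mul_le_mul (by linarith [ha.1, hb.1]) ((hL _ _).trans ?_) (abs_nonneg _) (by positivity)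
  rw [mul_assoc]
  exact mul_le_mul_of_nonneg_left (hd a ha.2 b hb.2) hL0

/-- In coordinates ρ div V = ∑ₖ ∂ₖ(ρVᵏ), so the integral is -∫ρ d(χ²)(V). Although χ is only
Lipschitz, Rademacher's theorem makes χ² differentiable almost everywhere in the chart, and there
|d(χ²)(V)| ≤ 2Lχ|V|. -/
lemma abs_integral_sq_mul_divergence_le_of_subset_dom (c : M) {K : Set M} (hK : IsCompact K)
    (hKc : K ⊆ dom (n := n) c) {V : VField n M} (hV : ∀ x, SmoothAt V x)
    (hV0 : ∀ x ∉ K, V x = 0) {χ : M → ℝ} {L : ℝ} (hL0 : 0 ≤ L) (hχ0 : ∀ x, 0 ≤ χ x)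
    (hL : ∀ x z, |χ x - χ z| ≤ L * dist x z) :
    |∫ x, χ x ^ 2 * divergence V x ∂(vol n M)| ≤ ∫ x, 2 * L * χ x * ‖V x‖ ∂(vol n M) := by
  have hχ : Continuous χ := by
    have : LipschitzWith L.toNNReal χ := LipschitzWith.of_dist_le_mul fun x z ↦ by
      rw [Real.coe_toNNReal _ hL0, Real.dist_eq]; exact hL x z
    exact this.continuous
  set φ := (extChartAt (𝓡 n) c).symm with hφ
  set ρ := density (ghat (n := n) c) with hρ
  have hcov := continuous_divergence hV
  have hnorm := continuous_norm hV
  have hdiv0 : ∀ x ∉ K, divergence V x = 0 := fun x hx ↦ divergence_of_eventually_zero (by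
    filter_upwards [hK.isClosed.isOpen_compl.mem_nhds hx] with z hz using hV0 z hz)
  -- passage to the chart
  rw [integral_vol_chart c (by fun_prop) fun x hx ↦ by rw [hdiv0 x fun h ↦ hx (hKc h), mul_zero],
    integral_vol_chart c (by fun_prop) fun x hx ↦ by rw [hV0 x fun h ↦ hx (hKc h), norm_zero,
      mul_zero]]
  set K' := extChartAt (𝓡 n) c '' K with hK'
  have hK'c : IsCompact K' := hK.image_of_continuousOn fun x hx ↦
    (contMDiffAt_chart (hKc hx)).continuousAt.continuousWithinAt
  have hK't : K' ⊆ tgt c := image_subset_iff.2 fun x hx ↦ extChartAt_mem_tgt (hKc hx)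
  have hVK : ∀ y ∈ tgt c, y ∉ K' → V (φ y) = 0 := fun y hy hyK ↦ hV0 _ fun h ↦
    hyK ⟨φ y, h, extChartAt_symm hy⟩
  have hhat0 : ∀ y ∈ tgt c, y ∉ K' → hat c V y = 0 := fun y hy hyK ↦ by
    rw [hat, hVK y hy hyK, map_zero]
  -- In coordinates χ² is only locally Lipschitz, and only on the chart image. Its restriction to a
  -- compact neighbourhood of `K'` is extended to a Lipschitz function `Q` on the whole space;
  -- values away from `K'` do not matter, since `V` vanishes there.
  obtain ⟨K₂, hK₂, hK'K₂, hK₂t⟩ := exists_compact_between hK'c (isOpen_tgt c) hK't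
  obtain ⟨N, hN⟩ := ((locallyLipschitzOn_sq c hL0 hχ0 hχ hL).mono hK₂t).exists_lipschitzOnWith_of_compact
    hK₂
  obtain ⟨Q, hQ, hQeq⟩ := hN.extend_real
  -- the vector field, extended by zero
  let f : Fin n → EuclideanSpace ℝ (Fin n) → ℝ := fun k ↦
    (tgt (n := n) c).indicator fun y ↦ ρ y * hat c V y k
  have hf_eq : ∀ k, ∀ y ∈ tgt c, f k =ᶠ[𝓝 y] fun y ↦ ρ y * hat c V y k := fun k y hy ↦ by
    filter_upwards [(isOpen_tgt c).mem_nhds hy] with z hz using indicator_of_mem hz _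
  have hf0 : ∀ k, ∀ y ∉ K', f k y = 0 := fun k y hy ↦ by
    by_cases hyt : y ∈ tgt c
    · refine (hf_eq k y hyt).self_of_nhds.trans ?_
      simp [hhat0 y hyt hy]
    · exact indicator_of_notMem hyt _
  have hf_supp : ∀ k, HasCompactSupport (f k) := fun k ↦ HasCompactSupport.intro hK'c (hf0 k)
  have hf_diff : ∀ k, ContDiff ℝ 1 (f k) := fun k ↦ contDiff_iff_contDiffAt.2 fun y ↦ by
    by_cases hy : y ∈ tgt c
    · refine ContDiffAt.congr_of_eventuallyEq ?_ (hf_eq k y hy)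
      have hVy : ContDiffAt ℝ ∞ (hat c V) y := by
        have := (smoothAt_iff (symm_mem_dom hy) V).1 (hV _)
        rwa [extChartAt_symm hy] at this
      have h1 := (contDiffAt_density (isLocalMetric_ghat c) hy).mul
        (contDiffAt_euclidean.1 hVy k)
      exact h1.of_le (by simp)
    · refine (contDiffAt_const (c := (0 : ℝ))).congr_of_eventuallyEq ?_
      filter_upwards [hK'c.isClosed.isOpen_compl.mem_nhds fun h ↦ hy (hK't h)] with z hz
        using hf0 k z hz
  have hfd0 : ∀ k, ∀ y ∉ K', fderiv ℝ (f k) y = 0 := fun k y hy ↦ by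
    have : f k =ᶠ[𝓝 y] fun _ ↦ 0 := by
      filter_upwards [hK'c.isClosed.isOpen_compl.mem_nhds hy] with z hz using hf0 k z hz
    rw [this.fderiv_eq, fderiv_fun_const]
    rfl
  have hdivK : ∀ y ∈ tgt c, y ∉ K' → divergence V (φ y) = 0 := fun y hy hyK ↦ hdiv0 _ fun h ↦
    hyK ⟨φ y, h, extChartAt_symm hy⟩
  let e : Fin n → EuclideanSpace ℝ (Fin n) := fun k ↦ EuclideanSpace.single k 1
  have hA : ∫ y in tgt c, ρ y * (χ (φ y) ^ 2 * divergence V (φ y))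
      = ∫ y, ∑ k, lineDeriv ℝ (f k) y (e k) * Q y := by
    refine Eq.trans ?_ (setIntegral_eq_integral_of_forall_compl_eq_zero (s := tgt (n := n) c) ?_)
    · refine setIntegral_congr_fun (measurableSet_tgt c) fun y hy ↦ ?_
      have hl : ∀ k, lineDeriv ℝ (f k) y (e k) = fderiv ℝ (f k) y (e k) := fun k ↦
        (((hf_diff k).differentiable (by simp)) y).lineDeriv_eq_fderiv
      simp only [hl]
      by_cases hyK : y ∈ K'
      · have hQy : Q y = χ (φ y) ^ 2 := (hQeq (interior_subset (hK'K₂ hyK))).symm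
        have hVd : DifferentiableAt ℝ (hat c V) y := by
          have := differentiableAt_hat (V := V) (symm_mem_dom hy) (hV _)
          rwa [extChartAt_symm hy] at this
        have hdiv := divergence_chart (symm_mem_dom hy) (hV (φ y))
        rw [extChartAt_symm hy] at hdiv
        have := density_mul_trace_cov (isLocalMetric_ghat c) hy hVd
        rw [← hdiv] at this
        have hs : ∑ k, fderiv ℝ (f k) y (e k) = ρ y * divergence V (φ y) := by
          rw [this]
          exact Finset.sum_congr rfl fun k _ ↦ by rw [(hf_eq k y hy).fderiv_eq]
        rw [hQy, ← Finset.sum_mul, hs]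
        ring
      · simp [hdivK y hy hyK, hfd0 _ y hyK]
    · intro y hy
      refine Finset.sum_eq_zero fun k _ ↦ ?_
      rw [(((hf_diff k).differentiable (by simp)) y).lineDeriv_eq_fderiv, hfd0 k y fun h ↦ hy (hK't h)]
      simp
  have hf_lip : ∀ k, ∃ D, LipschitzWith D (f k) := fun k ↦
    (hf_diff k).lipschitzWith_of_hasCompactSupport (hf_supp k) (by simp)
  choose D hD using hf_lip
  have hint1 : ∀ k, Integrable fun y ↦ lineDeriv ℝ (f k) y (e k) * Q y := fun k ↦ by
    have hc : Continuous fun y ↦ fderiv ℝ (f k) y (e k) * Q y :=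
      (((hf_diff k).continuous_fderiv (by simp)).clm_apply continuous_const).mul hQ.continuous
    refine (hc.integrable_of_hasCompactSupport ?_).congr (.of_forall fun y ↦ ?_)
    · refine HasCompactSupport.intro hK'c fun y hy ↦ ?_
      rw [hfd0 k y hy]
      simp
    · simp only [(((hf_diff k).differentiable (by simp)) y).lineDeriv_eq_fderiv]
  have hint2 : ∀ k, Integrable fun y ↦ lineDeriv ℝ Q y (e k) * f k y := fun k ↦
    ((hf_diff k).continuous.integrable_of_hasCompactSupport (hf_supp k)).bdd_mul
      (aestronglyMeasurable_lineDeriv hQ.continuous _)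
      (.of_forall fun _ ↦ norm_lineDeriv_le_of_lipschitz ℝ hQ)
  have hB : ∫ y, ∑ k, lineDeriv ℝ (f k) y (e k) * Q y
      = -∫ y, ∑ k, lineDeriv ℝ Q y (e k) * f k y := by
    rw [integral_finsetSum _ fun k _ ↦ hint1 k, integral_finsetSum _ fun k _ ↦ hint2 k,
      ← Finset.sum_neg_distrib]
    refine Finset.sum_congr rfl fun k _ ↦ ?_
    rw [hQ.integral_lineDeriv_mul_eq (hD k) (hf_supp k), ← integral_neg]
    simp only [lineDeriv_neg, neg_mul, neg_neg]
  set b : EuclideanSpace ℝ (Fin n) → ℝ := (tgt (n := n) c).indicator fun y ↦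
    ρ y * (2 * L * χ (φ y) * ‖V (φ y)‖) with hb
  have hbint : Integrable b := by
    have h0 : ∀ y ∉ K', b y = 0 := fun y hy ↦ by
      by_cases hyt : y ∈ tgt c
      · rw [hb, indicator_of_mem hyt, hVK y hyt hy, norm_zero, mul_zero, mul_zero]
      · exact indicator_of_notMem hyt _
    rw [← integrableOn_iff_integrable_of_support_subset (s := K') fun y hy ↦ by
      by_contra h
      exact hy (h0 y h)]
    refine ContinuousOn.integrableOn_compact hK'c fun y hy ↦ ContinuousAt.continuousWithinAt ?_
    have hyt := hK't hy
    have hφy : ContinuousAt φ y := (contMDiffAt_symm hyt).continuousAt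
    have h1 : ContinuousAt (fun y ↦ ρ y * (2 * L * χ (φ y) * ‖V (φ y)‖)) y :=
      (contDiffAt_density (isLocalMetric_ghat c) hyt).continuousAt.mul
        ((continuousAt_const.mul (hχ.continuousAt.comp hφy)).mul (hnorm.continuousAt.comp hφy))
    refine h1.congr ?_
    filter_upwards [(isOpen_tgt c).mem_nhds hyt] with z hz
    rw [hb, indicator_of_mem hz]
  rw [hA, hB, abs_neg, ← Real.norm_eq_abs, ← integral_indicator (measurableSet_tgt c)]
  refine norm_integral_le_of_norm_le hbint ?_
  filter_upwards [hQ.ae_differentiableAt] with y hy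
  by_cases hyK : y ∈ K'
  · have hyt := hK't hyK
    have hQy : Q =ᶠ[𝓝 y] fun z ↦ χ (φ z) ^ 2 := by
      filter_upwards [isOpen_interior.mem_nhds (hK'K₂ hyK)] with z hz
        using (hQeq (interior_subset hz)).symm
    have hsum : ∑ k, hat c V y k • e k = hat c V y := by
      have := (EuclideanSpace.basisFun (Fin n) ℝ).sum_repr (hat c V y)
      simpa using this
    have e1 : ∑ k, lineDeriv ℝ Q y (e k) * f k y = ρ y * fderiv ℝ Q y (hat c V y) := by
      conv_rhs => rw [← hsum, map_sum, Finset.mul_sum]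
      refine Finset.sum_congr rfl fun k _ ↦ ?_
      rw [hy.lineDeriv_eq_fderiv, (hf_eq k y hyt).self_of_nhds, map_smul, smul_eq_mul]
      ring
    have hρ0 : 0 ≤ ρ y := (density_pos (isLocalMetric_ghat c) hyt).le
    rw [e1, indicator_of_mem hyt, Real.norm_eq_abs, abs_mul, abs_of_nonneg hρ0]
    refine mul_le_mul_of_nonneg_left ?_ hρ0
    have := abs_fderiv_sq_le c hyt hL0 hχ0 hL hQy hy (hat c V y)
    rwa [ghat_hat hyt, real_inner_self_eq_norm_sq, Real.sqrt_sq (norm_nonneg _)] at this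
  · simp only [hf0 _ y hyK, mul_zero, Finset.sum_const_zero, norm_zero]
    refine indicator_nonneg (fun z hz ↦ mul_nonneg (density_pos (isLocalMetric_ghat c) hz).le ?_) y
    have := hχ0 (φ z)
    positivity

end LocalDivergence

/-! ### Algebraic rules for the divergence. -/

section Algebra

variable {n : ℕ} {M : Type*} [TopologicalSpace M]
  [ChartedSpace (EuclideanSpace ℝ (Fin n)) M] [IsManifold (𝓡 n) ∞ M]
  [RiemannianBundle (fun x : M ↦ TangentSpace (𝓡 n) x)]
  [IsContMDiffRiemannianBundle (𝓡 n) ∞ (EuclideanSpace ℝ (Fin n))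
      (fun x : M ↦ TangentSpace (𝓡 n) x)]

lemma hat_add (c : M) (V W : VField n M) : hat c (V + W) = hat c V + hat c W := by
  ext y : 1
  exact map_add _ _ _

lemma hat_smul (c : M) (f : M → ℝ) (V : VField n M) :
    hat c (fun x ↦ f x • V x) = fun y ↦ f ((extChartAt (𝓡 n) c).symm y) • hat c V y := by
  ext y : 1
  exact map_smul _ _ _

lemma smoothAt_add {V W : VField n M} {x : M} (hV : SmoothAt V x) (hW : SmoothAt W x) :
    SmoothAt (V + W) x := by
  have hx : x ∈ dom (n := n) x := mem_chart_source _ x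
  rw [smoothAt_iff hx] at *
  rw [hat_add]
  exact hV.add hW

lemma smoothAt_sum {ι : Type*} (J : Finset ι) {V : ι → VField n M} {x : M}
    (hV : ∀ i, SmoothAt (V i) x) : SmoothAt (∑ i ∈ J, V i) x := by
  classical
  induction J using Finset.induction_on with
  | empty => exact smoothAt_zero x
  | insert i J hi ih => rw [Finset.sum_insert hi]; exact smoothAt_add (hV i) ih

/-- A function smooth at a point is smooth in a chart. -/
lemma contDiffAt_comp_symm {f : M → ℝ} {c x : M} (hx : x ∈ dom (n := n) c)
    (hf : ContMDiffAt (𝓡 n) 𝓘(ℝ, ℝ) ∞ f x) :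
    ContDiffAt ℝ ∞ (fun y ↦ f ((extChartAt (𝓡 n) c).symm y)) (extChartAt (𝓡 n) c x) := by
  rw [← contMDiffAt_iff_contDiffAt]
  refine ContMDiffAt.comp _ (g := f) ?_ (contMDiffAt_symm (extChartAt_mem_tgt hx))
  rwa [symm_extChartAt hx]

lemma smoothAt_smul {f : M → ℝ} {V : VField n M} {x : M}
    (hf : ContMDiffAt (𝓡 n) 𝓘(ℝ, ℝ) ∞ f x) (hV : SmoothAt V x) :
    SmoothAt (fun z ↦ f z • V z) x := by
  have hx : x ∈ dom (n := n) x := mem_chart_source _ x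
  rw [smoothAt_iff hx] at *
  rw [hat_smul]
  exact (contDiffAt_comp_symm hx hf).smul hV

lemma divergence_add {V W : VField n M} {x : M} (hV : SmoothAt V x) (hW : SmoothAt W x) :
    divergence (V + W) x = divergence V x + divergence W x := by
  have hx : x ∈ dom (n := n) x := mem_chart_source _ x
  rw [divergence_chart hx (smoothAt_add hV hW), divergence_chart hx hV, divergence_chart hx hW,
    hat_add, ← map_add]
  congr 1
  ext v : 1
  change cov _ _ _ v = cov _ _ _ v + cov _ _ _ v
  rw [cov_apply, cov_apply, cov_apply, fderiv_add (differentiableAt_hat hx hV)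
    (differentiableAt_hat hx hW), _root_.add_apply, Pi.add_apply, map_add]
  abel

lemma divergence_sum {ι : Type*} (J : Finset ι) {V : ι → VField n M} {x : M}
    (hV : ∀ i, SmoothAt (V i) x) : divergence (∑ i ∈ J, V i) x = ∑ i ∈ J, divergence (V i) x := by
  classical
  induction J using Finset.induction_on with
  | empty => exact divergence_of_eventually_zero (.of_forall fun _ ↦ rfl)
  | insert i J hi ih =>
    rw [Finset.sum_insert hi, Finset.sum_insert hi, divergence_add (hV i) (smoothAt_sum J hV), ih]

/-- ∇(fV) = f∇V + df ⊗ V, and the rank-one term has trace df(V). -/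
lemma divergence_smul {f : M → ℝ} {V : VField n M} {x : M}
    (hf : ContMDiffAt (𝓡 n) 𝓘(ℝ, ℝ) ∞ f x) (hV : SmoothAt V x) :
    divergence (fun z ↦ f z • V z) x = f x * divergence V x + mvfderiv (𝓡 n) f x (V x) := by
  have hx : x ∈ dom (n := n) x := mem_chart_source _ x
  have hF := (contDiffAt_comp_symm hx hf).differentiableAt (by simp)
  have hVd := differentiableAt_hat hx hV
  rw [divergence_chart hx (smoothAt_smul hf hV), divergence_chart hx hV, hat_smul,
    mvfderiv_chart hx hF (fun _ _ ↦ rfl)]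
  set F := fun y ↦ f ((extChartAt (𝓡 n) x).symm y)
  set y := extChartAt (𝓡 n) x x
  have hFy : F y = f x := congrArg f (symm_extChartAt hx)
  have e : cov (ghat x) (fun y ↦ F y • hat x V y) y
      = F y • cov (ghat x) (hat x V) y + (fderiv ℝ F y).smulRight (hat x V y) := by
    ext v : 1
    change cov _ _ _ v = F y • cov _ _ _ v + fderiv ℝ F y v • hat x V y
    rw [cov_apply, cov_apply, fderiv_fun_smul hF hVd]
    change F y • fderiv ℝ (hat x V) y v + fderiv ℝ F y v • hat x V y + _ = _
    rw [map_smul, smul_add]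
    abel
  rw [e, ← hat_chart hx V, ← hFy]
  change LinearMap.trace ℝ _ (F y • (cov (ghat x) (hat x V) y : EuclideanSpace ℝ (Fin n) →ₗ[ℝ]
    EuclideanSpace ℝ (Fin n)) + (fderiv ℝ F y : EuclideanSpace ℝ (Fin n) →ₗ[ℝ] ℝ).smulRight
      (hat x V y)) = _
  rw [map_add, map_smul, LinearMap.trace_smulRight]
  rfl

end Algebra

/-! ### Integration by parts on the manifold. -/

section GlobalDivergence

variable {n : ℕ} {M : Type*} [MetricSpace M] [SecondCountableTopology M]
  [MeasurableSpace M] [BorelSpace M]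
  [ChartedSpace (EuclideanSpace ℝ (Fin n)) M] [IsManifold (𝓡 n) ∞ M]
  [RiemannianBundle (fun x : M ↦ TangentSpace (𝓡 n) x)]
  [IsContMDiffRiemannianBundle (𝓡 n) ∞ (EuclideanSpace ℝ (Fin n))
      (fun x : M ↦ TangentSpace (𝓡 n) x)]
  [IsRiemannianManifold (𝓡 n) M]

/-- Integration by parts against the square of a compactly supported Lipschitz function. -/
lemma abs_integral_sq_mul_divergence_le {V : VField n M} (hV : ∀ x, SmoothAt V x) {χ : M → ℝ}
    {L : ℝ} (hL0 : 0 ≤ L) (hχ0 : ∀ x, 0 ≤ χ x) (hL : ∀ x z, |χ x - χ z| ≤ L * dist x z)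
    (hχ : Continuous χ) (hχc : HasCompactSupport χ) :
    |∫ x, χ x ^ 2 * divergence V x ∂(vol n M)| ≤ 2 * L * ∫ x, χ x * ‖V x‖ ∂(vol n M) := by
  have hlc : LocallyCompactSpace M := Manifold.locallyCompact_of_finiteDimensional (𝓡 n)
  have hex : ∀ c : M, ∃ K : Set M, IsCompact K ∧ c ∈ interior K ∧ K ⊆ dom (n := n) c := fun c ↦
    exists_compact_subset (isOpen_dom c) (mem_chart_source _ c)
  choose C hC hcC hCd using hex
  -- Subordination to interiors of compact subsets of chart domains makes each ψᵢV vanish outside a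
  -- compact part of one chart.
  obtain ⟨ψ, hψ⟩ := SmoothPartitionOfUnity.exists_isSubordinate (𝓡 n) (isClosed_univ (X := M))
    (fun c ↦ interior (C c)) (fun c ↦ isOpen_interior) fun c _ ↦ mem_iUnion.2 ⟨c, hcC c⟩
  -- With a compact neighbourhood of the support, finitely many ψᵢ sum to 1 near each of its points
  -- and not just there, as differentiation requires.
  obtain ⟨K', hK', hKK'⟩ := exists_compact_superset hχc.isCompact
  set J := (ψ.locallyFinite.finite_nonempty_inter_compact hK').toFinset with hJ
  have hsum : ∀ x ∈ K', ∑ i ∈ J, ψ i x = 1 := fun x hx ↦ by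
    rw [← ψ.sum_eq_one (mem_univ x), finsum_eq_sum_of_support_subset]
    intro i hi
    rw [hJ, Finite.coe_toFinset]
    exact ⟨x, hi, hx⟩
  have hψs : ∀ i x, ContMDiffAt (𝓡 n) 𝓘(ℝ, ℝ) ∞ (ψ i) x := fun i x ↦ (ψ i).contMDiff.contMDiffAt
  let W : M → VField n M := fun i x ↦ ψ i x • V x
  have hW : ∀ i x, SmoothAt (W i) x := fun i x ↦ smoothAt_smul (hψs i x) (hV x)
  have hWn : ∀ i x, ‖W i x‖ = ψ i x * ‖V x‖ := fun i x ↦ by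
    rw [norm_smul, Real.norm_eq_abs, abs_of_nonneg (ψ.nonneg i x)]
  have hdiv : ∀ x, χ x ^ 2 * divergence V x = ∑ i ∈ J, χ x ^ 2 * divergence (W i) x := fun x ↦ by
    rw [← Finset.mul_sum]
    by_cases hx : x ∈ tsupport χ
    · rw [← divergence_sum J fun i ↦ hW i x]
      congr 1
      refine (divergence_congr (hV x) ?_).symm
      filter_upwards [isOpen_interior.mem_nhds (hKK' hx)] with z hz
      rw [Finset.sum_apply]
      simp only [W]
      rw [← Finset.sum_smul, hsum z (interior_subset hz), one_smul]
    · rw [image_eq_zero_of_notMem_tsupport hx]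
      simp
  have hint : ∀ i, Integrable (fun x ↦ χ x ^ 2 * divergence (W i) x) (vol n M) := fun i ↦ by
    refine ((hχ.pow 2).mul (continuous_divergence (hW i))).integrable_of_hasCompactSupport ?_
    exact HasCompactSupport.intro hχc.isCompact fun x hx ↦ by
      simp [image_eq_zero_of_notMem_tsupport hx]
  have hint' : ∀ i, Integrable (fun x ↦ 2 * L * χ x * ‖W i x‖) (vol n M) := fun i ↦ by
    refine ((continuous_const.mul hχ).mul (continuous_norm (hW i))).integrable_of_hasCompactSupport ?_
    exact HasCompactSupport.intro hχc.isCompact fun x hx ↦ by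
      simp [image_eq_zero_of_notMem_tsupport hx]
  simp only [hdiv]
  rw [integral_finsetSum _ fun i _ ↦ hint i]
  calc |∑ i ∈ J, ∫ x, χ x ^ 2 * divergence (W i) x ∂(vol n M)|
      ≤ ∑ i ∈ J, |∫ x, χ x ^ 2 * divergence (W i) x ∂(vol n M)| := Finset.abs_sum_le_sum_abs _ _
    _ ≤ ∑ i ∈ J, ∫ x, 2 * L * χ x * ‖W i x‖ ∂(vol n M) := by
        refine Finset.sum_le_sum fun i _ ↦ ?_
        refine abs_integral_sq_mul_divergence_le_of_subset_dom i (hC i) (hCd i) (hW i) ?_ hL0 hχ0 hL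
        intro x hx
        have : ψ i x = 0 := by
          by_contra h
          exact hx (interior_subset (hψ i (subset_tsupport _ h)))
        simp only [W, this, zero_smul]
    -- Since |ψᵢV| = ψᵢ|V|, the bounds add up without loss: the number of charts does not enter.
    _ = 2 * L * ∫ x, χ x * ‖V x‖ ∂(vol n M) := by
        rw [← integral_finsetSum _ fun i _ ↦ hint' i, ← integral_const_mul]
        refine integral_congr_ae (.of_forall fun x ↦ ?_)
        simp only [hWn]
        by_cases hx : x ∈ tsupport χ
        · rw [← Finset.mul_sum, ← Finset.sum_mul, hsum x (interior_subset (hKK' hx))]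
          ring
        · simp [image_eq_zero_of_notMem_tsupport hx]

end GlobalDivergence

/-! ### Joint regularity in time and space. -/

section TimeDependent

variable {n : ℕ} {M : Type*} [TopologicalSpace M]
  [ChartedSpace (EuclideanSpace ℝ (Fin n)) M] [IsManifold (𝓡 n) ∞ M]
  [RiemannianBundle (fun x : M ↦ TangentSpace (𝓡 n) x)]
  [IsContMDiffRiemannianBundle (𝓡 n) ∞ (EuclideanSpace ℝ (Fin n))
      (fun x : M ↦ TangentSpace (𝓡 n) x)]

/-- The squared Hilbert-Schmidt norm of `∇u`. -/
def gradSq (u : VField n M) (x : M) : ℝ := ∑ i, ‖nabla u x (frame x i)‖ ^ 2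

lemma gradSq_nonneg (u : VField n M) (x : M) : 0 ≤ gradSq u x :=
  Finset.sum_nonneg fun _ _ ↦ sq_nonneg _

/-- The frame need not vary continuously. As the trace of g⁻¹N*gN, with N* the transpose, the
quantity depends continuously on the metric and on `N`. -/
lemma gradSq_chart {c x : M} (hx : x ∈ dom (n := n) c) {u : VField n M} (hu : SmoothAt u x)
    {N : EuclideanSpace ℝ (Fin n) →L[ℝ] EuclideanSpace ℝ (Fin n)}
    (hN : N = cov (ghat c) (hat c u) (extChartAt (𝓡 n) c x)) :
    gradSq u x = LinearMap.trace ℝ (EuclideanSpace ℝ (Fin n))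
      (((ghat c (extChartAt (𝓡 n) c x)).inverse.comp
        (((compL ℝ (EuclideanSpace ℝ (Fin n)) (EuclideanSpace ℝ (Fin n)) ℝ).flip N).comp
          ((ghat c (extChartAt (𝓡 n) c x)).comp N)) :
        EuclideanSpace ℝ (Fin n) →L[ℝ] EuclideanSpace ℝ (Fin n)) :
        EuclideanSpace ℝ (Fin n) →ₗ[ℝ] EuclideanSpace ℝ (Fin n)) := by
  rw [← sum_frame hx, gradSq]
  refine Finset.sum_congr rfl fun i _ ↦ ?_
  have e := (isLocalMetric_ghat c).apply_inverse (extChartAt_mem_tgt hx)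
    ((ghat c (extChartAt (𝓡 n) c x) (N (toE c x (frame x i)))).comp N)
  refine Eq.trans ?_ (congrArg (fun l : EuclideanSpace ℝ (Fin n) →L[ℝ] ℝ ↦
    l (toE c x (frame x i))) e).symm
  change _ = ghat c (extChartAt (𝓡 n) c x) (N (toE c x (frame x i))) (N (toE c x (frame x i)))
  rw [hN, ← toE_nabla hx hu, ghat_chart hx, real_inner_self_eq_norm_sq]

/-- A time-dependent vector field which is smooth on `[0, T] × M`. -/
def SmoothPath (T : ℝ) (u : ℝ → VField n M) : Prop :=
  ContMDiffOn (𝓘(ℝ, ℝ).prod (𝓡 n)) (𝓡 n).tangent ∞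
    (fun q : ℝ × M ↦ (⟨q.2, u q.1 q.2⟩ : TangentBundle (𝓡 n) M)) (Icc 0 T ×ˢ univ)

/-- A time-dependent vector field in the chart centred at `c`, as a function of time and space. -/
def hatPath (u : ℝ → VField n M) (c : M) (q : ℝ × EuclideanSpace ℝ (Fin n)) :
    EuclideanSpace ℝ (Fin n) :=
  hat c (u q.1) q.2

/-- The total derivative of `hatPath`. -/
def hatPathDeriv (T : ℝ) (u : ℝ → VField n M) (c : M) (q : ℝ × EuclideanSpace ℝ (Fin n)) :
    ℝ × EuclideanSpace ℝ (Fin n) →L[ℝ] EuclideanSpace ℝ (Fin n) :=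
  fderivWithin ℝ (hatPath u c) (Icc 0 T ×ˢ tgt c) q

variable {T : ℝ} {u : ℝ → VField n M}

lemma contDiffOn_hatPath (hu : SmoothPath T u) (c : M) :
    ContDiffOn ℝ ∞ (hatPath u c) (Icc 0 T ×ˢ tgt c) := by
  have h1 : ContMDiffOn 𝓘(ℝ, ℝ × EuclideanSpace ℝ (Fin n)) (𝓘(ℝ, ℝ).prod (𝓡 n)) ∞
      (fun q : ℝ × EuclideanSpace ℝ (Fin n) ↦ (q.1, (extChartAt (𝓡 n) c).symm q.2))
      (Icc 0 T ×ˢ tgt c) :=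
    contDiff_fst.contMDiff.contMDiffOn.prodMk ((contMDiffOn_extChartAt_symm c).comp
      contDiff_snd.contMDiff.contMDiffOn fun q hq ↦ hq.2)
  have h2 := hu.comp h1 fun q hq ↦ ⟨hq.1, mem_univ _⟩
  have h3 := ((trivializationAt (EuclideanSpace ℝ (Fin n)) (TangentSpace (𝓡 n)) c).contMDiffOn_iff
    (fun q hq ↦ (Trivialization.mem_source _).2 (mem_baseSet (symm_mem_dom hq.2)))).1 h2
  rw [← contMDiffOn_iff_contDiffOn]
  exact h3.2.congr fun q hq ↦ toE_eq_snd (symm_mem_dom hq.2) _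

lemma smoothAt_of_contMDiffOn (hu : SmoothPath T u) {t : ℝ}
    (ht : t ∈ Icc 0 T) (x : M) : SmoothAt (u t) x := by
  have h1 : ContMDiff (𝓡 n) (𝓘(ℝ, ℝ).prod (𝓡 n)) ∞ (fun z : M ↦ (t, z)) :=
    contMDiff_const.prodMk contMDiff_id
  have := hu.comp (h1.contMDiffOn (s := univ)) fun z _ ↦ ⟨ht, mem_univ _⟩
  exact (contMDiffOn_univ.1 this).contMDiffAt

lemma continuousOn_of_chart {X : Type*} [TopologicalSpace X] {f : ℝ × M → X}
    (h : ∀ c : M, ∃ F : ℝ × EuclideanSpace ℝ (Fin n) → X, ContinuousOn F (Icc 0 T ×ˢ tgt c) ∧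
      ∀ s ∈ Icc 0 T, ∀ z ∈ dom (n := n) c, f (s, z) = F (s, extChartAt (𝓡 n) c z)) :
    ContinuousOn f (Icc 0 T ×ˢ univ) := by
  rintro ⟨s, x⟩ ⟨hs, -⟩
  have hx : x ∈ dom (n := n) x := mem_chart_source _ x
  obtain ⟨F, hF, hfF⟩ := h x
  have h1 : ContinuousOn (fun q : ℝ × M ↦ F (q.1, extChartAt (𝓡 n) x q.2))
      (Icc 0 T ×ˢ dom (n := n) x) := by
    refine hF.comp (continuousOn_fst.prodMk (ContinuousOn.comp (t := dom (n := n) x)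
      (fun z hz ↦ (contMDiffAt_chart hz).continuousAt.continuousWithinAt) continuousOn_snd
      fun q hq ↦ hq.2)) fun q hq ↦ ⟨hq.1, extChartAt_mem_tgt hq.2⟩
  have h2 : ContinuousOn f (Icc 0 T ×ˢ dom (n := n) x) :=
    h1.congr fun q hq ↦ hfF q.1 hq.1 q.2 hq.2
  refine (h2 (s, x) ⟨hs, hx⟩).mono_of_mem_nhdsWithin ?_
  rw [nhdsWithin_prod_eq, nhdsWithin_univ]
  exact Filter.prod_mem_prod self_mem_nhdsWithin ((isOpen_dom x).mem_nhds hx)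

/-- The positivity of `T` makes derivatives within the closed time interval unique, endpoints
included. -/
lemma uniqueDiffOn_Icc_prod_tgt (hT : 0 < T) (c : M) :
    UniqueDiffOn ℝ (Icc 0 T ×ˢ tgt (n := n) c) :=
  (uniqueDiffOn_Icc hT).prod (isOpen_tgt c).uniqueDiffOn

lemma continuousOn_hatPathDeriv (hT : 0 < T) (hu : SmoothPath T u) (c : M) :
    ContinuousOn (hatPathDeriv T u c) (Icc 0 T ×ˢ tgt c) :=
  (contDiffOn_hatPath hu c).continuousOn_fderivWithin (uniqueDiffOn_Icc_prod_tgt hT c) (by simp)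

lemma hasFDerivWithinAt_hatPath (hu : SmoothPath T u) {c : M} {t : ℝ} (ht : t ∈ Icc 0 T)
    {y : EuclideanSpace ℝ (Fin n)} (hy : y ∈ tgt c) :
    HasFDerivWithinAt (hatPath u c) (hatPathDeriv T u c (t, y)) (Icc 0 T ×ˢ tgt c) (t, y) :=
  ((contDiffOn_hatPath hu c).differentiableOn (by simp) (t, y) ⟨ht, hy⟩).hasFDerivWithinAt

/-- The spatial derivative. -/
lemma fderiv_hat_path (hu : SmoothPath T u) {c : M} {t : ℝ} (ht : t ∈ Icc 0 T)
    {y : EuclideanSpace ℝ (Fin n)} (hy : y ∈ tgt c) :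
    fderiv ℝ (hat c (u t)) y
      = (hatPathDeriv T u c (t, y)).comp (ContinuousLinearMap.inr ℝ ℝ _) := by
  have h1 : HasFDerivWithinAt (fun z : EuclideanSpace ℝ (Fin n) ↦ (t, z))
      (ContinuousLinearMap.inr ℝ ℝ _) (tgt c) y := (hasFDerivAt_prodMk_right t y).hasFDerivWithinAt
  have h2 := (hasFDerivWithinAt_hatPath hu ht hy).comp y h1 fun z hz ↦ ⟨ht, hz⟩
  exact (h2.hasFDerivAt ((isOpen_tgt c).mem_nhds hy)).fderiv

/-- The time derivative. -/
lemma hasDerivWithinAt_path (hu : SmoothPath T u) {c x : M} (hx : x ∈ dom (n := n) c) {t : ℝ}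
    (ht : t ∈ Icc 0 T) :
    HasDerivWithinAt (fun s ↦ u s x)
      (ofE c x (hatPathDeriv T u c (t, extChartAt (𝓡 n) c x) (1, 0))) (Icc 0 T) t := by
  have hy := extChartAt_mem_tgt hx
  have h1 : HasDerivWithinAt (fun s : ℝ ↦ (s, extChartAt (𝓡 n) c x)) ((1 : ℝ), 0) (Icc 0 T) t :=
    (hasDerivWithinAt_id t _).prodMk (hasDerivWithinAt_const _ _ _)
  have hm : MapsTo (fun s : ℝ ↦ (s, extChartAt (𝓡 n) c x)) (Icc 0 T) (Icc 0 T ×ˢ tgt c) :=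
    fun s hs ↦ ⟨hs, hy⟩
  have h2 := (hasFDerivWithinAt_hatPath hu ht hy).comp_hasDerivWithinAt t h1 hm
  have h3 := (ofE c x).hasFDerivAt.comp_hasDerivWithinAt t h2
  refine h3.congr_of_mem (fun s hs ↦ ?_) ht
  change u s x = ofE c x (hat c (u s) (extChartAt (𝓡 n) c x))
  rw [hat_chart hx, ofE_toE hx]

lemma derivWithin_path (hT : 0 < T) (hu : SmoothPath T u) {c x : M} (hx : x ∈ dom (n := n) c)
    {t : ℝ} (ht : t ∈ Icc 0 T) :
    derivWithin (fun s ↦ u s x) (Icc 0 T) t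
      = ofE c x (hatPathDeriv T u c (t, extChartAt (𝓡 n) c x) (1, 0)) :=
  (hasDerivWithinAt_path hu hx ht).derivWithin (uniqueDiffOn_Icc hT t ht)

lemma hasDerivWithinAt_normSq (hT : 0 < T) (hu : SmoothPath T u) (x : M) {t : ℝ}
    (ht : t ∈ Icc 0 T) :
    HasDerivWithinAt (fun s ↦ ‖u s x‖ ^ 2 / 2)
      (inner ℝ (derivWithin (fun s ↦ u s x) (Icc 0 T) t) (u t x)) (Icc 0 T) t := by
  have hx : x ∈ dom (n := n) x := mem_chart_source _ x
  have h := hasDerivWithinAt_path hu hx ht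
  rw [← derivWithin_path hT hu hx ht] at h
  refine (h.norm_sq.div_const 2).congr_deriv ?_
  rw [real_inner_comm]
  ring

lemma continuousOn_metric (c : M) :
    ContinuousOn (fun q : ℝ × EuclideanSpace ℝ (Fin n) ↦ ghat c q.2) (Icc 0 T ×ˢ tgt c) :=
  (isLocalMetric_ghat c).smooth.continuousOn.comp continuousOn_snd fun _ hq ↦ hq.2

lemma continuousOn_norm_sq_path (hu : SmoothPath T u) :
    ContinuousOn (fun q : ℝ × M ↦ ‖u q.1 q.2‖ ^ 2) (Icc 0 T ×ˢ univ) := by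
  refine continuousOn_of_chart fun c ↦ ⟨fun q ↦ ghat c q.2 (hatPath u c q) (hatPath u c q), ?_,
    fun s hs z hz ↦ ?_⟩
  · have h := (contDiffOn_hatPath hu c).continuousOn
    exact ((continuousOn_metric c).clm_apply h).clm_apply h
  · change _ = ghat c _ (hat c (u s) _) (hat c (u s) _)
    rw [hat_chart hz, ghat_chart hz, real_inner_self_eq_norm_sq]

lemma continuousOn_inner_derivWithin (hT : 0 < T) (hu : SmoothPath T u) :
    ContinuousOn (fun q : ℝ × M ↦
      (inner ℝ (derivWithin (fun s ↦ u s q.2) (Icc 0 T) q.1) (u q.1 q.2) : ℝ))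
      (Icc 0 T ×ˢ univ) := by
  refine continuousOn_of_chart fun c ↦
    ⟨fun q ↦ ghat c q.2 (hatPathDeriv T u c q (1, 0)) (hatPath u c q), ?_, fun s hs z hz ↦ ?_⟩
  · exact ((continuousOn_metric c).clm_apply ((continuousOn_hatPathDeriv hT hu c).clm_apply
      continuousOn_const)).clm_apply (contDiffOn_hatPath hu c).continuousOn
  · change _ = ghat c _ _ (hat c (u s) _)
    rw [hat_chart hz, derivWithin_path hT hu hz hs, inner_eq_ghat hz, toE_ofE hz]

lemma continuousOn_gradSq (hT : 0 < T) (hu : SmoothPath T u) :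
    ContinuousOn (fun q : ℝ × M ↦ gradSq (u q.1) q.2) (Icc 0 T ×ˢ univ) := by
  let tr : (EuclideanSpace ℝ (Fin n) →L[ℝ] EuclideanSpace ℝ (Fin n)) →ₗ[ℝ] ℝ :=
    (LinearMap.trace ℝ (EuclideanSpace ℝ (Fin n))) ∘ₗ ContinuousLinearMap.coeLM ℝ
  refine continuousOn_of_chart (n := n) fun c : M ↦ ?_
  let N : ℝ × EuclideanSpace ℝ (Fin n) → EuclideanSpace ℝ (Fin n) →L[ℝ] EuclideanSpace ℝ (Fin n) :=
    fun q ↦ (hatPathDeriv T u c q).comp (ContinuousLinearMap.inr ℝ ℝ _)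
      + (christoffel (ghat c) q.2).flip (hatPath u c q)
  have hN : ContinuousOn N (Icc 0 T ×ˢ tgt c) := by
    refine ((continuousOn_hatPathDeriv hT hu c).clm_comp continuousOn_const).add ?_
    refine ContinuousOn.clm_apply ?_ (contDiffOn_hatPath hu c).continuousOn
    refine (flipₗᵢ ℝ _ _ _).continuous.comp_continuousOn ?_
    refine ContinuousOn.comp (g := christoffel (ghat c)) (t := tgt c) (fun y hy ↦ ?_)
      continuousOn_snd fun _ hq ↦ hq.2
    exact ((isLocalMetric_ghat (n := n) c).contDiffAt_christoffel hy).continuousAt.continuousWithinAt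
  have hinv : ContinuousOn (fun q : ℝ × EuclideanSpace ℝ (Fin n) ↦ (ghat c q.2).inverse)
      (Icc 0 T ×ˢ tgt c) := by
    refine ContinuousOn.comp (g := fun y ↦ (ghat c y).inverse) (t := tgt c) (fun y hy ↦ ?_)
      continuousOn_snd fun _ hq ↦ hq.2
    exact ((isLocalMetric_ghat (n := n) c).contDiffAt_inverse hy).continuousAt.continuousWithinAt
  refine ⟨fun q ↦ tr ((ghat c q.2).inverse.comp
    (((compL ℝ (EuclideanSpace ℝ (Fin n)) (EuclideanSpace ℝ (Fin n)) ℝ).flip (N q)).comp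
          ((ghat c q.2).comp (N q)))), ?_, fun s hs z hz ↦ ?_⟩
  · refine tr.continuous_of_finiteDimensional.comp_continuousOn (hinv.clm_comp ?_)
    exact ((ContinuousLinearMap.continuous _).comp_continuousOn hN).clm_comp
      ((continuousOn_metric c).clm_comp hN)
  · refine gradSq_chart hz (smoothAt_of_contMDiffOn hu hs z) ?_
    rw [cov, fderiv_hat_path hu hs (extChartAt_mem_tgt hz)]
    rfl

end TimeDependent

/-! ### The local energy identity and the bound for the current. -/

section Pointwise

variable {n : ℕ} {M : Type*} [TopologicalSpace M]
  [ChartedSpace (EuclideanSpace ℝ (Fin n)) M] [IsManifold (𝓡 n) ∞ M]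
  [RiemannianBundle (fun x : M ↦ TangentSpace (𝓡 n) x)]
  [IsContMDiffRiemannianBundle (𝓡 n) ∞ (EuclideanSpace ℝ (Fin n))
      (fun x : M ↦ TangentSpace (𝓡 n) x)]

lemma inner_gradient (f : M → ℝ) (x : M) (a : TangentSpace (𝓡 n) x) :
    inner ℝ (gradient f x) a = mvfderiv (𝓡 n) f x a := by
  conv_rhs => rw [← (frame x).sum_repr' a]
  simp only [gradient, sum_inner, inner_smul_left, map_sum, map_smul, conj_trivial]
  exact Finset.sum_congr rfl fun i _ ↦ mul_comm _ _

/-- The components in an orthonormal frame are ⟨∇_{eᵢ}u, u⟩; Cauchy-Schwarz applies to each. -/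
lemma norm_gradEnergy_sq_le (u : VField n M) (x : M) :
    ‖gradEnergy u x‖ ^ 2 ≤ gradSq u x * ‖u x‖ ^ 2 := by
  rw [← (frame x).sum_sq_norm_inner_right, gradSq, Finset.sum_mul]
  refine Finset.sum_le_sum fun i _ ↦ ?_
  rw [real_inner_comm, inner_gradEnergy, ← mul_pow]
  exact pow_le_pow_left₀ (norm_nonneg _) (norm_inner_le_norm _ _) 2

lemma contMDiffAt_norm_sq {u : VField n M} {x : M} (hu : SmoothAt u x) :
    ContMDiffAt (𝓡 n) 𝓘(ℝ, ℝ) ∞ (fun z ↦ (inner ℝ (u z) (u z) : ℝ)) x :=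
  ContMDiffAt.inner_bundle hu hu

/-- The energy current `(|u|²/2 + q) u - ν ∇(|u|²/2)`. -/
def energyCurrent (ν : ℝ) (u : VField n M) (q : M → ℝ) : VField n M := fun x ↦
  (‖u x‖ ^ 2 / 2 + q x) • u x - ν • gradEnergy u x

lemma energyCurrent_eq (ν : ℝ) (u : VField n M) (q : M → ℝ) :
    energyCurrent ν u q = (fun x ↦ (1 / 2 : ℝ) • ((inner ℝ (u x) (u x) : ℝ) • u x))
      + ((fun x ↦ q x • u x) + fun x ↦ (-ν) • gradEnergy u x) := by
  ext x : 1
  rw [Pi.add_apply, Pi.add_apply, energyCurrent, real_inner_self_eq_norm_sq]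
  module

variable {ν : ℝ} {u : VField n M} {q : M → ℝ}

lemma smoothAt_energyCurrent (hu : ∀ z, SmoothAt u z)
    (hq : ∀ z, ContMDiffAt (𝓡 n) 𝓘(ℝ, ℝ) ∞ q z) (x : M) : SmoothAt (energyCurrent ν u q) x := by
  rw [energyCurrent_eq]
  exact smoothAt_add (smoothAt_smul contMDiffAt_const (smoothAt_smul (contMDiffAt_norm_sq (hu x))
    (hu x))) (smoothAt_add (smoothAt_smul (hq x) (hu x)) (smoothAt_smul contMDiffAt_const
      (smoothAt_gradEnergy hu x)))

/-- The local energy identity. -/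
lemma inner_eq_of_momentum (hu : ∀ z, SmoothAt u z) (hq : ∀ z, ContMDiffAt (𝓡 n) 𝓘(ℝ, ℝ) ∞ q z)
    (hdiv : ∀ z, divergence u z = 0) {x : M} {a : TangentSpace (𝓡 n) x}
    (ha : a + nabla u x (u x) + ν • hodgeLaplacian u x = -gradient q x) :
    inner ℝ a (u x) = -divergence (energyCurrent ν u q) x - ν * gradSq u x
      - ν * ricci x (u x) (u x) := by
  have h1 := mvfderiv_inner (hu x) (hu x) (u x)
  rw [real_inner_comm (nabla u x (u x)) (u x)] at h1
  have hn := contMDiffAt_norm_sq (hu x)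
  -- Because div u = 0, the transport part of the current contributes ⟨∇_u u, u⟩ + dq(u), which are
  -- the convection and pressure terms of the equation.
  have hd : divergence (energyCurrent ν u q) x = inner ℝ (nabla u x (u x)) (u x)
      + mvfderiv (𝓡 n) q x (u x) - ν * divergence (gradEnergy u) x := by
    rw [energyCurrent_eq, divergence_add (smoothAt_smul contMDiffAt_const (smoothAt_smul hn (hu x)))
      (smoothAt_add (smoothAt_smul (hq x) (hu x)) (smoothAt_smul contMDiffAt_const
      (smoothAt_gradEnergy hu x))), divergence_add (smoothAt_smul (hq x) (hu x))
      (smoothAt_smul contMDiffAt_const (smoothAt_gradEnergy hu x)),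
      divergence_smul contMDiffAt_const (smoothAt_smul hn (hu x)),
      divergence_smul contMDiffAt_const (smoothAt_gradEnergy hu x), divergence_smul hn (hu x),
      divergence_smul (hq x) (hu x), hdiv, h1]
    simp only [mvfderiv_const, zero_apply]
    ring
  have h2 := congrArg (fun v ↦ (inner ℝ v (u x) : ℝ)) ha
  simp only [inner_add_left, inner_smul_left, inner_neg_left, conj_trivial, inner_gradient,
    inner_hodgeLaplacian hu hdiv] at h2
  rw [hd]
  change _ = _ - ν * (∑ i, ‖nabla u x (frame x i)‖ ^ 2) - _
  linarith

/-- Meant for s = χ(x). Young's inequality puts the weight s² on |∇u|², so that this term matches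
the localized dissipation; the flux only needs s ≤ 1. -/
lemma two_mul_norm_energyCurrent_le {ν : ℝ} (hν : 0 ≤ ν) {s : ℝ} (hs : 0 ≤ s) (hs1 : s ≤ 1) (x : M) :
    2 * (s * ‖energyCurrent ν u q x‖) ≤ 2 * ‖(‖u x‖ ^ 2 / 2 + q x) • u x‖
      + ν * (s ^ 2 * gradSq u x + ‖u x‖ ^ 2) := by
  have h1 : ‖energyCurrent ν u q x‖ ≤ ‖(‖u x‖ ^ 2 / 2 + q x) • u x‖ + ν * ‖gradEnergy u x‖ := by
    refine (norm_sub_le _ _).trans_eq ?_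
    rw [norm_smul ν, Real.norm_eq_abs ν, abs_of_nonneg hν]
  have h2 := norm_gradEnergy_sq_le u x
  have h3 : 2 * (s * ‖gradEnergy u x‖) ≤ s ^ 2 * gradSq u x + ‖u x‖ ^ 2 := by
    refine abs_le_of_sq_le_sq' ?_ (add_nonneg (mul_nonneg (sq_nonneg _) (gradSq_nonneg u x))
      (sq_nonneg _)) |>.2
    nlinarith [sq_nonneg (s ^ 2 * gradSq u x - ‖u x‖ ^ 2), mul_le_mul_of_nonneg_left h2 (sq_nonneg s)]
  set F := ‖(‖u x‖ ^ 2 / 2 + q x) • u x‖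
  have hF : 0 ≤ F := norm_nonneg _
  have h4 := mul_le_mul_of_nonneg_left h1 hs
  have h5 := mul_le_mul_of_nonneg_left h3 hν
  have h6 : s * F ≤ F := mul_le_of_le_one_left hF hs1
  nlinarith

end Pointwise

/-! ### The rate of change of the localized energy. -/

section SpatialEstimate

variable {n : ℕ} {M : Type*} [MetricSpace M] [SecondCountableTopology M]
  [MeasurableSpace M] [BorelSpace M]
  [ChartedSpace (EuclideanSpace ℝ (Fin n)) M] [IsManifold (𝓡 n) ∞ M]
  [RiemannianBundle (fun x : M ↦ TangentSpace (𝓡 n) x)]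
  [IsContMDiffRiemannianBundle (𝓡 n) ∞ (EuclideanSpace ℝ (Fin n))
      (fun x : M ↦ TangentSpace (𝓡 n) x)]
  [IsRiemannianManifold (𝓡 n) M]

/-- The rate of change of the localized energy. -/
lemma setIntegral_sq_mul_inner_le {ν κ : ℝ} (hν : 0 ≤ ν) (hRic : RicciBoundedBelow n M κ)
    {u : VField n M} {q : M → ℝ} {a : VField n M}
    (hu : ∀ z, SmoothAt u z) (hq : ∀ z, ContMDiffAt (𝓡 n) 𝓘(ℝ, ℝ) ∞ q z)
    (hdiv : ∀ z, divergence u z = 0)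
    (ha : ∀ x, a x + nabla u x (u x) + ν • hodgeLaplacian u x = -gradient q x)
    (hac : Continuous fun x ↦ (inner ℝ (a x) (u x) : ℝ)) (hgc : Continuous (gradSq u))
    {χ : M → ℝ} {L : ℝ} (hL0 : 0 ≤ L) (hχ0 : ∀ x, 0 ≤ χ x) (hχ1 : ∀ x, χ x ≤ 1)
    (hL : ∀ x z, |χ x - χ z| ≤ L * dist x z) (hχ : Continuous χ) {K : Set M} (hK : IsCompact K)
    (hχK : ∀ x ∉ K, χ x = 0) :
    ∫ x in K, χ x ^ 2 * inner ℝ (a x) (u x) ∂(vol n M)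
      ≤ -(ν * (1 - L)) * ∫ x in K, χ x ^ 2 * gradSq u x ∂(vol n M)
        + 2 * L * ∫ x in K, ‖(‖u x‖ ^ 2 / 2 + q x) • u x‖ ∂(vol n M)
        + ν * L * ∫ x in K, ‖u x‖ ^ 2 ∂(vol n M)
        + 2 * ν * max κ 0 * ∫ x in K, χ x ^ 2 * (‖u x‖ ^ 2 / 2) ∂(vol n M) := by
  have hW : ∀ x, SmoothAt (energyCurrent ν u q) x := smoothAt_energyCurrent hu hq
  have hdW := continuous_divergence hW
  have hnW := continuous_norm hW
  have hnu := continuous_norm hu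
  have hqc : Continuous q := continuous_iff_continuousAt.2 fun z ↦ (hq z).continuousAt
  have hint : ∀ f : M → ℝ, Continuous f → IntegrableOn f K (vol n M) := fun f hf ↦
    hf.continuousOn.integrableOn_compact hK
  have hflux : Continuous fun x ↦ ‖(‖u x‖ ^ 2 / 2 + q x) • u x‖ := by
    simp only [norm_smul]
    fun_prop
  have hset : ∀ f : M → ℝ, (∀ x ∉ K, f x = 0) → ∫ x in K, f x ∂(vol n M) = ∫ x, f x ∂(vol n M) :=
    fun f hf ↦ setIntegral_eq_integral_of_forall_compl_eq_zero hf
  have hχc : HasCompactSupport χ := HasCompactSupport.intro hK hχK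
  have hmain := abs_integral_sq_mul_divergence_le hW hL0 hχ0 hL hχ hχc
  rw [← hset _ fun x hx ↦ by simp [hχK x hx], ← hset _ fun x hx ↦ by simp [hχK x hx]] at hmain
  have h1 : ∫ x in K, χ x ^ 2 * inner ℝ (a x) (u x) ∂(vol n M)
      ≤ ∫ x in K, (-(χ x ^ 2 * divergence (energyCurrent ν u q) x) - ν * (χ x ^ 2 * gradSq u x)
        + 2 * ν * max κ 0 * (χ x ^ 2 * (‖u x‖ ^ 2 / 2))) ∂(vol n M) := by
    refine setIntegral_mono_on (hint _ (by fun_prop)) (hint _ (by fun_prop)) hK.measurableSet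
      fun x _ ↦ ?_
    rw [inner_eq_of_momentum hu hq hdiv (ha x)]
    have h2 := hRic x (u x)
    -- The positive part of κ keeps the Gronwall rate nonnegative.
    have h3 : -(max κ 0) * ‖u x‖ ^ 2 ≤ ricci x (u x) (u x) :=
      (mul_le_mul_of_nonneg_right (neg_le_neg (le_max_left κ 0)) (sq_nonneg _)).trans h2
    have h4 := mul_le_mul_of_nonneg_left h3 (mul_nonneg hν (sq_nonneg (χ x)))
    linarith
  rw [integral_add (hint _ (by fun_prop)) (hint _ (by fun_prop)), integral_sub (hint _ (by fun_prop))
    (hint _ (by fun_prop)), integral_neg, integral_const_mul, integral_const_mul] at h1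
  have h2 : 2 * ∫ x in K, χ x * ‖energyCurrent ν u q x‖ ∂(vol n M)
      ≤ ∫ x in K, (2 * ‖(‖u x‖ ^ 2 / 2 + q x) • u x‖
        + ν * (χ x ^ 2 * gradSq u x + ‖u x‖ ^ 2)) ∂(vol n M) := by
    rw [← integral_const_mul]
    exact setIntegral_mono_on (hint _ (by fun_prop)) (hint _ (by fun_prop)) hK.measurableSet
      fun x _ ↦ two_mul_norm_energyCurrent_le hν (hχ0 x) (hχ1 x) x
  rw [integral_add (hint _ (by fun_prop)) (hint _ (by fun_prop)), integral_const_mul,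
    integral_const_mul, integral_add (hint _ (by fun_prop)) (hint _ (by fun_prop))] at h2
  -- The current costs `L` times the bound `h2`; its term νL∫χ²|∇u|² lowers the dissipation
  -- coefficient from ν to ν(1 - L).
  have h3 := neg_le_of_abs_le hmain
  have h4 := mul_le_mul_of_nonneg_left h2 hL0
  linarith

end SpatialEstimate

/-! ### Gronwall's inequality with dissipation. -/

section Gronwall

/-- The integral form of Gronwall's inequality, with a dissipation term `g`. -/
lemma add_integral_le_mul_exp {T c k : ℝ} {y a g b : ℝ → ℝ} (hc : 0 ≤ c) (hk : 0 ≤ k)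
    (ha : IntervalIntegrable a volume 0 T) (hg : IntervalIntegrable g volume 0 T)
    (hb : IntervalIntegrable b volume 0 T) (hg0 : ∀ s ∈ Icc 0 T, 0 ≤ g s)
    (hb0 : ∀ s ∈ Icc 0 T, 0 ≤ b s) (hy : ∀ t ∈ Icc 0 T, y t = y 0 + ∫ s in 0..t, a s)
    (hle : ∀ s ∈ Icc 0 T, a s ≤ -c * g s + b s + k * y s) {t : ℝ} (ht : t ∈ Icc 0 T) :
    y t + c * ∫ s in 0..t, g s ≤ (y 0 + ∫ s in 0..T, b s) * Real.exp (k * t) := by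
  have hT : 0 ≤ T := ht.1.trans ht.2
  have hsub : ∀ {t}, t ∈ Icc 0 T → uIcc 0 t ⊆ uIcc 0 T := fun ht ↦ by
    rw [uIcc_of_le ht.1, uIcc_of_le hT]; exact Icc_subset_Icc_right ht.2
  have hyc : ContinuousOn y (Icc 0 T) := by
    have := intervalIntegral.continuousOn_primitive_interval' ha left_mem_uIcc
    rw [uIcc_of_le hT] at this
    exact (continuousOn_const.add this).congr hy
  -- `y` is continuous only on [0, T]; extending it by its endpoint values makes the primitive
  -- differentiable everywhere.
  set z : ℝ → ℝ := IccExtend hT ((Icc 0 T).domRestrict y)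
  have hz : Continuous z := (continuousOn_iff_continuous_domRestrict.1 hyc).Icc_extend'
  have hzy : ∀ s ∈ Icc 0 T, z s = y s := fun s hs ↦ IccExtend_of_mem hT _ hs
  set A := y 0 + ∫ s in 0..T, b s
  -- `h` dominates y + c∫g, and h' = ky ≤ kh on [0, T], so h(t)exp(-kt) decreases. The dissipation
  -- thus stays on the left-hand side.
  set h : ℝ → ℝ := fun t ↦ A + k * ∫ s in 0..t, z s
  have hder : ∀ t, HasDerivAt h (k * z t) t := fun t ↦
    ((hz.integral_hasStrictDerivAt 0 t).hasDerivAt.const_mul k).const_add A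
  have hYh : ∀ t ∈ Icc 0 T, y t + c * ∫ s in 0..t, g s ≤ h t := by
    intro t ht
    have ia := ha.mono_set (hsub ht)
    have ig := hg.mono_set (hsub ht)
    have ib := hb.mono_set (hsub ht)
    have iz : IntervalIntegrable z volume 0 t := hz.intervalIntegrable _ _
    have h1 : ∫ s in 0..t, a s ≤ ∫ s in 0..t, (-c * g s + b s + k * z s) :=
      intervalIntegral.integral_mono_on ht.1 ia (((ig.const_mul _).add ib).add (iz.const_mul _))
        fun s hs ↦ by
          have hs' : s ∈ Icc 0 T := ⟨hs.1, hs.2.trans ht.2⟩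
          rw [hzy s hs']
          exact hle s hs'
    rw [intervalIntegral.integral_add ((ig.const_mul _).add ib) (iz.const_mul _),
      intervalIntegral.integral_add (ig.const_mul _) ib, intervalIntegral.integral_const_mul,
      intervalIntegral.integral_const_mul] at h1
    have h2 : ∫ s in 0..t, b s ≤ ∫ s in 0..T, b s := by
      rw [← intervalIntegral.integral_add_adjacent_intervals ib
        (hb.mono_set (by rw [uIcc_of_le ht.2, uIcc_of_le hT]; exact Icc_subset_Icc_left ht.1) :
          IntervalIntegrable b volume t T)]
      exact le_add_of_nonneg_right (intervalIntegral.integral_nonneg ht.2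
        fun s hs ↦ hb0 s ⟨ht.1.trans hs.1, hs.2⟩)
    have h3 := hy t ht
    simp only [h, A]
    linarith
  have hyh : ∀ t ∈ Icc 0 T, z t ≤ h t := fun t ht ↦ by
    refine le_trans ?_ (hYh t ht)
    rw [hzy t ht]
    exact le_add_of_nonneg_right (mul_nonneg hc (intervalIntegral.integral_nonneg ht.1
      fun s hs ↦ hg0 s ⟨hs.1, hs.2.trans ht.2⟩))
  have hder2 : ∀ t, HasDerivAt (fun t ↦ h t * Real.exp (-(k * t)))
      (k * z t * Real.exp (-(k * t)) + h t * (Real.exp (-(k * t)) * -(k * 1))) t := fun t ↦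
    (hder t).mul (((hasDerivAt_id t).const_mul k).neg.exp)
  have hanti : AntitoneOn (fun t ↦ h t * Real.exp (-(k * t))) (Icc 0 T) := by
    refine antitoneOn_of_deriv_nonpos (convex_Icc 0 T)
      (fun s _ ↦ (hder2 s).continuousAt.continuousWithinAt)
      (fun s _ ↦ (hder2 s).differentiableAt.differentiableWithinAt) fun s hs ↦ ?_
    rw [(hder2 s).deriv]
    have h1 := mul_le_mul_of_nonneg_left (hyh s (interior_subset hs))
      (mul_nonneg hk (Real.exp_pos (-(k * s))).le)
    linarith
  have hfin := hanti (left_mem_Icc.2 hT) ht ht.1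
  have h0 : h 0 = A := by simp [h]
  simp only [mul_zero, neg_zero, Real.exp_zero, mul_one, h0] at hfin
  refine (hYh t ht).trans ?_
  have := mul_le_mul_of_nonneg_right hfin (Real.exp_pos (k * t)).le
  rwa [mul_assoc, ← Real.exp_add, neg_add_cancel, Real.exp_zero, mul_one] at this

end Gronwall

/-! ### Exchange of time and space integrals over a compact set. -/

section Fubini

variable {X : Type*} [TopologicalSpace X] [T2Space X] [SecondCountableTopology X]
  [MeasurableSpace X] [BorelSpace X] {μ : Measure X} [IsFiniteMeasureOnCompacts μ] [SFinite μ]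
  {T : ℝ} {K : Set X} {f : ℝ → X → ℝ}

lemma continuous_slice (hf : ContinuousOn (fun q : ℝ × X ↦ f q.1 q.2) (Icc 0 T ×ˢ univ)) {s : ℝ}
    (hs : s ∈ Icc 0 T) : Continuous (f s) := by
  rw [← continuousOn_univ]
  exact hf.comp (by fun_prop : Continuous fun x : X ↦ (s, x)).continuousOn
    fun x _ ↦ ⟨hs, mem_univ _⟩

lemma integrable_prod_restrict (hK : IsCompact K)
    (hf : ContinuousOn (fun q : ℝ × X ↦ f q.1 q.2) (Icc 0 T ×ˢ univ)) {t : ℝ} (ht : t ≤ T) :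
    Integrable (fun q : ℝ × X ↦ f q.1 q.2) ((volume.restrict (Icc 0 t)).prod (μ.restrict K)) := by
  rw [Measure.prod_restrict]
  exact (hf.mono (prod_mono (Icc_subset_Icc_right ht) (subset_univ _))).integrableOn_compact
    (isCompact_Icc.prod hK)

lemma intervalIntegrable_setIntegral (hK : IsCompact K) (hT : 0 ≤ T)
    (hf : ContinuousOn (fun q : ℝ × X ↦ f q.1 q.2) (Icc 0 T ×ˢ univ)) :
    IntervalIntegrable (fun s ↦ ∫ x in K, f s x ∂μ) volume 0 T := by
  rw [intervalIntegrable_iff_integrableOn_Icc_of_le hT]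
  exact (integrable_prod_restrict hK hf le_rfl).integral_prod_left

lemma integral_setIntegral_eq (hK : IsCompact K)
    (hf : ContinuousOn (fun q : ℝ × X ↦ f q.1 q.2) (Icc 0 T ×ˢ univ)) {t : ℝ} (ht : t ∈ Icc 0 T) :
    ∫ s in 0..t, ∫ x in K, f s x ∂μ
      = ∫ q, f q.1 q.2 ∂((volume.restrict (Icc 0 t)).prod (μ.restrict K)) := by
  rw [intervalIntegral.integral_of_le ht.1, ← integral_Icc_eq_integral_Ioc,
    integral_prod _ (integrable_prod_restrict hK hf ht.2)]

lemma ofReal_integral_setIntegral (hK : IsCompact K)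
    (hf : ContinuousOn (fun q : ℝ × X ↦ f q.1 q.2) (Icc 0 T ×ˢ univ)) (hf0 : ∀ s x, 0 ≤ f s x)
    {t : ℝ} (ht : t ∈ Icc 0 T) :
    ENNReal.ofReal (∫ s in 0..t, ∫ x in K, f s x ∂μ)
      = ∫⁻ s in Icc 0 t, ∫⁻ x in K, ENNReal.ofReal (f s x) ∂μ := by
  have hi := integrable_prod_restrict (μ := μ) hK hf ht.2
  rw [integral_setIntegral_eq hK hf ht, ofReal_integral_eq_lintegral_ofReal hi
    (.of_forall fun q ↦ hf0 q.1 q.2), lintegral_prod _ hi.aemeasurable.ennreal_ofReal]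

lemma aemeasurable_setLIntegral (hK : IsCompact K)
    (hf : ContinuousOn (fun q : ℝ × X ↦ f q.1 q.2) (Icc 0 T ×ˢ univ)) {t : ℝ} (ht : t ≤ T) :
    AEMeasurable (fun s ↦ ∫⁻ x in K, ENNReal.ofReal (f s x) ∂μ) (volume.restrict (Icc 0 t)) :=
  (integrable_prod_restrict (μ := μ) hK hf ht).aemeasurable.ennreal_ofReal.lintegral_prod_right'

/-- The fundamental theorem of calculus under the integral sign. -/
lemma setIntegral_eq_add_integral (hK : IsCompact K) {e d : ℝ → X → ℝ}
    (he : ∀ t ∈ Icc 0 T, ∀ x, HasDerivWithinAt (fun s ↦ e s x) (d t x) (Icc 0 T) t)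
    (hec : ContinuousOn (fun q : ℝ × X ↦ e q.1 q.2) (Icc 0 T ×ˢ univ))
    (hdc : ContinuousOn (fun q : ℝ × X ↦ d q.1 q.2) (Icc 0 T ×ˢ univ)) {t : ℝ} (ht : t ∈ Icc 0 T) :
    ∫ x in K, e t x ∂μ = ∫ x in K, e 0 x ∂μ + ∫ s in 0..t, ∫ x in K, d s x ∂μ := by
  have hT : 0 ≤ T := ht.1.trans ht.2
  have hslice : ∀ s ∈ Icc 0 T, IntegrableOn (e s) K μ := fun s hs ↦
    (continuous_slice hec hs).continuousOn.integrableOn_compact hK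
  have hftc : ∀ x, e t x - e 0 x = ∫ s in 0..t, d s x := fun x ↦ by
    have hcd : ContinuousOn (fun s ↦ d s x) (Icc 0 t) :=
      hdc.comp (by fun_prop : Continuous fun s : ℝ ↦ (s, x)).continuousOn
        fun s hs ↦ ⟨⟨hs.1, hs.2.trans ht.2⟩, mem_univ _⟩
    refine (intervalIntegral.integral_eq_sub_of_hasDerivAt_of_le ht.1
      (fun s hs ↦ ((he s ⟨hs.1, hs.2.trans ht.2⟩ x).continuousWithinAt.mono
        (Icc_subset_Icc_right ht.2))) (fun s hs ↦ ?_) ?_).symm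
    · exact (he s ⟨hs.1.le, hs.2.le.trans ht.2⟩ x).hasDerivAt
        (Icc_mem_nhds hs.1 (hs.2.trans_le ht.2))
    · rw [intervalIntegrable_iff_integrableOn_Icc_of_le ht.1]
      exact hcd.integrableOn_Icc
  rw [integral_setIntegral_eq hK hdc ht, ← sub_eq_iff_eq_add',
    ← integral_sub (hslice t ht) (hslice 0 (left_mem_Icc.2 hT)),
    integral_prod_symm _ (integrable_prod_restrict hK hdc ht.2)]
  refine integral_congr_ae (.of_forall fun x ↦ ?_)
  simp only [hftc x]
  rw [intervalIntegral.integral_of_le ht.1, integral_Icc_eq_integral_Ioc]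

end Fubini

/-! ### Lipschitz cutoffs of the distance. -/

section Cutoff

/-- A cutoff function equal to `1` on the ball of radius `R` and supported in the ball of radius
`2 R`. -/
def cutoff {X : Type*} [MetricSpace X] (o : X) (R : ℝ) (x : X) : ℝ := max 0 (min 1 (2 - dist x o / R))

variable {X : Type*} [MetricSpace X] (o : X) {R : ℝ}

lemma cutoff_nonneg (x : X) : 0 ≤ cutoff o R x := le_max_left _ _

lemma cutoff_le_one (x : X) : cutoff o R x ≤ 1 := max_le zero_le_one (min_le_left _ _)

lemma continuous_cutoff : Continuous (cutoff o R) := by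
  unfold cutoff
  fun_prop

lemma abs_cutoff_sub_le (hR : 0 < R) (x z : X) :
    |cutoff o R x - cutoff o R z| ≤ 1 / R * dist x z := by
  have h1 : |cutoff o R x - cutoff o R z| ≤ |min 1 (2 - dist x o / R) - min 1 (2 - dist z o / R)| := by
    refine (abs_max_sub_max_le_max _ _ _ _).trans ?_
    rw [sub_self, abs_zero, max_eq_right (abs_nonneg _)]
  refine h1.trans ((abs_min_sub_min_le_max _ _ _ _).trans ?_)
  rw [sub_self, abs_zero, max_eq_right (abs_nonneg _), sub_sub_sub_cancel_left, ← sub_div, abs_div,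
    abs_of_pos hR, one_div_mul_eq_div]
  refine div_le_div_of_nonneg_right ?_ hR.le
  rw [dist_comm x z]
  exact abs_dist_sub_le _ _ _

lemma cutoff_eq_one (hR : 0 < R) {x : X} (hx : x ∈ Metric.closedBall o R) : cutoff o R x = 1 := by
  have : dist x o / R ≤ 1 := (div_le_one hR).2 hx
  rw [cutoff, min_eq_left (by linarith), max_eq_right zero_le_one]

lemma cutoff_eq_zero (hR : 0 < R) {x : X} (hx : x ∉ Metric.closedBall o (2 * R)) :
    cutoff o R x = 0 := by
  have : 2 ≤ dist x o / R := by
    rw [le_div_iff₀ hR]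
    exact (not_le.1 hx).le
  exact max_eq_left ((min_le_right _ _).trans (by linarith))

end Cutoff

/-! ### Energy inequalities on balls. -/

section Energy

variable {n : ℕ} {M : Type*} [MetricSpace M] [SecondCountableTopology M]
  [MeasurableSpace M] [BorelSpace M]
  [ChartedSpace (EuclideanSpace ℝ (Fin n)) M] [IsManifold (𝓡 n) ∞ M]
  [RiemannianBundle (fun x : M ↦ TangentSpace (𝓡 n) x)]
  [IsContMDiffRiemannianBundle (𝓡 n) ∞ (EuclideanSpace ℝ (Fin n))
      (fun x : M ↦ TangentSpace (𝓡 n) x)]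
  [IsRiemannianManifold (𝓡 n) M]
  {κ ν T : ℝ} {u₀ : VField n M} {u : ℝ → VField n M} {p : ℝ → M → ℝ}

lemma IsSmoothSolution.contMDiffAt_pressure (hsol : IsSmoothSolution ν T u₀ u p) {t : ℝ}
    (ht : t ∈ Icc 0 T) (x : M) : ContMDiffAt (𝓡 n) 𝓘(ℝ, ℝ) ∞ (p t) x := by
  have h1 : ContMDiff (𝓡 n) (𝓘(ℝ, ℝ).prod (𝓡 n)) ∞ (fun z : M ↦ (t, z)) :=
    contMDiff_const.prodMk contMDiff_id
  have := hsol.smooth_pressure.comp (h1.contMDiffOn (s := univ)) fun z _ ↦ ⟨ht, mem_univ _⟩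
  exact (contMDiffOn_univ.1 this).contMDiffAt

lemma IsSmoothSolution.continuousOn_flux (hsol : IsSmoothSolution ν T u₀ u p) :
    ContinuousOn (fun q : ℝ × M ↦ ‖(‖u q.1 q.2‖ ^ 2 / 2 + p q.1 q.2) • u q.1 q.2‖)
      (Icc 0 T ×ˢ univ) := by
  have h1 := continuousOn_norm_sq_path hsol.smooth_velocity
  have h2 : ContinuousOn (fun q : ℝ × M ↦ ‖u q.1 q.2‖) (Icc 0 T ×ˢ univ) :=
    h1.sqrt.congr fun q _ ↦ (Real.sqrt_sq (norm_nonneg _)).symm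
  have h3 := hsol.smooth_pressure.continuousOn
  simp only [norm_smul]
  exact (((h1.div_const 2).add h3).norm).mul h2

/-- The localized energy inequality. -/
lemma IsSmoothSolution.localized_energy_le (hsol : IsSmoothSolution ν T u₀ u p) (hν : 0 ≤ ν)
    (hT : 0 < T) (hRic : RicciBoundedBelow n M κ) {χ : M → ℝ} {L : ℝ} (hL0 : 0 ≤ L) (hL1 : L ≤ 1)
    (hχ0 : ∀ x, 0 ≤ χ x) (hχ1 : ∀ x, χ x ≤ 1) (hL : ∀ x z, |χ x - χ z| ≤ L * dist x z)
    (hχ : Continuous χ) {K : Set M} (hK : IsCompact K) (hχK : ∀ x ∉ K, χ x = 0) {t : ℝ}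
    (ht : t ∈ Icc 0 T) :
    ∫ x in K, χ x ^ 2 * (‖u t x‖ ^ 2 / 2) ∂(vol n M)
        + ν * (1 - L) * ∫ s in 0..t, ∫ x in K, χ x ^ 2 * gradSq (u s) x ∂(vol n M)
      ≤ (∫ x in K, χ x ^ 2 * (‖u₀ x‖ ^ 2 / 2) ∂(vol n M)
        + (2 * L * (∫ s in 0..T, ∫ x in K, ‖(‖u s x‖ ^ 2 / 2 + p s x) • u s x‖ ∂(vol n M))
          + ν * L * ∫ s in 0..T, ∫ x in K, ‖u s x‖ ^ 2 ∂(vol n M)))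
        * Real.exp (2 * ν * max κ 0 * t) := by
  have hu : SmoothPath T u := hsol.smooth_velocity
  have hχ2 : ContinuousOn (fun q : ℝ × M ↦ χ q.2 ^ 2) (Icc 0 T ×ˢ univ) :=
    (by fun_prop : Continuous fun q : ℝ × M ↦ χ q.2 ^ 2).continuousOn
  have hE := continuousOn_norm_sq_path hu
  have hG := continuousOn_gradSq hT hu
  have hD := continuousOn_inner_derivWithin hT hu
  have hF := hsol.continuousOn_flux
  have iD := intervalIntegrable_setIntegral (μ := vol n M)
    (f := fun s x ↦ χ x ^ 2 * (inner ℝ (derivWithin (fun s ↦ u s x) (Icc 0 T) s) (u s x) : ℝ))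
    hK hT.le (hχ2.mul hD)
  have iG := intervalIntegrable_setIntegral (μ := vol n M)
    (f := fun s x ↦ χ x ^ 2 * gradSq (u s) x) hK hT.le (hχ2.mul hG)
  have iF := intervalIntegrable_setIntegral (μ := vol n M)
    (f := fun s x ↦ ‖(‖u s x‖ ^ 2 / 2 + p s x) • u s x‖) hK hT.le hF
  have iE := intervalIntegrable_setIntegral (μ := vol n M)
    (f := fun s x ↦ ‖u s x‖ ^ 2) hK hT.le hE
  -- Here `y` is the localized kinetic energy, `c` times the localized `g` is the surviving
  -- dissipation, and `b` is the cutoff error, proportional to `L`.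
  have key := add_integral_le_mul_exp (T := T) (c := ν * (1 - L)) (k := 2 * ν * max κ 0)
    (y := fun t ↦ ∫ x in K, χ x ^ 2 * (‖u t x‖ ^ 2 / 2) ∂(vol n M))
    (b := fun s ↦ 2 * L * ∫ x in K, ‖(‖u s x‖ ^ 2 / 2 + p s x) • u s x‖ ∂(vol n M)
      + ν * L * ∫ x in K, ‖u s x‖ ^ 2 ∂(vol n M))
    (mul_nonneg hν (sub_nonneg.2 hL1)) (by positivity) iD iG
    ((iF.const_mul _).add (iE.const_mul _))
    (fun s _ ↦ integral_nonneg fun x ↦ mul_nonneg (sq_nonneg _) (gradSq_nonneg _ _))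
    (fun s _ ↦ add_nonneg (mul_nonneg (by positivity) (integral_nonneg fun x ↦ norm_nonneg _))
      (mul_nonneg (by positivity) (integral_nonneg fun x ↦ sq_nonneg _)))
    (fun s hs ↦ setIntegral_eq_add_integral (μ := vol n M) hK
      (e := fun s x ↦ χ x ^ 2 * (‖u s x‖ ^ 2 / 2))
      (fun r hr x ↦ (hasDerivWithinAt_normSq hT hu x hr).const_mul (χ x ^ 2))
      (hχ2.mul (hE.div_const 2)) (hχ2.mul hD) hs)
    (fun s hs ↦ by
      have := setIntegral_sq_mul_inner_le hν hRic (smoothAt_of_contMDiffOn hu hs)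
        (hsol.contMDiffAt_pressure hs) (hsol.incompressible s hs) (hsol.momentum s hs)
        (continuous_slice (f := fun s x ↦
          (inner ℝ (derivWithin (fun s ↦ u s x) (Icc 0 T) s) (u s x) : ℝ)) hD hs)
        (continuous_slice (f := fun s x ↦ gradSq (u s) x) hG hs) hL0 hχ0 hχ1 hL hχ hK hχK
      linarith) ht
  rw [intervalIntegral.integral_add (iF.const_mul _) (iE.const_mul _),
    intervalIntegral.integral_const_mul, intervalIntegral.integral_const_mul, hsol.initial] at key
  exact key

/-- The localized energy inequality between a ball and the whole space. -/
lemma IsSmoothSolution.energy_closedBall_le [CompleteSpace M] (hsol : IsSmoothSolution ν T u₀ u p)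
    (hint : HasIntegrableEnergy T u p) (hν : 0 < ν) (hT : 0 < T) (hRic : RicciBoundedBelow n M κ)
    (o : M) {R : ℝ} (hR : 1 ≤ R) {t : ℝ} (ht : t ∈ Icc 0 T) :
    ENNReal.ofReal (1 / 2) * ∫⁻ x in Metric.closedBall o R, ENNReal.ofReal (‖u t x‖ ^ 2) ∂(vol n M)
        + ENNReal.ofReal (ν * (1 - 1 / R)) * ∫⁻ s in Icc 0 t, ∫⁻ x in Metric.closedBall o R,
          ENNReal.ofReal (gradSq (u s) x) ∂(vol n M)
      ≤ (ENNReal.ofReal (1 / 2) * normSq u₀ + ENNReal.ofReal (1 / R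
          * (2 * (∫⁻ t in Icc 0 T, ∫⁻ x,
            ENNReal.ofReal ‖(‖u t x‖ ^ 2 / 2 + p t x) • u t x‖ ∂(vol n M)).toReal
            + ν * (∫⁻ t in Icc 0 T, normSq (u t)).toReal)))
        * ENNReal.ofReal (Real.exp (2 * ν * t * max κ 0)) := by
  have hR0 : 0 < R := zero_lt_one.trans_le hR
  have hL1 : 1 / R ≤ 1 := (div_le_one hR0).2 hR
  have hu : SmoothPath T u := hsol.smooth_velocity
  have hE := continuousOn_norm_sq_path hu
  have hG := continuousOn_gradSq hT hu
  have hF := hsol.continuousOn_flux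
  -- Completeness enters here: it makes the support of the cutoff compact.
  have hK : IsCompact (Metric.closedBall o (2 * R)) := isCompact_closedBall_of_complete n o _
  have hB : IsCompact (Metric.closedBall o R) := isCompact_closedBall_of_complete n o _
  have hBK : Metric.closedBall o R ⊆ Metric.closedBall o (2 * R) :=
    Metric.closedBall_subset_closedBall (by linarith)
  have key := hsol.localized_energy_le hν.le hT hRic (by positivity) hL1 (cutoff_nonneg o)
    (cutoff_le_one o) (abs_cutoff_sub_le o hR0) (continuous_cutoff o) hK
    (fun x hx ↦ cutoff_eq_zero o hR0 hx) ht
  have hslice : ∀ s ∈ Icc 0 T, Continuous fun x ↦ ‖u s x‖ ^ 2 := fun s hs ↦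
    (continuous_norm (smoothAt_of_contMDiffOn hu hs)).pow 2
  have hof : ∀ s ∈ Icc 0 T, ENNReal.ofReal (∫ x in Metric.closedBall o (2 * R),
      cutoff o R x ^ 2 * (‖u s x‖ ^ 2 / 2) ∂(vol n M)) = ∫⁻ x in Metric.closedBall o (2 * R),
      ENNReal.ofReal (cutoff o R x ^ 2 * (‖u s x‖ ^ 2 / 2)) ∂(vol n M) := fun s hs ↦ by
    have hc : Continuous fun x ↦ cutoff o R x ^ 2 * (‖u s x‖ ^ 2 / 2) :=
      ((continuous_cutoff o).pow 2).mul ((hslice s hs).div_const 2)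
    exact ofReal_integral_eq_lintegral_ofReal (hc.continuousOn.integrableOn_compact hK)
      (.of_forall fun x ↦ by positivity)
  have e2 : ENNReal.ofReal (∫ s in 0..t, ∫ x in Metric.closedBall o (2 * R),
      cutoff o R x ^ 2 * gradSq (u s) x ∂(vol n M)) = ∫⁻ s in Icc 0 t,
        ∫⁻ x in Metric.closedBall o (2 * R),
          ENNReal.ofReal (cutoff o R x ^ 2 * gradSq (u s) x) ∂(vol n M) := by
    refine ofReal_integral_setIntegral (T := T) hK (ContinuousOn.mul ?_ hG)
      (fun s x ↦ mul_nonneg (sq_nonneg _) (gradSq_nonneg _ _)) ht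
    exact (((continuous_cutoff o).comp continuous_snd).pow 2).continuousOn
  have l1 : ENNReal.ofReal (1 / 2) * ∫⁻ x in Metric.closedBall o R,
      ENNReal.ofReal (‖u t x‖ ^ 2) ∂(vol n M) ≤ ENNReal.ofReal (∫ x in Metric.closedBall o (2 * R),
        cutoff o R x ^ 2 * (‖u t x‖ ^ 2 / 2) ∂(vol n M)) := by
    rw [hof t ht, ← lintegral_const_mul' _ _ ENNReal.ofReal_ne_top]
    refine le_trans (setLIntegral_mono' hB.measurableSet fun x hx ↦ ?_) (lintegral_mono_set hBK)
    rw [cutoff_eq_one o hR0 hx, ← ENNReal.ofReal_mul (by norm_num)]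
    exact ENNReal.ofReal_le_ofReal (by linarith)
  have l2 : ∫⁻ s in Icc 0 t, ∫⁻ x in Metric.closedBall o R, ENNReal.ofReal (gradSq (u s) x) ∂(vol n M)
      ≤ ENNReal.ofReal (∫ s in 0..t, ∫ x in Metric.closedBall o (2 * R),
        cutoff o R x ^ 2 * gradSq (u s) x ∂(vol n M)) := by
    rw [e2]
    refine lintegral_mono fun s ↦ le_trans (setLIntegral_mono' hB.measurableSet fun x hx ↦ ?_)
      (lintegral_mono_set hBK)
    rw [cutoff_eq_one o hR0 hx, one_pow, one_mul]
  have l0 : ENNReal.ofReal (∫ x in Metric.closedBall o (2 * R),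
      cutoff o R x ^ 2 * (‖u₀ x‖ ^ 2 / 2) ∂(vol n M)) ≤ ENNReal.ofReal (1 / 2) * normSq u₀ := by
    rw [← hsol.initial, hof 0 (left_mem_Icc.2 hT.le), normSq,
      ← lintegral_const_mul' _ _ ENNReal.ofReal_ne_top]
    refine le_trans (lintegral_mono fun x ↦ ?_) (setLIntegral_le_lintegral _ _)
    rw [← ENNReal.ofReal_mul (by norm_num)]
    refine ENNReal.ofReal_le_ofReal ?_
    have h1 : cutoff o R x ^ 2 ≤ 1 := pow_le_one₀ (cutoff_nonneg o x) (cutoff_le_one o x)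
    have h2 := mul_le_mul_of_nonneg_right h1 (by positivity : 0 ≤ ‖u 0 x‖ ^ 2 / 2)
    linarith
  have lF : ∫ s in 0..T, ∫ x in Metric.closedBall o (2 * R),
      ‖(‖u s x‖ ^ 2 / 2 + p s x) • u s x‖ ∂(vol n M) ≤ (∫⁻ t in Icc 0 T, ∫⁻ x,
        ENNReal.ofReal ‖(‖u t x‖ ^ 2 / 2 + p t x) • u t x‖ ∂(vol n M)).toReal := by
    -- Finiteness of the flux is essential: `toReal` of an infinite integral would be 0.
    rw [← ENNReal.ofReal_le_iff_le_toReal hint.flux.ne, ofReal_integral_setIntegral hK hF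
      (fun s x ↦ norm_nonneg _) (right_mem_Icc.2 hT.le)]
    exact lintegral_mono fun s ↦ setLIntegral_le_lintegral _ _
  have lE : ∫ s in 0..T, ∫ x in Metric.closedBall o (2 * R), ‖u s x‖ ^ 2 ∂(vol n M)
      ≤ (∫⁻ t in Icc 0 T, normSq (u t)).toReal := by
    rw [← ENNReal.ofReal_le_iff_le_toReal hint.energy.ne, ofReal_integral_setIntegral hK hE
      (fun s x ↦ sq_nonneg _) (right_mem_Icc.2 hT.le)]
    exact lintegral_mono fun s ↦ setLIntegral_le_lintegral _ _
  set A₀ := ∫ x in Metric.closedBall o (2 * R), cutoff o R x ^ 2 * (‖u₀ x‖ ^ 2 / 2) ∂(vol n M)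
  set A₁ := ∫ x in Metric.closedBall o (2 * R), cutoff o R x ^ 2 * (‖u t x‖ ^ 2 / 2) ∂(vol n M)
  set A₂ := ∫ s in 0..t, ∫ x in Metric.closedBall o (2 * R),
        cutoff o R x ^ 2 * gradSq (u s) x ∂(vol n M)
  have hA₁ : 0 ≤ A₁ := integral_nonneg fun x ↦ by positivity
  have hA₀ : 0 ≤ A₀ := integral_nonneg fun x ↦ by positivity
  have hA₂ : 0 ≤ A₂ := intervalIntegral.integral_nonneg ht.1 fun s _ ↦ integral_nonneg fun x ↦
    mul_nonneg (sq_nonneg _) (gradSq_nonneg _ _)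
  have hνL : 0 ≤ ν * (1 - 1 / R) := mul_nonneg hν.le (sub_nonneg.2 hL1)
  set F := (∫⁻ t in Icc 0 T, ∫⁻ x,
        ENNReal.ofReal ‖(‖u t x‖ ^ 2 / 2 + p t x) • u t x‖ ∂(vol n M)).toReal
  set N := (∫⁻ t in Icc 0 T, normSq (u t)).toReal
  have hF0 : 0 ≤ F := ENNReal.toReal_nonneg
  have hN0 : 0 ≤ N := ENNReal.toReal_nonneg
  have hfin : A₁ + ν * (1 - 1 / R) * A₂ ≤ (A₀ + 1 / R * (2 * F + ν * N))
      * Real.exp (2 * ν * t * max κ 0) := by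
    rw [show 2 * ν * t * max κ 0 = 2 * ν * max κ 0 * t by ring]
    refine key.trans (mul_le_mul_of_nonneg_right ?_ (Real.exp_pos _).le)
    have h1 := mul_le_mul_of_nonneg_left lF (by positivity : 0 ≤ 2 * (1 / R))
    have h2 := mul_le_mul_of_nonneg_left lE (by positivity : 0 ≤ ν * (1 / R))
    linarith
  calc _ ≤ ENNReal.ofReal A₁ + ENNReal.ofReal (ν * (1 - 1 / R)) * ENNReal.ofReal A₂ := by
        gcongr
    _ = ENNReal.ofReal (A₁ + ν * (1 - 1 / R) * A₂) := by
        rw [← ENNReal.ofReal_mul hνL, ← ENNReal.ofReal_add hA₁ (mul_nonneg hνL hA₂)]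
    _ ≤ _ := ENNReal.ofReal_le_ofReal hfin
    _ = (ENNReal.ofReal A₀ + ENNReal.ofReal (1 / R * (2 * F + ν * N)))
        * ENNReal.ofReal (Real.exp (2 * ν * t * max κ 0)) := by
        rw [ENNReal.ofReal_mul (by positivity), ENNReal.ofReal_add hA₀ (by positivity)]
    _ ≤ _ := by gcongr

end Energy

/-! ### Exhaustion of the manifold by balls. -/

section Limit

variable {n : ℕ} {M : Type*} [MetricSpace M] [SecondCountableTopology M]
  [MeasurableSpace M] [BorelSpace M]
  [ChartedSpace (EuclideanSpace ℝ (Fin n)) M] [IsManifold (𝓡 n) ∞ M]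
  [RiemannianBundle (fun x : M ↦ TangentSpace (𝓡 n) x)]
  [IsContMDiffRiemannianBundle (𝓡 n) ∞ (EuclideanSpace ℝ (Fin n))
      (fun x : M ↦ TangentSpace (𝓡 n) x)]
  [IsRiemannianManifold (𝓡 n) M] [CompleteSpace M]
  {κ ν T : ℝ} {u₀ : VField n M} {u : ℝ → VField n M} {p : ℝ → M → ℝ}

/-- The radii tend to infinity: the integrals on the left increase to those over `M` and the cutoff
error is O(1/R). Working in [0, ∞] requires no assumption on the norm of `u₀`. -/
lemma IsSmoothSolution.energy_le (hsol : IsSmoothSolution ν T u₀ u p)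
    (hint : HasIntegrableEnergy T u p) (hν : 0 < ν) (hT : 0 < T) (hRic : RicciBoundedBelow n M κ)
    (o : M) {t : ℝ} (ht : t ∈ Icc 0 T) :
    ENNReal.ofReal (1 / 2) * normSq (u t)
        + ENNReal.ofReal ν * ∫⁻ s in Icc 0 t, gradNormSq (u s)
      ≤ ENNReal.ofReal (1 / 2) * normSq u₀ * ENNReal.ofReal (Real.exp (2 * ν * t * max κ 0)) := by
  have hu : SmoothPath T u := hsol.smooth_velocity
  have hG := continuousOn_gradSq hT hu
  let R : ℕ → ℝ := fun k ↦ k + 1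
  have hR1 : ∀ k, 1 ≤ R k := fun k ↦ le_add_of_nonneg_left (Nat.cast_nonneg k)
  have hR : Filter.Tendsto R Filter.atTop Filter.atTop :=
    Filter.tendsto_atTop_add_const_right _ _ tendsto_natCast_atTop_atTop
  have hRmono : Monotone R := fun i j hij ↦ by simpa [R] using hij
  have hinv : Filter.Tendsto (fun k ↦ 1 / R k) Filter.atTop (𝓝 0) := by
    simpa [R] using tendsto_one_div_add_atTop_nhds_zero_nat (𝕜 := ℝ)
  have hcover : AECover (vol n M) Filter.atTop fun k ↦ Metric.closedBall o (R k) :=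
    aecover_closedBall hR
  have hcont : ∀ s ∈ Icc 0 T, Continuous (gradSq (u s)) := fun s hs ↦
    continuous_slice (f := fun s x ↦ gradSq (u s) x) hG hs
  have hlim1 : Filter.Tendsto (fun k ↦ ∫⁻ x in Metric.closedBall o (R k),
      ENNReal.ofReal (‖u t x‖ ^ 2) ∂(vol n M)) Filter.atTop (𝓝 (normSq (u t))) :=
    hcover.lintegral_tendsto_of_countably_generated
      ((continuous_norm (smoothAt_of_contMDiffOn hu ht)).pow 2).measurable.ennreal_ofReal.aemeasurable
  have hlim2 : Filter.Tendsto (fun k ↦ ∫⁻ s in Icc 0 t, ∫⁻ x in Metric.closedBall o (R k),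
      ENNReal.ofReal (gradSq (u s) x) ∂(vol n M)) Filter.atTop
        (𝓝 (∫⁻ s in Icc 0 t, gradNormSq (u s))) := by
    refine lintegral_tendsto_of_tendsto_of_monotone (fun k ↦ ?_) ?_ ?_
    · exact aemeasurable_setLIntegral (T := T) (f := fun s x ↦ gradSq (u s) x)
        (isCompact_closedBall_of_complete n o (R k)) hG ht.2
    · exact .of_forall fun s i j hij ↦ lintegral_mono_set
        (Metric.closedBall_subset_closedBall (hRmono hij))
    · filter_upwards [ae_restrict_mem measurableSet_Icc] with s hs
      exact hcover.lintegral_tendsto_of_countably_generated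
        (hcont s ⟨hs.1, hs.2.trans ht.2⟩).measurable.ennreal_ofReal.aemeasurable
  set A : ℝ := 2 * (∫⁻ t in Icc 0 T, ∫⁻ x,
      ENNReal.ofReal ‖(‖u t x‖ ^ 2 / 2 + p t x) • u t x‖ ∂(vol n M)).toReal
      + ν * (∫⁻ t in Icc 0 T, normSq (u t)).toReal
  have hlim3 : Filter.Tendsto (fun k ↦ ENNReal.ofReal (ν * (1 - 1 / R k))) Filter.atTop
      (𝓝 (ENNReal.ofReal ν)) := by
    refine ENNReal.tendsto_ofReal ?_
    simpa using (hinv.const_sub 1).const_mul ν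
  have hlim4 : Filter.Tendsto (fun k ↦ ENNReal.ofReal (1 / R k * A)) Filter.atTop (𝓝 0) := by
    rw [← ENNReal.ofReal_zero]
    refine ENNReal.tendsto_ofReal ?_
    simpa using hinv.mul_const A
  -- The total dissipation is not yet known to be finite, and limits of products in [0, ∞] fail for
  -- 0 · ∞; the positivity of ν excludes this.
  have hleft := (ENNReal.Tendsto.const_mul (a := ENNReal.ofReal (1 / 2)) hlim1
    (Or.inr ENNReal.ofReal_ne_top)).add (ENNReal.Tendsto.mul hlim3
      (Or.inl (ENNReal.ofReal_pos.2 hν).ne') hlim2 (Or.inr ENNReal.ofReal_ne_top))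
  have hright := ENNReal.Tendsto.mul_const (b := ENNReal.ofReal (Real.exp (2 * ν * t * max κ 0)))
    ((tendsto_const_nhds (x := ENNReal.ofReal (1 / 2) * normSq u₀)).add hlim4)
    (Or.inr ENNReal.ofReal_ne_top)
  rw [add_zero] at hright
  exact le_of_tendsto_of_tendsto' hleft hright fun k ↦
    hsol.energy_closedBall_le hint hν hT hRic o (hR1 k) ht

end Limit

end RiemNS

end

/-! ### Degenerate cases and conclusion. -/

theorem mainTheorem12 {n : ℕ} {M : Type*} [MetricSpace M] [SecondCountableTopology M]
    [MeasurableSpace M] [BorelSpace M]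
    [ChartedSpace (EuclideanSpace ℝ (Fin n)) M] [IsManifold (𝓡 n) ∞ M]
    [RiemannianBundle (fun x : M ↦ TangentSpace (𝓡 n) x)]
    [IsContMDiffRiemannianBundle (𝓡 n) ∞ (EuclideanSpace ℝ (Fin n))
      (fun x : M ↦ TangentSpace (𝓡 n) x)]
    [IsRiemannianManifold (𝓡 n) M] [CompleteSpace M]
    (κ : ℝ) (hRic : RiemNS.RicciBoundedBelow n M κ)
    (ν T : ℝ) (hν : 0 < ν)
    (u₀ : RiemNS.VField n M) (u : ℝ → RiemNS.VField n M) (p : ℝ → M → ℝ)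
    (hsol : RiemNS.IsSmoothSolution ν T u₀ u p)
    (hint : RiemNS.HasIntegrableEnergy T u p) :
    ∀ t ∈ Icc (0 : ℝ) T,
      ENNReal.ofReal (1 / 2) * RiemNS.normSq (u t)
          + ENNReal.ofReal ν * ∫⁻ s in Icc (0 : ℝ) t, RiemNS.gradNormSq (u s)
        ≤ ENNReal.ofReal (1 / 2) * RiemNS.normSq u₀
          * ENNReal.ofReal (Real.exp (2 * ν * t * max κ 0)) := by
  intro t ht
  -- If T = 0, only t = 0 occurs and the time integral is over a null set.
  rcases (ht.1.trans ht.2).eq_or_lt with hT | hT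
  · obtain rfl : t = 0 := le_antisymm (hT ▸ ht.2) ht.1
    simp [hsol.initial]
  -- The balls need a centre; on the empty manifold all integrals vanish.
  rcases isEmpty_or_nonempty M with hM | ⟨⟨o⟩⟩
  · simp [RiemNS.normSq, RiemNS.gradNormSq]
  · exact hsol.energy_le hint hν hT hRic o ht
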